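/- Let $d\ge 2$ and $m\ge 2$ be fixed integers and let $1<p_1<p_2<\dots<p_m$ be fixed pairwise coprime integers. Let $\mathcal S=\{p_1^{\alpha_1}\cdots p_m^{\alpha_m} : \alpha_1,\dots,\alpha_m\in\mathbb Z_{\ge 0}\}$. A multi-base representation of a positive integer $n$ is a family $(a_h)_{h\in\mathcal S}$ of digits $a_h\in\{0,1,\dots,d-1\}$, only finitely many of them non-zero, with $n=\sum_{h\in\mathcal S}a_h h$; its sum of digits is $\sum_{h\in\mathcal S}a_h$. Put $$\kappa=\frac{\log d}{m!}\prod_{j=1}^m\frac1{\log p_j}.$$ Every sufficiently large $n$ has at least one such representation, and the number of them is finite. For such $n$, let $X_n$ be the sum of digits of a uniformly random multi-base representation of $n$, with mean $\mu_n=\mathbb E X_n$ and variance $\sigma_n^2=\mathbb V X_n$. Then, as $n\to\infty$, $X_n$ is asymptotically Gaussian, i.e. for every $x\in\mathbb R$ $$\mathbb P\Big(\frac{X_n-\mu_n}{\sigma_n}\le x\Big)\longrightarrow\frac1{\sqrt{2\pi}}\int_{-\infty}^x e^{-t^2/2}\,dt,$$ and $$\mu_n=\frac{\kappa(d-1)}{2\log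 d}(\log n)^m+O\big((\log n)^{m-1}\log\log n\big),\qquad \sigma_n^2=\frac{\kappa(d-1)(d+1)}{12\log d}(\log n)^m+O\big((\log n)^{m-1}\log\log n\big).$$ The implied constants may depend on $d$, $m$ and $p_1,\dots,p_m$. -/

import Mathlib

open Filter Topology Asymptotics

noncomputable section

namespace MultiBase

/-- The set `S` of all products `p_1 ^ α_1 * ⋯ * p_m ^ α_m` with non-negative integer exponents. -/
def baseSet {m : ℕ} (p : Fin m → ℕ) : Set ℕ :=
  Set.range fun α : Fin m → ℕ => ∏ j, p j ^ α j

/-- `a` is a multi-base representation of `n` with bases `p` and digits `0, …, d - 1`: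
`a h` is the digit attached to `h`, it vanishes for all but finitely many `h` and for all `h ∉ S`,
and `n = ∑ a h * h`. -/
structure IsRep {m : ℕ} (p : Fin m → ℕ) (d n : ℕ) (a : ℕ →₀ ℕ) : Prop where
  support_subset : ∀ h ∈ a.support, h ∈ baseSet p
  digit_lt : ∀ h, a h < d
  sum_eq : (a.sum fun h c => c * h) = n

open Classical in
/-- The finite set of all multi-base representations of `n`. When all bases are positive, a term
`h` with non-zero digit satisfies `1 ≤ h ≤ n`, so the ambient finite set loses nothing
(see `mem_reps`). -/
def reps {m : ℕ} (p : Fin m → ℕ) (d n : ℕ) : Finset (ℕ →₀ ℕ) :=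
  ((Finset.Icc 1 n).finsupp fun _ => Finset.range d).filter (IsRep p d n)

theorem mem_reps {m : ℕ} {p : Fin m → ℕ} (hp : ∀ j, 0 < p j) {d n : ℕ} {a : ℕ →₀ ℕ} :
    a ∈ reps p d n ↔ IsRep p d n a := by
  classical
  unfold reps
  rw [Finset.mem_filter, Finset.mem_finsupp_iff]
  refine ⟨fun h => h.2, fun h => ⟨⟨fun k hk => ?_, fun k _ => ?_⟩, h⟩⟩
  · obtain ⟨α, hα⟩ := h.support_subset k hk
    have hk0 : 0 < k := by
      rw [← hα]
      exact Finset.prod_pos fun j _ => pow_pos (hp j) _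
    have h1 : a k * k ≤ n := by
      rw [← h.sum_eq]
      exact Finset.single_le_sum (f := fun i => a i * i) (fun i _ => Nat.zero_le _) hk
    have h2 : 1 ≤ a k := Nat.one_le_iff_ne_zero.mpr (Finsupp.mem_support_iff.mp hk)
    exact Finset.mem_Icc.mpr ⟨hk0, le_trans (Nat.le_mul_of_pos_left k h2) h1⟩
  · exact Finset.mem_range.mpr (h.digit_lt k)

/-- The sum of digits of a representation. -/
def digitSum (a : ℕ →₀ ℕ) : ℕ := a.sum fun _ c => c

/-- The expectation of `f` at a uniformly random multi-base representation of `n`. -/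
def expect {m : ℕ} (p : Fin m → ℕ) (d n : ℕ) (f : (ℕ →₀ ℕ) → ℝ) : ℝ :=
  (∑ a ∈ reps p d n, f a) / (reps p d n).card

open Classical in
/-- The probability that a uniformly random multi-base representation of `n` satisfies `A`. -/
def prob {m : ℕ} (p : Fin m → ℕ) (d n : ℕ) (A : (ℕ →₀ ℕ) → Prop) : ℝ :=
  (((reps p d n).filter A).card : ℝ) / (reps p d n).card

/-- The mean of the sum of digits of a uniformly random representation of `n`. -/
def mean {m : ℕ} (p : Fin m → ℕ) (d n : ℕ) : ℝ :=
  expect p d n fun a => (digitSum a : ℝ)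

/-- The variance of the sum of digits of a uniformly random representation of `n`. -/
def variance {m : ℕ} (p : Fin m → ℕ) (d n : ℕ) : ℝ :=
  expect p d n fun a => ((digitSum a : ℝ) - mean p d n) ^ 2

/-- The constant `κ = (log d / m!) * ∏ 1 / log p_j`. -/
def kappa {m : ℕ} (p : Fin m → ℕ) (d : ℕ) : ℝ :=
  Real.log d / (m.factorial : ℝ) * ∏ j, 1 / Real.log (p j)

end MultiBase

end

/-! Write k = m - 1 and L = log n. Give each h ∈ S with h ≤ n an independent random digit with
weights proportional to exp(-j r h). The joint weight of a digit family depends only on its value ∑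
a_h h, so conditioning on value n gives exactly the uniform law on representations of n, for every r
> 0. The parameter r is chosen to make the expected value equal to n (`exists_isTilt`). Then r n
lies between 1 and C L^k, so log (1/r) = L - O(log log n).

Conditional expectations of products of digit functions are ratios of Fourier integrals
(`avg_prod_mul_tiltProb`), whose denominator is the probability of hitting n. The value is governed
by the terms h of size about 1/r. There are about L^k of these, so its standard deviation is of
order s / r with s = √(L^k), and `exists_tiltProb_ge` gives probability at least c r / s. The digit
sum, in contrast, receives comparable contributions from all of the roughly L^(k+1) terms below 1/r.
Conditioning on the value therefore hardly affects it.

This is made quantitative by a covariance bound. The digit at h and its phase exp(2πi j h θ) are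
nearly uncorrelated, with error `shift`, whose sum over h is O(L^k |θ| / r). Against the
Gaussian-sized Fourier transform this integrates to O(r) (`exists_integral_decay_mul_shiftSum_le`).
Division by c r / s gives conditional mean error O(s) and second moment error O(s²) for the centred
digit sum. At frequency τ/σ the conditional and independent characteristic functions then differ by
O(L^(-1/2)). The independent case is a Taylor expansion, and Lévy's theorem finishes. The main terms
come from counting S up to 1/r (`card_expSet_bounds`), where digits are nearly uniform on 0, …, d -
1; the gap between log (1/r) and log n produces the log log n in the error.

Away from θ = 0 two bounds for the Fourier transform are combined, with M = 1/r. Pointwise it is at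
most a negative power of M (`exists_decay_exponent_ge`): two coprime bases prevent all p^a q^b θ
from being near integers. That alone is too weak, as that power may be small; but the total mass is
M⁻¹ up to powers of log M (`exists_integral_decay_le`). Half of the exponent is spent on each bound
(`exists_decay_le`). -/

namespace MultiBase

/-! ### Distance to the integers and the pointwise minor arc bound -/

/-- The quantity `1 - cos (2 π y)`, comparable to the squared distance of `y` to the nearest
integer. -/
noncomputable def cosGap (y : ℝ) : ℝ := 1 - Real.cos (2 * Real.pi * y)

theorem cosGap_nonneg (y : ℝ) : 0 ≤ cosGap y := by
  unfold cosGap; linarith [Real.cos_le_one (2 * Real.pi * y)]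

theorem cosGap_le_two (y : ℝ) : cosGap y ≤ 2 := by
  unfold cosGap; linarith [Real.neg_one_le_cos (2 * Real.pi * y)]

theorem cosGap_add_int (y : ℝ) (k : ℤ) : cosGap (y + k) = cosGap y := by
  unfold cosGap
  rw [show 2 * Real.pi * (y + k) = 2 * Real.pi * y + k * (2 * Real.pi) by ring,
    Real.cos_add_int_mul_two_pi]

theorem continuous_cosGap : Continuous cosGap := by unfold cosGap; fun_prop

theorem cosGap_ge_sq {y : ℝ} (hy : |y| ≤ 1 / 2) : 8 * y ^ 2 ≤ cosGap y := by
  have hpi := Real.pi_pos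
  have h : |2 * Real.pi * y| ≤ Real.pi := by
    rw [abs_mul, abs_of_pos (by positivity)]
    nlinarith
  have := Real.cos_le_one_sub_mul_cos_sq h
  have h2 : 2 / Real.pi ^ 2 * (2 * Real.pi * y) ^ 2 = 8 * y ^ 2 := by
    field_simp; ring
  unfold cosGap; linarith

theorem cosGap_le_sq (y : ℝ) : cosGap y ≤ 20 * y ^ 2 := by
  have := Real.one_sub_sq_div_two_le_cos (x := 2 * Real.pi * y)
  have h3 : Real.pi ^ 2 ≤ 10 := by nlinarith [Real.pi_lt_d2, Real.pi_pos]
  unfold cosGap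
  nlinarith [sq_nonneg y, mul_le_mul_of_nonneg_right h3 (sq_nonneg y)]

/-- Since `cosGap y` is half of |exp(2πiy) - 1|², this is the triangle inequality for chords
followed by (a + b)² ≤ 2a² + 2b². It later absorbs the frequency shift caused by a characteristic
function argument. -/
theorem cosGap_le_add (x δ : ℝ) : cosGap x ≤ 2 * cosGap (x + δ) + 2 * cosGap δ := by
  unfold cosGap
  have h : 2 * Real.pi * x = 2 * Real.pi * (x + δ) - 2 * Real.pi * δ := by ring
  rw [h, Real.cos_sub]
  set u := 2 * Real.pi * (x + δ)
  set v := 2 * Real.pi * δ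
  nlinarith [sq_nonneg (2 - Real.cos u - Real.cos v), sq_nonneg (Real.sin u + Real.sin v),
    Real.sin_sq_add_cos_sq u, Real.sin_sq_add_cos_sq v]

theorem cosGap_ge_round (y : ℝ) : 8 * (y - round y) ^ 2 ≤ cosGap y := by
  have h := cosGap_ge_sq (abs_sub_round y)
  have h2 := cosGap_add_int (y - round y) (round y)
  rw [sub_add_cancel] at h2
  linarith

theorem abs_sub_round_le_abs_sub (y : ℝ) (k : ℤ) : |y - round y| ≤ |y - k| := round_le y k

theorem cosGap_ge_of_far {y c : ℝ} (hc : 0 ≤ c) (h : c ≤ |y - round y|) :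
    8 * c ^ 2 ≤ cosGap y := by
  refine le_trans ?_ (cosGap_ge_round y)
  rw [← sq_abs (y - round y)]
  gcongr

theorem round_eq_of_abs_sub_lt {y : ℝ} {k : ℤ} (h : |y - k| < 1 / 2) : round y = k := by
  rw [abs_lt] at h
  rw [round_eq, Int.floor_eq_iff]
  constructor <;> linarith

/-- If all multiples `p ^ a * x` with `a ≤ A` are near to integers, then `x` is very near to an
integer. -/
theorem mul_abs_sub_round_lt {p : ℕ} (hp : 2 ≤ p) (x : ℝ) (A : ℕ)
    (h : ∀ a ≤ A, |(p : ℝ) ^ a * x - round ((p : ℝ) ^ a * x)| < 1 / (2 * p)) :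
    (p : ℝ) ^ A * |x - round x| < 1 / (2 * p) := by
  have hp0 : (0 : ℝ) < p := by positivity
  have hp2 : (2 : ℝ) ≤ p := by exact_mod_cast hp
  induction A with
  | zero => simpa using h 0 le_rfl
  | succ A ih =>
    have h1 := ih fun a ha => h a (by omega)
    have h2 : |(p : ℝ) ^ (A + 1) * x - ((p ^ (A + 1) * round x : ℤ) : ℝ)|
        = (p : ℝ) ^ (A + 1) * |x - round x| := by
      push_cast
      rw [← mul_sub, abs_mul, abs_of_pos (by positivity)]
    have h3 : (p : ℝ) ^ (A + 1) * |x - round x| < 1 / 2 := by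
      have : (p : ℝ) * ((p : ℝ) ^ A * |x - round x|) < p * (1 / (2 * p)) := by gcongr
      calc _ = (p : ℝ) * ((p : ℝ) ^ A * |x - round x|) := by ring
        _ < p * (1 / (2 * p)) := this
        _ = 1 / 2 := by field_simp
    -- The distance is below 1/2, so the nearest integer to p^(A+1) x is p^(A+1) times that of x.
    -- The hypothesis at exponent A + 1 then restores the bound 1/(2p) lost on multiplying by p.
    have h4 := round_eq_of_abs_sub_lt (h2 ▸ h3)
    have h5 := h (A + 1) le_rfl
    rwa [h4, h2] at h5

/-- If `q ^ b * θ` is close to an integer although `θ` is not, then some `q ^ b' * θ` is close to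
a fraction of denominator `q` that is not an integer. -/
theorem exists_near_fraction {q : ℕ} (hq : 2 ≤ q) {θ δ : ℝ}
    (h0 : δ ≤ |θ - round θ|) (b : ℕ)
    (hb : |(q : ℝ) ^ b * θ - round ((q : ℝ) ^ b * θ)| < (q : ℝ) ^ b * δ) :
    ∃ b' < b, ∃ k : ℤ, ¬ (q : ℤ) ∣ k ∧ |(q : ℝ) ^ b' * θ - k / q| < (q : ℝ) ^ b' * δ := by
  have hq0 : (0 : ℝ) < q := by positivity
  induction b with
  | zero => simp at hb; linarith
  | succ b ih =>
    set k := round ((q : ℝ) ^ (b + 1) * θ) with hk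
    have h1 : |(q : ℝ) ^ b * θ - k / q| < (q : ℝ) ^ b * δ := by
      have e : (q : ℝ) ^ b * θ - k / q = ((q : ℝ) ^ (b + 1) * θ - k) / q := by
        field_simp; ring
      rw [e, abs_div, abs_of_pos hq0, div_lt_iff₀ hq0]
      calc _ < (q : ℝ) ^ (b + 1) * δ := hb
        _ = _ := by ring
    -- If q divides k, the smaller multiple is itself near an integer and the descent continues. It
    -- cannot reach exponent 0, where `h0` forbids it.
    by_cases hd : (q : ℤ) ∣ k
    · obtain ⟨l, hl⟩ := hd
      have h2 : (k : ℝ) / q = (l : ℤ) := by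
        rw [hl]; push_cast; field_simp
      rw [h2] at h1
      obtain ⟨b', hb', r⟩ := ih (lt_of_le_of_lt (abs_sub_round_le_abs_sub _ _) h1)
      exact ⟨b', by omega, r⟩
    · exact ⟨b, by omega, k, hd, h1⟩

theorem fraction_far {q : ℕ} (hq : 2 ≤ q) {k : ℤ} (hk : ¬ (q : ℤ) ∣ k) (l : ℤ) :
    1 / (q : ℝ) ≤ |(k : ℝ) / q - l| := by
  have hq0 : (0 : ℝ) < q := by positivity
  have e : (k : ℝ) / q - l = ((k - q * l : ℤ) : ℝ) / q := by push_cast; field_simp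
  rw [e, abs_div, abs_of_pos hq0]
  gcongr
  have : k - q * l ≠ 0 := fun h => hk ⟨l, by linarith⟩
  exact_mod_cast Int.one_le_abs this

/-- Far away from the integers, many terms `h * θ` with `h = p ^ a * q ^ b ≤ M` are far from the
integers. -/
theorem sum_cosGap_ge {p q : ℕ} (hp : 2 ≤ p) (hq : 2 ≤ q) (hpq : p.Coprime q) {M : ℝ}
    {T : Finset ℕ} (hT : ∀ a b : ℕ, (p : ℝ) ^ a * (q : ℝ) ^ b ≤ M → p ^ a * q ^ b ∈ T)
    {B l : ℕ} (hBl : (p : ℝ) ^ l * (q : ℝ) ^ B ≤ M) {θ : ℝ}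
    (hθ : 1 / (2 * M) ≤ |θ|) (hθ' : |θ| ≤ 1 / 2) :
    2 / ((p : ℝ) ^ 2 * q ^ 2) * min (B : ℝ) l ≤ ∑ h ∈ T, cosGap (h * θ) := by
  have hp0 : (0 : ℝ) < p := by positivity
  have hq0 : (0 : ℝ) < q := by positivity
  have hp1 : (1 : ℝ) ≤ p := by exact_mod_cast (by omega : 1 ≤ p)
  have hq1 : (1 : ℝ) ≤ q := by exact_mod_cast (by omega : 1 ≤ q)
  have hM1 : 1 ≤ M := le_trans (one_le_mul_of_one_le_of_one_le (one_le_pow₀ hp1)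
    (one_le_pow₀ hq1)) hBl
  have hM0 : 0 < M := by linarith
  have hδ : 1 / (2 * M) ≤ |θ - round θ| := by
    by_cases h0 : round θ = 0
    · simpa [h0] using hθ
    · have h1 : (1 : ℝ) ≤ |(round θ : ℝ)| := by exact_mod_cast Int.one_le_abs h0
      have h2 : |(round θ : ℝ)| ≤ |θ - round θ| + |θ| := by
        calc |(round θ : ℝ)| = |θ - (θ - round θ)| := by congr 1; ring
          _ ≤ |θ| + |θ - round θ| := abs_sub _ _
          _ = _ := by ring
      have : 1 / (2 * M) ≤ 1 / 2 := by
        rw [div_le_div_iff₀ (by positivity) (by norm_num)]; linarith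
      linarith
  -- Either every row b < B has a term far from the integers, giving B contributions, or some row
  -- stays near the integers throughout. The latter forces a column of l terms to be far from them.
  by_cases hrow : ∀ b < B, ∃ a, (p : ℝ) ^ a * (q : ℝ) ^ b ≤ M ∧
      1 / (2 * p) ≤ |(p : ℝ) ^ a * ((q : ℝ) ^ b * θ) - round ((p : ℝ) ^ a * ((q : ℝ) ^ b * θ))|
  · choose! f hf1 hf2 using hrow
    have hinj : Set.InjOn (fun b => p ^ f b * q ^ b) (Finset.range B : Set ℕ) := by
      intro b _ b' _ hbb
      have h1 : q ^ b ∣ q ^ b' := by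
        refine Nat.Coprime.dvd_of_dvd_mul_left ?_ (⟨p ^ f b, by
          rw [mul_comm (q ^ b)]; exact hbb.symm⟩ : q ^ b ∣ p ^ f b' * q ^ b')
        exact (Nat.Coprime.pow _ _ hpq).symm
      have h2 : q ^ b' ∣ q ^ b := by
        refine Nat.Coprime.dvd_of_dvd_mul_left ?_ (⟨p ^ f b', by
          rw [mul_comm (q ^ b')]; exact hbb⟩ : q ^ b' ∣ p ^ f b * q ^ b)
        exact (Nat.Coprime.pow _ _ hpq).symm
      exact Nat.pow_right_injective hq (Nat.dvd_antisymm h1 h2)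
    have hsub : (Finset.range B).image (fun b => p ^ f b * q ^ b) ⊆ T := by
      intro h hh
      obtain ⟨b, hb, rfl⟩ := Finset.mem_image.1 hh
      exact hT _ _ (hf1 b (Finset.mem_range.1 hb))
    calc 2 / ((p : ℝ) ^ 2 * q ^ 2) * min (B : ℝ) l ≤ 2 / (p : ℝ) ^ 2 * B := by
          gcongr
          · exact le_mul_of_one_le_right (by positivity) (one_le_pow₀ hq1)
          · exact min_le_left _ _
      _ = ∑ b ∈ Finset.range B, 8 * (1 / (2 * (p : ℝ))) ^ 2 := by
          simp; field_simp; ring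
      _ ≤ ∑ b ∈ Finset.range B, cosGap (((p ^ f b * q ^ b : ℕ) : ℝ) * θ) := by
          refine Finset.sum_le_sum fun b hb => ?_
          have := cosGap_ge_of_far (by positivity) (hf2 b (Finset.mem_range.1 hb))
          push_cast
          rwa [mul_assoc]
      _ = ∑ h ∈ (Finset.range B).image (fun b => p ^ f b * q ^ b), cosGap (h * θ) := by
          rw [Finset.sum_image hinj]
      _ ≤ _ := Finset.sum_le_sum_of_subset_of_nonneg hsub fun _ _ _ => cosGap_nonneg _
  · push Not at hrow
    obtain ⟨b, hb, hbad⟩ := hrow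
    have hqM : (1 : ℝ) ≤ M / q ^ b := by
      rw [le_div_iff₀ (by positivity), one_mul]
      refine le_trans ?_ hBl
      calc (q : ℝ) ^ b ≤ q ^ B := pow_le_pow_right₀ hq1 hb.le
        _ ≤ _ := le_mul_of_one_le_left (by positivity) (one_le_pow₀ hp1)
    obtain ⟨A, hA1, hA2⟩ := exists_nat_pow_near hqM
      (by exact_mod_cast (by omega : 1 < p) : (1 : ℝ) < p)
    -- A is maximal with p^A q^b ≤ M, so nearness along the whole row puts q^b θ within q^b / (2M)
    -- of an integer, although θ itself is at least 1/(2M) away.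
    have h1 := mul_abs_sub_round_lt hp ((q : ℝ) ^ b * θ) A fun a ha => hbad a (by
      rw [le_div_iff₀ (by positivity)] at hA1
      exact le_trans (by gcongr) hA1)
    have h2 : |(q : ℝ) ^ b * θ - round ((q : ℝ) ^ b * θ)| < (q : ℝ) ^ b * (1 / (2 * M)) := by
      rw [div_lt_iff₀ (by positivity)] at hA2
      rw [lt_div_iff₀ (by positivity)] at h1
      rw [mul_one_div, lt_div_iff₀ (by positivity)]
      set X := |(q : ℝ) ^ b * θ - round ((q : ℝ) ^ b * θ)|
      have hX : 0 ≤ X := abs_nonneg _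
      rcases hX.eq_or_lt with h | h
      · rw [← h]; simp; positivity
      calc X * (2 * M) < X * (2 * ((p : ℝ) ^ (A + 1) * q ^ b)) := by gcongr
        _ = (p ^ A * X * (2 * p)) * q ^ b := by ring
        _ ≤ 1 * q ^ b := by gcongr
        _ = _ := one_mul _
    obtain ⟨b', hb', k, hk, hk2⟩ := exists_near_fraction hq hδ b h2
    have hinj : Set.InjOn (fun a => p ^ a * q ^ b') (Finset.range l : Set ℕ) := by
      intro a _ a' _ haa
      exact Nat.pow_right_injective hp (Nat.eq_of_mul_eq_mul_right (by positivity) haa)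
    -- The exponent b' + 1 ≤ B leaves a spare factor q. Hence the error p^a q^b' / (2M) stays below
    -- 1/(2q), half the distance from a proper fraction k/q to the integers.
    have hle : ∀ a < l, (p : ℝ) ^ a * (q : ℝ) ^ (b' + 1) ≤ M := fun a ha =>
      le_trans (mul_le_mul (pow_le_pow_right₀ hp1 ha.le)
        (pow_le_pow_right₀ hq1 (by omega)) (by positivity) (by positivity)) hBl
    have hsub : (Finset.range l).image (fun a => p ^ a * q ^ b') ⊆ T := by
      intro h hh
      obtain ⟨a, ha, rfl⟩ := Finset.mem_image.1 hh
      exact hT _ _ (le_trans (by gcongr; omega) (hle a (Finset.mem_range.1 ha)))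
    calc 2 / ((p : ℝ) ^ 2 * q ^ 2) * min (B : ℝ) l ≤ 2 / (q : ℝ) ^ 2 * l := by
          gcongr
          · exact le_mul_of_one_le_left (by positivity) (one_le_pow₀ hp1)
          · exact min_le_right _ _
      _ = ∑ a ∈ Finset.range l, 8 * (1 / (2 * (q : ℝ))) ^ 2 := by
          simp; field_simp; ring
      _ ≤ ∑ a ∈ Finset.range l, cosGap (((p ^ a * q ^ b' : ℕ) : ℝ) * θ) := by
          refine Finset.sum_le_sum fun a ha => ?_
          refine cosGap_ge_of_far (by positivity) ?_
          push_cast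
          -- Coprimality of p and q enters here: multiplication by p^a keeps the fraction away from
          -- the integers.
          have hka : ¬ (q : ℤ) ∣ (p ^ a * k : ℤ) := by
            intro h
            refine hk (IsCoprime.dvd_of_dvd_mul_left ?_ h)
            exact (Nat.isCoprime_iff_coprime.2 hpq.symm).pow_right
          have h3 := fraction_far hq hka (round ((p : ℝ) ^ a * q ^ b' * θ))
          have h4 : |(p : ℝ) ^ a * q ^ b' * θ - ((p ^ a * k : ℤ) : ℝ) / q| ≤ 1 / (2 * q) := by
            have e : (p : ℝ) ^ a * q ^ b' * θ - ((p ^ a * k : ℤ) : ℝ) / q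
                = p ^ a * (q ^ b' * θ - k / q) := by push_cast; ring
            rw [e, abs_mul, abs_of_pos (by positivity)]
            have h5 := hle a (Finset.mem_range.1 ha)
            calc (p : ℝ) ^ a * |(q : ℝ) ^ b' * θ - k / q|
                ≤ p ^ a * (q ^ b' * (1 / (2 * M))) := by gcongr
              _ = (p ^ a * q ^ (b' + 1)) / (q * (2 * M)) := by field_simp; ring
              _ ≤ M / (q * (2 * M)) := by gcongr
              _ = _ := by field_simp
          have h6 : 1 / (q : ℝ) = 1 / (2 * q) + 1 / (2 * q) := by field_simp; norm_num
          set X := (p : ℝ) ^ a * q ^ b' * θ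
          have h7 : |((p ^ a * k : ℤ) : ℝ) / q - round X| ≤
              |X - ((p ^ a * k : ℤ) : ℝ) / q| + |X - round X| := by
            calc _ = |(X - round X) - (X - ((p ^ a * k : ℤ) : ℝ) / q)| := by congr 1; ring
              _ ≤ |X - round X| + |X - ((p ^ a * k : ℤ) : ℝ) / q| := abs_sub _ _
              _ = _ := by ring
          linarith
      _ = ∑ h ∈ (Finset.range l).image (fun a => p ^ a * q ^ b'), cosGap (h * θ) := by
          rw [Finset.sum_image hinj]
      _ ≤ _ := Finset.sum_le_sum_of_subset_of_nonneg hsub fun _ _ _ => cosGap_nonneg _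

end MultiBase

/-! ### Total mass of the Fourier majorant -/

namespace MultiBase

/-- The substitution x = pθ cuts [0, p] into p unit intervals on which H repeats. This is the
transfer operator of multiplication by p on the circle. -/
theorem integral_mul_comp_nat_mul {G H : ℝ → ℝ} (hG : Continuous G) (hH : Continuous H)
    (hper : Function.Periodic H 1) {p : ℕ} (hp : 0 < p) :
    ∫ θ in (0 : ℝ)..1, G θ * H (p * θ)
      = (p : ℝ)⁻¹ * ∫ x in (0 : ℝ)..1, (∑ j ∈ Finset.range p, G ((x + j) / p)) * H x := by
  have hp0 : (p : ℝ) ≠ 0 := by positivity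
  have h1 := intervalIntegral.integral_comp_mul_left (a := 0) (b := 1)
    (fun x => G (x / p) * H x) hp0
  simp only [mul_zero, mul_one, smul_eq_mul] at h1
  have h2 : ∀ θ : ℝ, (p : ℝ) * θ / p = θ := fun θ => by field_simp
  simp only [h2] at h1
  rw [h1]
  congr 1
  have hc : Continuous fun x => G (x / p) * H x := by fun_prop
  have h3 := intervalIntegral.sum_integral_adjacent_intervals (a := fun k => (k : ℝ)) (n := p)
    (fun k _ => hc.intervalIntegrable (μ := MeasureTheory.volume) _ _)
  simp only [Nat.cast_zero] at h3
  rw [← h3]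
  simp only [Finset.sum_mul]
  rw [intervalIntegral.integral_finsetSum]
  · refine Finset.sum_congr rfl fun j _ => ?_
    have h4 := intervalIntegral.integral_comp_add_right (a := 0) (b := 1)
      (fun x => G (x / p) * H x) (j : ℝ)
    simp only [zero_add] at h4
    push_cast
    rw [add_comm (j : ℝ) 1, ← h4]
    refine intervalIntegral.integral_congr fun x _ => ?_
    have := (hper.nat_mul j) x
    simp only [mul_one] at this
    simp only [this]
  · intro j _
    exact Continuous.intervalIntegrable (by fun_prop) _ _

theorem integral_comp_nat_mul {H : ℝ → ℝ} (hH : Continuous H)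
    (hper : Function.Periodic H 1) {p : ℕ} (hp : 0 < p) :
    ∫ θ in (0 : ℝ)..1, H (p * θ) = ∫ x in (0 : ℝ)..1, H x := by
  have := integral_mul_comp_nat_mul (G := fun _ => 1) continuous_const hH hper hp
  have hp0 : (p : ℝ) ≠ 0 := by positivity
  simp only [one_mul, Finset.sum_const, Finset.card_range, nsmul_eq_mul, mul_one,
    intervalIntegral.integral_const_mul] at this
  rw [this]; field_simp

/-- The weight of one row of the multiplicative lattice. -/
noncomputable def rowWeight (p : ℕ) (Λ : ℝ) (l : ℕ) (θ : ℝ) : ℝ :=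
  Real.exp (-Λ * ∑ a ∈ Finset.range l, cosGap ((p : ℝ) ^ a * θ))

theorem continuous_rowWeight (p : ℕ) (Λ : ℝ) (l : ℕ) : Continuous (rowWeight p Λ l) := by
  unfold rowWeight
  have := continuous_cosGap
  fun_prop

theorem rowWeight_periodic (p : ℕ) (Λ : ℝ) (l : ℕ) :
    Function.Periodic (rowWeight p Λ l) 1 := fun θ => by
  unfold rowWeight
  congr 2
  refine Finset.sum_congr rfl fun a _ => ?_
  have := cosGap_add_int ((p : ℝ) ^ a * θ) ((p : ℤ) ^ a)
  push_cast at this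
  rw [mul_add, mul_one, this]

theorem rowWeight_succ (p : ℕ) (Λ : ℝ) (l : ℕ) (θ : ℝ) :
    rowWeight p Λ (l + 1) θ = Real.exp (-Λ * cosGap θ) * rowWeight p Λ l (p * θ) := by
  unfold rowWeight
  rw [← Real.exp_add, ← mul_add, Finset.sum_range_succ', add_comm]
  simp only [pow_zero, one_mul, pow_succ, mul_assoc]

theorem cosGap_ge_of_mem {y c : ℝ} (hc : 0 ≤ c) (h1 : c ≤ y) (h2 : y ≤ 1 - c) :
    8 * c ^ 2 ≤ cosGap y := by
  rcases le_total y (1 / 2) with h | h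
  · refine le_trans ?_ (cosGap_ge_sq (abs_le.2 ⟨by linarith, h⟩))
    gcongr
  · have := cosGap_add_int (y - 1) 1
    rw [Int.cast_one, sub_add_cancel] at this
    rw [this]
    refine le_trans ?_ (cosGap_ge_sq (abs_le.2 ⟨by linarith, by linarith⟩))
    nlinarith

/-- The p preimages of x under multiplication by p are spaced by 1/p. All but one are at distance at
least 1/(2p) from the integers, where `cosGap` is at least 2/p². -/
theorem sum_exp_cosGap_le {p : ℕ} (hp : 2 ≤ p) {Λ : ℝ} (hΛ : 0 ≤ Λ) {x : ℝ} (hx0 : 0 ≤ x)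
    (hx1 : x ≤ 1) :
    ∑ j ∈ Finset.range p, Real.exp (-Λ * cosGap ((x + j) / p))
      ≤ 1 + p * Real.exp (-(2 * Λ / (p : ℝ) ^ 2)) := by
  have hp0 : (0 : ℝ) < p := by positivity
  have key : ∀ i ∈ Finset.range p, (∀ j ∈ (Finset.range p).erase i,
      1 / (2 * (p : ℝ)) ≤ (x + j) / p ∧ (x + j) / p ≤ 1 - 1 / (2 * p)) →
      ∑ j ∈ Finset.range p, Real.exp (-Λ * cosGap ((x + j) / p))
      ≤ 1 + p * Real.exp (-(2 * Λ / (p : ℝ) ^ 2)) := by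
    intro i hi h
    rw [← Finset.add_sum_erase _ _ hi]
    gcongr
    · rw [Real.exp_le_one_iff]
      nlinarith [cosGap_nonneg ((x + i) / p)]
    · calc _ ≤ ∑ j ∈ (Finset.range p).erase i, Real.exp (-(2 * Λ / (p : ℝ) ^ 2)) := by
            refine Finset.sum_le_sum fun j hj => ?_
            obtain ⟨h1, h2⟩ := h j hj
            have := cosGap_ge_of_mem (by positivity) h1 h2
            rw [Real.exp_le_exp]
            have e : 8 * (1 / (2 * (p : ℝ))) ^ 2 = 2 / p ^ 2 := by field_simp; norm_num
            rw [e] at this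
            have := mul_le_mul_of_nonneg_left this hΛ
            have e2 : 2 * Λ / (p : ℝ) ^ 2 = Λ * (2 / p ^ 2) := by ring
            rw [e2]; linarith
        _ ≤ _ := by
            rw [Finset.sum_const, nsmul_eq_mul]
            gcongr
            exact le_trans (Finset.card_le_card (Finset.erase_subset _ _)) (by simp)
  have e1 : (1 : ℝ) / (2 * p) = (1 / 2) / p := by field_simp
  have e2 : 1 - (1 : ℝ) / (2 * p) = (p - 1 / 2) / p := by field_simp
  rw [e2, e1] at key
  simp only [div_le_div_iff_of_pos_right hp0] at key
  -- The exceptional preimage is j = 0 when x ≤ 1/2, and j = p - 1 otherwise.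
  rcases le_total x (1 / 2) with h | h
  · refine key 0 (by simp; omega) fun j hj => ?_
    simp only [Finset.mem_erase, Finset.mem_range] at hj
    have h1 : (1 : ℝ) ≤ j := by exact_mod_cast Nat.one_le_iff_ne_zero.2 hj.1
    have h2 : (j : ℝ) + 1 ≤ p := by exact_mod_cast hj.2
    constructor <;> linarith
  · refine key (p - 1) (by simp; omega) fun j hj => ?_
    simp only [Finset.mem_erase, Finset.mem_range] at hj
    have h1 : (0 : ℝ) ≤ j := by positivity
    have h2 : (j : ℝ) + 2 ≤ p := by exact_mod_cast (by omega : j + 2 ≤ p)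
    constructor <;> linarith

/-- Each term of the row contributes one application of the transfer operator, which multiplies the
integral by at most (1 + p e^(-2Λ/p²)) / p. -/
theorem integral_rowWeight_le {p : ℕ} (hp : 2 ≤ p) {Λ : ℝ} (hΛ : 0 ≤ Λ) (l : ℕ) :
    ∫ θ in (0 : ℝ)..1, rowWeight p Λ l θ
      ≤ ((p : ℝ)⁻¹ * (1 + p * Real.exp (-(2 * Λ / (p : ℝ) ^ 2)))) ^ l := by
  induction l with
  | zero => simp [rowWeight]
  | succ l ih =>
    simp only [rowWeight_succ]
    rw [integral_mul_comp_nat_mul (by have := continuous_cosGap; fun_prop)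
      (continuous_rowWeight p Λ l) (rowWeight_periodic p Λ l) (by omega), pow_succ', mul_assoc]
    gcongr
    have hcr := continuous_rowWeight p Λ l
    have hcc := continuous_cosGap
    calc _ ≤ ∫ θ in (0 : ℝ)..1, (1 + p * Real.exp (-(2 * Λ / (p : ℝ) ^ 2))) * rowWeight p Λ l θ := by
          refine intervalIntegral.integral_mono_on (by norm_num)
            (Continuous.intervalIntegrable (by fun_prop) _ _)
            (Continuous.intervalIntegrable (by fun_prop) _ _) fun x hx => ?_
          gcongr
          · exact (Real.exp_pos _).le
          · exact sum_exp_cosGap_le hp hΛ hx.1 hx.2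
      _ ≤ _ := by
          rw [intervalIntegral.integral_const_mul]
          gcongr

/-- For Λ of order log l the correction (1 + ε)^l stays below e, so a row is as concentrated as the
ideal p^(-l). -/
theorem integral_rowWeight_le' {p : ℕ} (hp : 2 ≤ p) {Λ : ℝ} (hΛ : 0 ≤ Λ) {l : ℕ}
    (hl : l * (p * Real.exp (-(2 * Λ / (p : ℝ) ^ 2))) ≤ 1) :
    ∫ θ in (0 : ℝ)..1, rowWeight p Λ l θ ≤ 3 * ((p : ℝ) ^ l)⁻¹ := by
  refine (integral_rowWeight_le hp hΛ l).trans ?_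
  rw [mul_pow, inv_pow, mul_comm]
  gcongr
  calc (1 + p * Real.exp (-(2 * Λ / (p : ℝ) ^ 2))) ^ l
      ≤ (Real.exp (p * Real.exp (-(2 * Λ / (p : ℝ) ^ 2)))) ^ l := by
        gcongr
        rw [add_comm]; exact Real.add_one_le_exp _
    _ = Real.exp (l * (p * Real.exp (-(2 * Λ / (p : ℝ) ^ 2)))) := by rw [← Real.exp_nat_mul]
    _ ≤ Real.exp 1 := by gcongr
    _ ≤ 3 := by linarith [Real.exp_one_lt_d9]

/-- The decay function of the Fourier transform of a sum of independent digits. -/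
noncomputable def decay (c : ℝ) (T : Finset ℕ) (θ : ℝ) : ℝ :=
  Real.exp (-c * ∑ h ∈ T, cosGap (h * θ))

theorem continuous_decay (c : ℝ) (T : Finset ℕ) : Continuous (decay c T) := by
  unfold decay
  have := continuous_cosGap
  fun_prop

theorem decay_pos (c : ℝ) (T : Finset ℕ) (θ : ℝ) : 0 < decay c T θ := Real.exp_pos _

theorem decay_periodic (c : ℝ) (T : Finset ℕ) : Function.Periodic (decay c T) 1 := fun θ => by
  unfold decay
  congr 2
  refine Finset.sum_congr rfl fun a _ => ?_
  have := cosGap_add_int (a * θ) a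
  push_cast at this
  rw [mul_add, mul_one, this]

/-- Pigeonhole: among B disjoint rows, one has gap sum at most the average. Its weight with exponent
c B then already dominates the whole product, and a sum over rows covers every choice. The number of
rows thus acts as an increase of Λ. -/
theorem decay_le_sum_rowWeight {p q : ℕ} (hp : 2 ≤ p) (hq : 2 ≤ q) (hpq : p.Coprime q) {c : ℝ}
    (hc : 0 ≤ c) {T : Finset ℕ} {l B : ℕ} (hB : 0 < B)
    (hT : ∀ a < l, ∀ b < B, p ^ a * q ^ b ∈ T) (θ : ℝ) :
    decay c T θ ≤ ∑ b ∈ Finset.range B, rowWeight p (c * B) l (((q ^ b : ℕ) : ℝ) * θ) := by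
  have hinj : Set.InjOn (fun x : ℕ × ℕ => p ^ x.2 * q ^ x.1)
      (Finset.range B ×ˢ Finset.range l : Finset (ℕ × ℕ)) := by
    rintro ⟨b, a⟩ _ ⟨b', a'⟩ _ h
    simp only at h
    have h1 : q ^ b ∣ q ^ b' := Nat.Coprime.dvd_of_dvd_mul_left
      (Nat.Coprime.pow _ _ hpq).symm ⟨p ^ a, by rw [mul_comm (q ^ b)]; exact h.symm⟩
    have h2 : q ^ b' ∣ q ^ b := Nat.Coprime.dvd_of_dvd_mul_left
      (Nat.Coprime.pow _ _ hpq).symm ⟨p ^ a', by rw [mul_comm (q ^ b')]; exact h⟩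
    have h3 := Nat.pow_right_injective hq (Nat.dvd_antisymm h1 h2)
    subst h3
    have h4 := Nat.pow_right_injective hp (Nat.eq_of_mul_eq_mul_right (by positivity) h)
    rw [h4]
  have hsub : (Finset.range B ×ˢ Finset.range l).image (fun x : ℕ × ℕ => p ^ x.2 * q ^ x.1)
      ⊆ T := by
    intro h hh
    obtain ⟨⟨b, a⟩, hx, rfl⟩ := Finset.mem_image.1 hh
    simp only [Finset.mem_product, Finset.mem_range] at hx
    exact hT a hx.2 b hx.1
  have hsum : ∑ b ∈ Finset.range B, ∑ a ∈ Finset.range l,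
      cosGap ((p : ℝ) ^ a * (((q ^ b : ℕ) : ℝ) * θ)) ≤ ∑ h ∈ T, cosGap (h * θ) := by
    refine le_trans (le_of_eq ?_)
      (Finset.sum_le_sum_of_subset_of_nonneg hsub fun _ _ _ => cosGap_nonneg _)
    rw [Finset.sum_image hinj, Finset.sum_product]
    refine Finset.sum_congr rfl fun b _ => Finset.sum_congr rfl fun a _ => ?_
    push_cast
    rw [mul_assoc]
  have hB0 : (0 : ℝ) < B := by positivity
  obtain ⟨b, hb, hbb⟩ := Finset.exists_le_of_sum_le (s := Finset.range B)
    (f := fun b => ∑ a ∈ Finset.range l, cosGap ((p : ℝ) ^ a * (((q ^ b : ℕ) : ℝ) * θ)))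
    (g := fun _ => (∑ h ∈ T, cosGap (h * θ)) / B) (by simpa using by omega) (by
      rw [Finset.sum_const, Finset.card_range, nsmul_eq_mul]
      rw [mul_div_cancel₀ _ hB0.ne']
      exact hsum)
  refine le_trans ?_ (Finset.single_le_sum
    (f := fun b => rowWeight p (c * B) l (((q ^ b : ℕ) : ℝ) * θ))
    (fun _ _ => (Real.exp_pos _).le) hb)
  unfold decay rowWeight
  rw [Real.exp_le_exp]
  rw [le_div_iff₀ hB0] at hbb
  nlinarith [mul_le_mul_of_nonneg_left hbb hc]

theorem integral_decay_le {p q : ℕ} (hp : 2 ≤ p) (hq : 2 ≤ q) (hpq : p.Coprime q) {c : ℝ}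
    (hc : 0 ≤ c) {T : Finset ℕ} {l B : ℕ} (hB : 0 < B)
    (hT : ∀ a < l, ∀ b < B, p ^ a * q ^ b ∈ T)
    (hl : l * (p * Real.exp (-(2 * (c * B) / (p : ℝ) ^ 2))) ≤ 1) :
    ∫ θ in (-1 / 2 : ℝ)..1 / 2, decay c T θ ≤ B * (3 * ((p : ℝ) ^ l)⁻¹) := by
  have h1 := (decay_periodic c T).intervalIntegral_add_eq (-1 / 2) 0
  norm_num at h1
  rw [show (-1 / 2 : ℝ) = -(1 / 2) by norm_num, h1]
  have hcr := continuous_rowWeight p (c * B) l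
  calc _ ≤ ∫ θ in (0 : ℝ)..1, ∑ b ∈ Finset.range B,
        rowWeight p (c * B) l (((q ^ b : ℕ) : ℝ) * θ) := by
        refine intervalIntegral.integral_mono_on (by norm_num)
          ((continuous_decay c T).intervalIntegrable _ _)
          (Continuous.intervalIntegrable (by fun_prop) _ _) fun x _ =>
          decay_le_sum_rowWeight hp hq hpq hc hB hT x
    _ = ∑ b ∈ Finset.range B, ∫ θ in (0 : ℝ)..1,
        rowWeight p (c * B) l (((q ^ b : ℕ) : ℝ) * θ) :=
        intervalIntegral.integral_finsetSum fun b _ =>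
          Continuous.intervalIntegrable (by fun_prop) _ _
    _ ≤ ∑ b ∈ Finset.range B, 3 * ((p : ℝ) ^ l)⁻¹ := by
        refine Finset.sum_le_sum fun b _ => ?_
        rw [integral_comp_nat_mul hcr (rowWeight_periodic _ _ _) (by positivity)]
        exact integral_rowWeight_le' hp (by positivity) hl
    _ = _ := by simp

theorem eventually_mul_log_pow_le (K : ℝ) (N : ℕ) :
    ∀ᶠ x : ℝ in atTop, K * Real.log x ^ N ≤ x := by
  have h := (Real.isLittleO_pow_log_id_atTop (n := N)).const_mul_left K
  filter_upwards [h.bound one_pos, eventually_ge_atTop 0] with x hx hx0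
  simp only [id, one_mul, Real.norm_eq_abs, abs_of_nonneg hx0] at hx
  exact (le_abs_self _).trans hx

/-- The total mass of the decay function is `1 / M` up to a power of `log M`. -/
theorem exists_integral_decay_le {p q : ℕ} (hp : 2 ≤ p) (hq : 2 ≤ q) (hpq : p.Coprime q) {c : ℝ}
    (hc : 0 < c) : ∃ N : ℕ, ∀ᶠ M : ℝ in atTop, ∀ T : Finset ℕ,
      (∀ a b : ℕ, (p : ℝ) ^ a * (q : ℝ) ^ b ≤ M → p ^ a * q ^ b ∈ T) →
      ∫ θ in (-1 / 2 : ℝ)..1 / 2, decay c T θ ≤ M⁻¹ * Real.log M ^ N := by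
  have hp0 : (0 : ℝ) < p := by positivity
  have hq0 : (0 : ℝ) < q := by positivity
  have hp1 : (1 : ℝ) < p := by exact_mod_cast (by omega : 1 < p)
  have hq1 : (1 : ℝ) < q := by exact_mod_cast (by omega : 1 < q)
  -- This K makes e^(-2cB/p²) at most R⁻², where R = log M and B ≥ K log R, which beats the row
  -- length l ≤ 2R. Meanwhile q^B is only a power of R, so p^l is still M up to powers of log M.
  set K : ℝ := (p : ℝ) ^ 2 / c with hK
  have hK0 : 0 < K := by positivity
  set N : ℕ := ⌈K * Real.log q⌉₊
  refine ⟨N + 2, ?_⟩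
  have hlog := Real.tendsto_log_atTop
  filter_upwards [hlog.eventually_ge_atTop (2 * p), hlog.eventually_ge_atTop 3,
    hlog.eventually_ge_atTop (3 * p * q * (K + 1)), eventually_gt_atTop 0,
    eventually_mul_log_pow_le q N] with M h1 h2 h3 hM0 h4 T hT
  set R := Real.log M with hR
  have hR0 : 0 < R := by linarith
  have hlR : 0 < Real.log R := Real.log_pos (by linarith)
  set B : ℕ := ⌈K * Real.log R⌉₊ with hBdef
  have hB0 : 0 < B := Nat.ceil_pos.2 (by positivity)
  have hB1 : K * Real.log R ≤ B := Nat.le_ceil _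
  have hB2 : (B : ℝ) ≤ K * Real.log R + 1 := (Nat.ceil_lt_add_one (by positivity)).le
  have hqB : (q : ℝ) ^ B ≤ q * R ^ N := by
    calc (q : ℝ) ^ B = (q : ℝ) ^ (B : ℝ) := (Real.rpow_natCast _ _).symm
      _ ≤ (q : ℝ) ^ (K * Real.log R + 1) := Real.rpow_le_rpow_of_exponent_le hq1.le hB2
      _ = q * R ^ (K * Real.log q) := by
          rw [Real.rpow_add hq0, Real.rpow_one, mul_comm, Real.rpow_def_of_pos hq0,
            Real.rpow_def_of_pos hR0]
          congr 2; ring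
      _ ≤ q * R ^ (N : ℝ) := by
          gcongr
          · linarith
          · exact Nat.le_ceil _
      _ = _ := by rw [Real.rpow_natCast]
  have hqM : 1 ≤ M / (q : ℝ) ^ B := by
    rw [le_div_iff₀ (by positivity), one_mul]; exact hqB.trans h4
  obtain ⟨l, hl1, hl2⟩ := exists_nat_pow_near hqM hp1
  have hl1' : (p : ℝ) ^ l * q ^ B ≤ M := (le_div_iff₀ (by positivity)).1 hl1
  have hl2' : M < (p : ℝ) ^ (l + 1) * q ^ B := (div_lt_iff₀ (by positivity)).1 hl2
  have hlR2 : (l : ℝ) ≤ 2 * R := by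
    have : (2 : ℝ) ^ l ≤ M := by
      refine le_trans ?_ (le_trans (le_mul_of_one_le_right (by positivity)
        (one_le_pow₀ hq1.le)) hl1')
      gcongr; exact_mod_cast hp
    have := Real.log_le_log (by positivity) this
    rw [Real.log_pow] at this
    nlinarith [Real.log_two_gt_d9]
  refine (integral_decay_le hp hq hpq hc.le hB0 (l := l) (fun a ha b hb => hT a b ?_) ?_).trans ?_
  · refine le_trans ?_ hl1'
    gcongr
    exacts [hp1.le, hq1.le]
  · have h5 : 2 * (c * B) / (p : ℝ) ^ 2 ≥ 2 * Real.log R := by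
      rw [ge_iff_le, le_div_iff₀ (by positivity)]
      have : c * (K * Real.log R) ≤ c * B := by gcongr
      have e : c * (K * Real.log R) = Real.log R * p ^ 2 := by rw [hK]; field_simp
      linarith
    calc (l : ℝ) * (p * Real.exp (-(2 * (c * B) / (p : ℝ) ^ 2)))
        ≤ 2 * R * (p * Real.exp (-(2 * Real.log R))) := by gcongr
      _ = 2 * R * (p * (R ^ 2)⁻¹) := by
          rw [Real.exp_neg, two_mul (Real.log R), Real.exp_add, Real.exp_log hR0, sq]
      _ = 2 * p / R := by field_simp
      _ ≤ 1 := by rw [div_le_one hR0]; exact h1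
  · have h6 : ((p : ℝ) ^ l)⁻¹ ≤ p * q * R ^ N * M⁻¹ := by
      rw [inv_le_iff_one_le_mul₀ (by positivity)]
      have : M ≤ (p : ℝ) ^ (l + 1) * (q * R ^ N) := hl2'.le.trans (by gcongr)
      calc (1 : ℝ) = M * M⁻¹ := by field_simp
        _ ≤ (p : ℝ) ^ (l + 1) * (q * R ^ N) * M⁻¹ := by gcongr
        _ = _ := by ring
    have h7 : (B : ℝ) ≤ (K + 1) * R := by
      have : Real.log R ≤ R := (Real.log_le_sub_one_of_pos hR0).trans (by linarith)
      nlinarith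
    calc (B : ℝ) * (3 * ((p : ℝ) ^ l)⁻¹) ≤ (K + 1) * R * (3 * (p * q * R ^ N * M⁻¹)) := by gcongr
      _ = (3 * p * q * (K + 1)) * R * R ^ N * M⁻¹ := by ring
      _ ≤ R * R * R ^ N * M⁻¹ := by gcongr
      _ = _ := by ring

/-- Away from the integers, the decay function is smaller than any power of `log M`. -/
theorem exists_decay_exponent_ge {p q : ℕ} (hp : 2 ≤ p) (hq : 2 ≤ q) (hpq : p.Coprime q) :
    ∃ c > 0, ∀ᶠ M : ℝ in atTop, ∀ T : Finset ℕ,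
      (∀ a b : ℕ, (p : ℝ) ^ a * (q : ℝ) ^ b ≤ M → p ^ a * q ^ b ∈ T) →
      ∀ θ : ℝ, 1 / (2 * M) ≤ |θ| → |θ| ≤ 1 / 2 →
        c * Real.log M ≤ ∑ h ∈ T, cosGap (h * θ) := by
  have hp1 : (1 : ℝ) < p := by exact_mod_cast (by omega : 1 < p)
  have hq1 : (1 : ℝ) < q := by exact_mod_cast (by omega : 1 < q)
  have hlp := Real.log_pos hp1
  have hlq := Real.log_pos hq1
  set D := 2 * (Real.log p + Real.log q) with hD
  have hD0 : 0 < D := by positivity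
  refine ⟨2 / ((p : ℝ) ^ 2 * q ^ 2) * (1 / D), by positivity, ?_⟩
  filter_upwards [Real.tendsto_log_atTop.eventually_ge_atTop (2 * D), eventually_gt_atTop 0]
    with M h1 hM0 T hT θ hθ hθ'
  set R := Real.log M with hR
  -- The square of exponents a, b ≤ l with l ≈ R / (log p + log q) fits below M, making both
  -- alternatives of `sum_cosGap_ge` of order log M.
  set l : ℕ := ⌊2 * R / D⌋₊
  have hl1 : (l : ℝ) ≤ 2 * R / D := Nat.floor_le (by apply div_nonneg <;> linarith)
  have hl2 : 2 * R / D < l + 1 := Nat.lt_floor_add_one _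
  have hl3 : (p : ℝ) ^ l * (q : ℝ) ^ l ≤ M := by
    rw [← Real.log_le_log_iff (by positivity) hM0, Real.log_mul (by positivity) (by positivity),
      Real.log_pow, Real.log_pow, ← mul_add]
    rw [le_div_iff₀ hD0, hD] at hl1
    nlinarith
  have h2 := sum_cosGap_ge hp hq hpq hT hl3 hθ hθ'
  rw [min_self] at h2
  refine le_trans ?_ h2
  rw [mul_assoc]
  gcongr
  have h3 : 2 ≤ R / D := by rwa [le_div_iff₀ hD0]
  have : 2 * R / D = 2 * (R / D) := by ring
  have : 1 / D * R = R / D := by ring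
  linarith

end MultiBase

/-! ### Counting the elements of S -/

namespace MultiBase

/-- Mean value bounds for powers; the upper one here and the lower one next are what telescopes in
the count of S. -/
theorem sub_pow_le {a b : ℝ} (hb : 0 ≤ b) (hab : b ≤ a) (n : ℕ) :
    a ^ (n + 1) - b ^ (n + 1) ≤ (n + 1) * (a - b) * a ^ n := by
  induction n with
  | zero => simp
  | succ n ih =>
    have h1 : b ^ (n + 1) * (a - b) ≤ a ^ (n + 1) * (a - b) := by
      gcongr
    have h2 := mul_le_mul_of_nonneg_left ih (hb.trans hab)
    push_cast
    calc a ^ (n + 1 + 1) - b ^ (n + 1 + 1)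
        = a * (a ^ (n + 1) - b ^ (n + 1)) + b ^ (n + 1) * (a - b) := by ring
      _ ≤ a * ((n + 1) * (a - b) * a ^ n) + a ^ (n + 1) * (a - b) := add_le_add h2 h1
      _ = _ := by ring

theorem le_sub_pow {a b : ℝ} (hb : 0 ≤ b) (hab : b ≤ a) (n : ℕ) :
    (n + 1) * (a - b) * b ^ n ≤ a ^ (n + 1) - b ^ (n + 1) := by
  induction n with
  | zero => simp
  | succ n ih =>
    have h3 : b * ((n + 1) * (a - b) * b ^ n) ≤ b * (a ^ (n + 1) - b ^ (n + 1)) := by gcongr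
    have h4 : b ^ (n + 1) * (a - b) ≤ a ^ (n + 1) * (a - b) := by
      gcongr
    push_cast
    calc (n + 1 + 1) * (a - b) * b ^ (n + 1)
        = b * ((n + 1) * (a - b) * b ^ n) + b ^ (n + 1) * (a - b) := by ring
      _ ≤ b * (a ^ (n + 1) - b ^ (n + 1)) + a ^ (n + 1) * (a - b) := add_le_add h3 h4
      _ = _ := by ring

variable {m : ℕ}

/-- The product `p_1 ^ α_1 * ⋯ * p_m ^ α_m`. -/
def term (p : Fin m → ℕ) (α : Fin m → ℕ) : ℕ := ∏ j, p j ^ α j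

theorem term_pos {p : Fin m → ℕ} (hp : ∀ j, 1 < p j) (α : Fin m → ℕ) : 0 < term p α :=
  Finset.prod_pos fun j _ => pow_pos (by have := hp j; omega) _

/-- Pairwise coprimality replaces primality: p_j^(α_j) divides the other product and is coprime to
all its factors except p_j^(β_j), so it divides that one; symmetry does the rest. -/
theorem term_injective {p : Fin m → ℕ} (hp : ∀ j, 1 < p j)
    (hcop : ∀ i j, i ≠ j → Nat.Coprime (p i) (p j)) : Function.Injective (term p) := by
  have key : ∀ α β : Fin m → ℕ, term p α = term p β → ∀ j, p j ^ α j ∣ p j ^ β j := by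
    intro α β h j
    have h1 : p j ^ α j ∣ term p β := h ▸ Finset.dvd_prod_of_mem _ (Finset.mem_univ j)
    unfold term at h1
    rw [← Finset.mul_prod_erase _ _ (Finset.mem_univ j)] at h1
    refine Nat.Coprime.dvd_of_dvd_mul_right (Nat.Coprime.prod_right fun i hi => ?_) h1
    exact Nat.Coprime.pow _ _ (hcop _ _ (Finset.ne_of_mem_erase hi).symm)
  intro α β h
  funext j
  exact Nat.pow_right_injective (hp j)
    (Nat.dvd_antisymm (key α β h j) (key β α h.symm j))

/-- The exponent vectors `α` with `p_1 ^ α_1 * ⋯ * p_m ^ α_m ≤ x`. -/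
noncomputable def expSet (p : Fin m → ℕ) (x : ℝ) : Finset (Fin m → ℕ) := by
  classical
  exact (Fintype.piFinset fun _ => Finset.range (⌊x⌋₊ + 1)).filter fun α => (term p α : ℝ) ≤ x

theorem mem_expSet {p : Fin m → ℕ} (hp : ∀ j, 1 < p j) {x : ℝ} {α : Fin m → ℕ} :
    α ∈ expSet p x ↔ (term p α : ℝ) ≤ x := by
  classical
  simp only [expSet, Finset.mem_filter, Fintype.mem_piFinset, Finset.mem_range,
    and_iff_right_iff_imp]
  intro h j
  refine Nat.lt_succ_of_le (Nat.le_floor (le_trans ?_ h))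
  have h1 : α j ≤ p j ^ α j := (Nat.lt_pow_self (hp j)).le
  have h2 : p j ^ α j ≤ term p α :=
    Finset.single_le_prod' (f := fun j => p j ^ α j)
      (fun i _ => Nat.one_le_pow _ _ (by have := hp i; omega)) (Finset.mem_univ j)
  exact_mod_cast h1.trans h2

theorem expSet_eq_empty {p : Fin m → ℕ} (hp : ∀ j, 1 < p j) {x : ℝ} (hx : x < 1) :
    expSet p x = ∅ := by
  refine Finset.eq_empty_of_forall_notMem fun α hα => ?_
  have h := (mem_expSet hp).1 hα
  have : (1 : ℝ) ≤ term p α := by exact_mod_cast term_pos hp α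
  linarith

theorem term_succ (p α : Fin (m + 1) → ℕ) :
    term p α = p 0 ^ α 0 * term (Fin.tail p) (Fin.tail α) := by
  simp [term, Fin.prod_univ_succ, Fin.tail]

/-- Vectors with α_0 = 0 are counted in one dimension less; the others become vectors for x / p_0
after lowering α_0 by one. -/
theorem card_expSet_succ {p : Fin (m + 1) → ℕ} (hp : ∀ j, 1 < p j) (x : ℝ) :
    (expSet p x).card = (expSet (Fin.tail p) x).card + (expSet p (x / p 0)).card := by
  classical
  have hp0 : (0 : ℝ) < p 0 := by have := hp 0; positivity
  have hpt : ∀ j, 1 < Fin.tail p j := fun j => hp _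
  rw [← Finset.card_filter_add_card_filter_not (s := expSet p x) (fun α => α 0 = 0)]
  congr 1
  · refine Finset.card_nbij' (fun α => Fin.tail α) (fun α => Fin.cons 0 α) ?_ ?_ ?_ ?_
    · intro α hα
      simp only [Finset.coe_filter, Set.mem_ofPred_eq, mem_expSet hp, term_succ] at hα
      simp only [Finset.mem_coe, mem_expSet hpt]
      simpa [hα.2] using hα.1
    · intro α hα
      simp only [Finset.mem_coe, mem_expSet hpt] at hα
      simp only [Finset.coe_filter, Set.mem_ofPred_eq, mem_expSet hp, term_succ]
      simpa using hα
    · intro α hα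
      simp only [Finset.coe_filter, Set.mem_ofPred_eq] at hα
      rw [← hα.2]; exact Fin.cons_self_tail α
    · intro α _
      simp
  · refine Finset.card_nbij' (fun α => Fin.cons (α 0 - 1) (Fin.tail α))
      (fun α => Fin.cons (α 0 + 1) (Fin.tail α)) ?_ ?_ ?_ ?_
    · intro α hα
      simp only [Finset.coe_filter, Set.mem_ofPred_eq, mem_expSet hp, term_succ] at hα
      simp only [Finset.mem_coe, mem_expSet hp, term_succ, Fin.cons_zero, Fin.tail_cons]
      rw [le_div_iff₀ hp0]
      refine le_trans (le_of_eq ?_) hα.1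
      obtain ⟨k, hk⟩ := Nat.exists_eq_succ_of_ne_zero hα.2
      rw [hk]; push_cast; simp [pow_succ]; ring
    · intro α hα
      simp only [Finset.mem_coe, mem_expSet hp, term_succ] at hα
      simp only [Finset.coe_filter, Set.mem_ofPred_eq, mem_expSet hp, term_succ, Fin.cons_zero,
        Fin.tail_cons]
      refine ⟨?_, by omega⟩
      rw [le_div_iff₀ hp0] at hα
      refine le_trans (le_of_eq ?_) hα
      push_cast; ring
    · intro α hα
      simp only [Finset.coe_filter, Set.mem_ofPred_eq] at hα
      simp only [Fin.cons_zero, Fin.tail_cons]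
      rw [Nat.sub_add_cancel (by omega)]
      exact Fin.cons_self_tail α
    · intro α _
      simp only [Fin.cons_zero, Fin.tail_cons, Nat.add_sub_cancel]
      exact Fin.cons_self_tail α

/-- The leading constant in the count of products `p_1 ^ α_1 * ⋯ * p_m ^ α_m ≤ x`. -/
noncomputable def countConst (p : Fin m → ℕ) : ℝ :=
  1 / (m.factorial : ℝ) * ∏ j, 1 / Real.log (p j)

theorem countConst_pos {p : Fin m → ℕ} (hp : ∀ j, 1 < p j) : 0 < countConst p := by
  unfold countConst
  refine mul_pos (by positivity) (Finset.prod_pos fun j _ => ?_)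
  exact one_div_pos.2 (Real.log_pos (by exact_mod_cast hp j))

theorem countConst_succ (p : Fin (m + 1) → ℕ) :
    countConst p = countConst (Fin.tail p) / ((m + 1) * Real.log (p 0)) := by
  unfold countConst
  rw [Fin.prod_univ_succ, Nat.factorial_succ]
  push_cast
  simp only [Fin.tail]
  rw [div_eq_mul_inv _ ((m + 1 : ℝ) * Real.log (p 0)), mul_inv, one_div, one_div, mul_inv]
  ring

/-- Two-sided bounds for the number of products `p_1 ^ α_1 * ⋯ * p_m ^ α_m ≤ x`. -/
theorem card_expSet_bounds {p : Fin m → ℕ} (hp : ∀ j, 1 < p j) {x : ℝ} (hx : 1 ≤ x) :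
    countConst p * Real.log x ^ m ≤ (expSet p x).card ∧
      ((expSet p x).card : ℝ) ≤ countConst p * (Real.log x + ∑ j, Real.log (p j)) ^ m := by
  induction m generalizing x with
  | zero =>
    have : expSet p x = {0} := by
      ext α
      rw [mem_expSet hp, Finset.mem_singleton]
      simp only [term, Finset.univ_eq_empty, Finset.prod_empty, Nat.cast_one, hx, true_iff]
      exact Subsingleton.elim _ _
    simp [this, countConst]
  | succ m ih =>
    have hp0 : (1 : ℝ) < p 0 := by exact_mod_cast hp 0
    have hpt : ∀ j, 1 < Fin.tail p j := fun j => hp _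
    obtain ⟨k, hk⟩ := pow_unbounded_of_one_lt x hp0
    set lam := Real.log (p 0) with hlam
    have hlam0 : 0 < lam := Real.log_pos hp0
    have hct := countConst_pos hpt
    have hsum : ∑ j, Real.log (p j) = lam + ∑ j, Real.log (Fin.tail p j) := by
      rw [Fin.sum_univ_succ]; rfl
    set Λ := ∑ j, Real.log (Fin.tail p j) with hΛ
    have hΛ0 : 0 ≤ Λ := Finset.sum_nonneg fun j _ =>
      Real.log_nonneg (by exact_mod_cast (hpt j).le)
    rw [countConst_succ, hsum]
    set c := countConst (Fin.tail p) with hc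
    have e : ∀ z : ℝ, c / ((m + 1) * lam) * z = c * (z / ((m + 1) * lam)) := fun z => by ring
    rw [e, e]
    clear_value c
    -- The inner induction runs over the number of divisions by p_0 that bring x below 1.
    induction k generalizing x with
    | zero => simp at hk; linarith
    | succ k ihk =>
      have hy : 0 ≤ Real.log x := Real.log_nonneg hx
      set y := Real.log x with hydef
      obtain ⟨hl, hu⟩ := ih hpt hx
      rw [← hc] at hl hu
      rw [card_expSet_succ hp]
      push_cast
      -- The shift by Λ + lam in the upper bound makes one step of the recursion close: the
      -- increment of the (m + 1)-st power over a step lam exceeds the lower-dimensional count.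
      have hupow : c * (y + Λ) ^ m + c * ((y + Λ) ^ (m + 1) / ((m + 1) * lam))
          ≤ c * ((y + (lam + Λ)) ^ (m + 1) / ((m + 1) * lam)) := by
        rw [← mul_add]
        gcongr
        rw [← le_sub_iff_add_le, ← sub_div, le_div_iff₀ (by positivity)]
        have := le_sub_pow (a := y + (lam + Λ)) (b := y + Λ) (by positivity) (by linarith) m
        calc _ = (m + 1) * (y + (lam + Λ) - (y + Λ)) * (y + Λ) ^ m := by ring
          _ ≤ _ := this
      by_cases hx1 : x / p 0 < 1
      · rw [expSet_eq_empty hp hx1]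
        have hylam : y ≤ lam := by
          rw [div_lt_one (by linarith)] at hx1
          exact Real.log_le_log (by linarith) hx1.le
        simp only [Finset.card_empty, Nat.cast_zero, add_zero]
        constructor
        · refine le_trans ?_ hl
          gcongr
          rw [div_le_iff₀ (by positivity), pow_succ]
          gcongr
          nlinarith
        · refine hu.trans (le_trans ?_ hupow)
          have : 0 ≤ c * ((y + Λ) ^ (m + 1) / ((m + 1) * lam)) := by positivity
          linarith
      · push Not at hx1
        have hlogd : Real.log (x / p 0) = y - lam := by
          rw [Real.log_div (by linarith) (by linarith)]
        have hyl : 0 ≤ y - lam := hlogd ▸ Real.log_nonneg hx1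
        obtain ⟨h1, h2⟩ := ihk hx1 (by
          rw [div_lt_iff₀ (by linarith), ← pow_succ]; exact hk)
        rw [hlogd] at h1 h2
        constructor
        · refine le_trans ?_ (add_le_add hl h1)
          rw [← mul_add]
          gcongr
          rw [← sub_le_iff_le_add, ← sub_div, div_le_iff₀ (by positivity)]
          have := sub_pow_le (a := y) (b := y - lam) hyl (by linarith) m
          calc _ ≤ (m + 1) * (y - (y - lam)) * y ^ m := this
            _ = _ := by ring
        · refine le_trans (add_le_add hu h2) (le_trans (le_of_eq ?_) hupow)
          congr 4
          ring

/-- The elements of `S` up to `x`. -/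
noncomputable def terms (p : Fin m → ℕ) (x : ℝ) : Finset ℕ := by
  classical exact (expSet p x).image (term p)

theorem mem_terms {p : Fin m → ℕ} (hp : ∀ j, 1 < p j) {x : ℝ} {h : ℕ} :
    h ∈ terms p x ↔ h ∈ baseSet p ∧ (h : ℝ) ≤ x := by
  classical
  simp only [terms, Finset.mem_image, mem_expSet hp, baseSet, Set.mem_range]
  constructor
  · rintro ⟨α, h1, rfl⟩
    exact ⟨⟨α, rfl⟩, h1⟩
  · rintro ⟨⟨α, rfl⟩, h1⟩
    exact ⟨α, h1, rfl⟩

theorem pos_of_mem_terms {p : Fin m → ℕ} (hp : ∀ j, 1 < p j) {x : ℝ} {h : ℕ}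
    (hh : h ∈ terms p x) : 0 < h := by
  obtain ⟨⟨α, rfl⟩, -⟩ := (mem_terms hp).1 hh
  exact term_pos hp α

theorem terms_mono {p : Fin m → ℕ} (hp : ∀ j, 1 < p j) {x y : ℝ} (hxy : x ≤ y) :
    terms p x ⊆ terms p y := fun h hh => by
  rw [mem_terms hp] at hh ⊢
  exact ⟨hh.1, hh.2.trans hxy⟩

theorem card_terms {p : Fin m → ℕ} (hp : ∀ j, 1 < p j)
    (hcop : ∀ i j, i ≠ j → Nat.Coprime (p i) (p j)) (x : ℝ) :
    (terms p x).card = (expSet p x).card := by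
  classical
  unfold terms
  exact Finset.card_image_of_injective _ (term_injective hp hcop)

theorem sum_terms {p : Fin m → ℕ} (hp : ∀ j, 1 < p j)
    (hcop : ∀ i j, i ≠ j → Nat.Coprime (p i) (p j)) (x : ℝ) (f : ℕ → ℝ) :
    ∑ h ∈ terms p x, f h = ∑ α ∈ expSet p x, f (term p α) := by
  classical
  unfold terms
  exact Finset.sum_image fun _ _ _ _ h => term_injective hp hcop h

theorem pow_mul_pow_mem_baseSet {p : Fin m → ℕ} {i j : Fin m} (a b : ℕ) :
    p i ^ a * p j ^ b ∈ baseSet p := by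
  classical
  refine ⟨Pi.single i a + Pi.single j b, ?_⟩
  simp only [Pi.add_apply, pow_add, Finset.prod_mul_distrib]
  congr 1
  · rw [Finset.prod_eq_single i] <;> simp +contextual
  · rw [Finset.prod_eq_single j] <;> simp +contextual

theorem sum_min_inv_geom_of_one_le {p : ℕ} (hp : 2 ≤ p) (K : ℕ) {u : ℝ} (hu : 1 ≤ u) :
    ∑ k ∈ Finset.range K, min (u * (p : ℝ) ^ k) (u * (p : ℝ) ^ k)⁻¹ ≤ 2 / u := by
  have hp2 : (2 : ℝ) ≤ p := by exact_mod_cast hp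
  induction K generalizing u with
  | zero => simp; positivity
  | succ K ih =>
    rw [Finset.sum_range_succ']
    have h1 := ih (u := u * p) (by nlinarith)
    simp only [mul_assoc, ← pow_succ'] at h1
    have h2 : 2 / (u * p) ≤ 1 / u := by
      rw [div_le_div_iff₀ (by nlinarith) (by linarith)]; nlinarith
    have h3 : min (u * (p : ℝ) ^ 0) (u * (p : ℝ) ^ 0)⁻¹ ≤ 1 / u := by
      simp
    have : 2 / u = 1 / u + 1 / u := by ring
    linarith

/-- Along a geometric progression the minimum first grows and then decays geometrically, so only a
bounded number of terms near 1 matter, uniformly in the starting point. -/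
theorem sum_min_inv_geom_le {p : ℕ} (hp : 2 ≤ p) (K : ℕ) {u : ℝ} (hu : 0 < u) :
    ∑ k ∈ Finset.range K, min (u * (p : ℝ) ^ k) (u * (p : ℝ) ^ k)⁻¹ ≤ 4 := by
  have hp2 : (2 : ℝ) ≤ p := by exact_mod_cast hp
  rcases le_total 1 u with h | h
  · refine (sum_min_inv_geom_of_one_le hp K h).trans ?_
    rw [div_le_iff₀ hu]; linarith
  -- Strengthened to 4 - u for the induction: after one step the bound is 4 - up, and up ≥ 2u pays
  -- for the first term u.
  have key : ∑ k ∈ Finset.range K, min (u * (p : ℝ) ^ k) (u * (p : ℝ) ^ k)⁻¹ ≤ 4 - u := by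
    induction K generalizing u with
    | zero => simp; linarith
    | succ K ih =>
      rw [Finset.sum_range_succ']
      have h3 : min (u * (p : ℝ) ^ 0) (u * (p : ℝ) ^ 0)⁻¹ ≤ u := by simp
      rcases le_total (u * p) 1 with h4 | h4
      · have h1 := ih (u := u * p) (by positivity) h4
        simp only [mul_assoc, ← pow_succ'] at h1
        nlinarith
      · have h1 := sum_min_inv_geom_of_one_le hp K h4
        simp only [mul_assoc, ← pow_succ'] at h1
        have : 2 / (u * p) ≤ 2 := by
          rw [div_le_iff₀ (by positivity)]; linarith
        rw [mul_comm] at this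
        have e : 2 / (u * p) = 2 / (p * u) := by rw [mul_comm u]
        linarith
  linarith

/-- The terms of size about `1 / r` dominate: at most one in each geometric progression counts. -/
theorem sum_terms_min_le {p : Fin (m + 1) → ℕ} (hp : ∀ j, 1 < p j)
    (hcop : ∀ i j, i ≠ j → Nat.Coprime (p i) (p j)) (x : ℝ) {r : ℝ} (hr : 0 < r) :
    ∑ h ∈ terms p x, min (r * h) (r * h)⁻¹ ≤ 4 * (expSet (Fin.tail p) x).card := by
  classical
  have hpt : ∀ j, 1 < Fin.tail p j := fun j => hp _
  rw [sum_terms hp hcop x fun h => min (r * h) (r * h)⁻¹]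
  set ψ : ℕ × (Fin m → ℕ) → ℝ := fun y =>
    min (r * term (Fin.tail p) y.2 * (p 0 : ℝ) ^ y.1)
      (r * term (Fin.tail p) y.2 * (p 0 : ℝ) ^ y.1)⁻¹ with hψ
  have hψ0 : ∀ y, 0 ≤ ψ y := fun y => le_min (by positivity) (by positivity)
  have hinj : Set.InjOn (fun α : Fin (m + 1) → ℕ => (α 0, Fin.tail α)) (expSet p x) := by
    intro α _ β _ h
    simp only [Prod.mk.injEq] at h
    rw [← Fin.cons_self_tail α, ← Fin.cons_self_tail β, h.1, h.2]
  have hsub : (expSet p x).image (fun α : Fin (m + 1) → ℕ => (α 0, Fin.tail α)) ⊆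
      Finset.range (⌊x⌋₊ + 1) ×ˢ expSet (Fin.tail p) x := by
    intro y hy
    obtain ⟨α, hα, rfl⟩ := Finset.mem_image.1 hy
    rw [Finset.mem_product]
    constructor
    · simp only [expSet, Finset.mem_filter, Fintype.mem_piFinset] at hα
      exact hα.1 0
    · rw [mem_expSet hp, term_succ] at hα
      rw [mem_expSet hpt]
      refine le_trans ?_ hα
      exact_mod_cast Nat.le_mul_of_pos_left _ (pow_pos (by have := hp 0; omega) _)
  calc _ = ∑ y ∈ (expSet p x).image (fun α : Fin (m + 1) → ℕ => (α 0, Fin.tail α)), ψ y := by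
        rw [Finset.sum_image hinj]
        refine Finset.sum_congr rfl fun α _ => ?_
        rw [term_succ]
        simp only [hψ]
        push_cast
        congr 1 <;> ring_nf
    _ ≤ ∑ y ∈ Finset.range (⌊x⌋₊ + 1) ×ˢ expSet (Fin.tail p) x, ψ y :=
        Finset.sum_le_sum_of_subset_of_nonneg hsub fun _ _ _ => hψ0 _
    _ = ∑ α ∈ expSet (Fin.tail p) x, ∑ k ∈ Finset.range (⌊x⌋₊ + 1), ψ (k, α) := by
        rw [Finset.sum_product_right]
    _ ≤ ∑ α ∈ expSet (Fin.tail p) x, 4 := by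
        refine Finset.sum_le_sum fun α _ => ?_
        have : (0 : ℝ) < term (Fin.tail p) α := by exact_mod_cast term_pos hpt α
        exact sum_min_inv_geom_le (p := p 0) (hp 0) (⌊x⌋₊ + 1) (mul_pos hr this)
    _ = _ := by simp [mul_comm]

end MultiBase

/-! ### A single Boltzmann distributed digit -/

namespace MultiBase

/-- The partition function of a single digit. -/
noncomputable def digitZ (d : ℕ) (x : ℝ) : ℝ := ∑ j ∈ Finset.range d, Real.exp (-(j * x))

/-- The Boltzmann weight of the digit `j`. -/
noncomputable def digitW (d : ℕ) (x : ℝ) (j : ℕ) : ℝ := Real.exp (-(j * x)) / digitZ d x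

/-- The expectation of a function of a Boltzmann distributed digit. -/
noncomputable def digitExp (d : ℕ) (x : ℝ) (f : ℕ → ℂ) : ℂ :=
  ∑ j ∈ Finset.range d, (digitW d x j : ℂ) * f j

/-- The mean of a Boltzmann distributed digit. -/
noncomputable def digitMean (d : ℕ) (x : ℝ) : ℝ := ∑ j ∈ Finset.range d, digitW d x j * j

/-- The variance of a Boltzmann distributed digit. -/
noncomputable def digitVar (d : ℕ) (x : ℝ) : ℝ :=
  ∑ j ∈ Finset.range d, digitW d x j * (j - digitMean d x) ^ 2

variable {d : ℕ} {x : ℝ}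

theorem digitZ_ge_one (hd : 2 ≤ d) : 1 ≤ digitZ d x := by
  unfold digitZ
  have := Finset.single_le_sum (s := Finset.range d) (f := fun j : ℕ => Real.exp (-(j * x)))
    (fun _ _ => (Real.exp_pos _).le) (Finset.mem_range.2 (by omega : 0 < d))
  simpa using this

theorem digitZ_pos (hd : 2 ≤ d) : 0 < digitZ d x := lt_of_lt_of_le one_pos (digitZ_ge_one hd)

theorem digitZ_le (hx : 0 ≤ x) : digitZ d x ≤ d := by
  unfold digitZ
  calc _ ≤ ∑ j ∈ Finset.range d, (1 : ℝ) := Finset.sum_le_sum fun j _ => by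
        rw [Real.exp_le_one_iff]; simp; positivity
    _ = d := by simp

theorem digitW_pos (hd : 2 ≤ d) (j : ℕ) : 0 < digitW d x j :=
  div_pos (Real.exp_pos _) (digitZ_pos hd)

theorem sum_digitW (hd : 2 ≤ d) : ∑ j ∈ Finset.range d, digitW d x j = 1 := by
  unfold digitW
  rw [← Finset.sum_div]
  exact div_self (digitZ_pos hd).ne'

theorem digitW_le_exp (hd : 2 ≤ d) (hx : 0 ≤ x) {j : ℕ} (hj : j ≠ 0) :
    digitW d x j ≤ Real.exp (-x) := by
  refine (div_le_self (Real.exp_pos _).le (digitZ_ge_one hd)).trans ?_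
  rw [Real.exp_le_exp, neg_le_neg_iff]
  exact le_mul_of_one_le_left hx (by exact_mod_cast Nat.one_le_iff_ne_zero.2 hj)

theorem sum_digitW_mul_le (hd : 2 ≤ d) {f : ℕ → ℝ} {M : ℝ} (hf : ∀ j < d, f j ≤ M) :
    ∑ j ∈ Finset.range d, digitW d x j * f j ≤ M := by
  calc _ ≤ ∑ j ∈ Finset.range d, digitW d x j * M := Finset.sum_le_sum fun j hj => by
        have := (digitW_pos (x := x) hd j).le
        have := hf j (Finset.mem_range.1 hj)
        gcongr
    _ = M := by rw [← Finset.sum_mul, sum_digitW hd, one_mul]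

/-- Only non-zero digits contribute positively, each with probability at most e^(-x). This factor is
what makes terms h much larger than 1/r negligible in all later sums. -/
theorem sum_digitW_mul_le_exp (hd : 2 ≤ d) (hx : 0 ≤ x) {f : ℕ → ℝ} {M : ℝ} (hf0 : f 0 ≤ 0)
    (hM : 0 ≤ M) (hf : ∀ j < d, f j ≤ M) :
    ∑ j ∈ Finset.range d, digitW d x j * f j ≤ d * (M * Real.exp (-x)) := by
  calc _ ≤ ∑ j ∈ Finset.range d, M * Real.exp (-x) := Finset.sum_le_sum fun j hj => by
        have h1 := (digitW_pos (x := x) hd j).le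
        have h2 := hf j (Finset.mem_range.1 hj)
        by_cases hj0 : j = 0
        · subst hj0
          refine le_trans (mul_nonpos_of_nonneg_of_nonpos h1 hf0) (by positivity)
        · calc _ ≤ digitW d x j * M := by gcongr
            _ ≤ Real.exp (-x) * M := by gcongr; exact digitW_le_exp hd hx hj0
            _ = _ := mul_comm _ _
    _ = _ := by simp

theorem norm_digitExp_le_sum (hd : 2 ≤ d) (f : ℕ → ℂ) :
    ‖digitExp d x f‖ ≤ ∑ j ∈ Finset.range d, digitW d x j * ‖f j‖ := by
  refine (norm_sum_le _ _).trans (Finset.sum_le_sum fun j _ => ?_)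
  rw [norm_mul, Complex.norm_real, Real.norm_of_nonneg (digitW_pos hd j).le]

theorem norm_digitExp_le (hd : 2 ≤ d) {f : ℕ → ℂ} {M : ℝ} (hf : ∀ j < d, ‖f j‖ ≤ M) :
    ‖digitExp d x f‖ ≤ M :=
  (norm_digitExp_le_sum hd f).trans (sum_digitW_mul_le hd hf)

theorem digitExp_const (hd : 2 ≤ d) (c : ℂ) : digitExp d x (fun _ => c) = c := by
  unfold digitExp
  rw [← Finset.sum_mul, ← Complex.ofReal_sum, sum_digitW hd]
  simp

theorem digitExp_sub (f g : ℕ → ℂ) :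
    digitExp d x (fun j => f j - g j) = digitExp d x f - digitExp d x g := by
  simp [digitExp, mul_sub]

theorem digitExp_add (f g : ℕ → ℂ) :
    digitExp d x (fun j => f j + g j) = digitExp d x f + digitExp d x g := by
  simp [digitExp, mul_add, Finset.sum_add_distrib]

theorem digitExp_const_mul (c : ℂ) (f : ℕ → ℂ) :
    digitExp d x (fun j => c * f j) = c * digitExp d x f := by
  simp only [digitExp, Finset.mul_sum]
  exact Finset.sum_congr rfl fun j _ => by ring

theorem digitMean_nonneg (hd : 2 ≤ d) : 0 ≤ digitMean d x :=
  Finset.sum_nonneg fun j _ => mul_nonneg (digitW_pos hd j).le (by positivity)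

theorem digitMean_le (hd : 2 ≤ d) : digitMean d x ≤ d :=
  sum_digitW_mul_le hd fun j hj => by exact_mod_cast hj.le

theorem digitMean_le_exp (hd : 2 ≤ d) (hx : 0 ≤ x) :
    digitMean d x ≤ d ^ 2 * Real.exp (-x) := by
  have := sum_digitW_mul_le_exp (x := x) hd hx (f := fun j => (j : ℝ)) (M := d) (by simp)
    (by positivity) (fun j hj => by exact_mod_cast hj.le)
  calc _ ≤ _ := this
    _ = _ := by ring

theorem abs_digit_sub_mean_le (hd : 2 ≤ d) {j : ℕ} (hj : j < d) :
    |(j : ℝ) - digitMean d x| ≤ d := by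
  have h1 := digitMean_nonneg (x := x) hd
  have h2 := digitMean_le (x := x) hd
  have h3 : (j : ℝ) ≤ d := by exact_mod_cast hj.le
  have h4 : (0 : ℝ) ≤ j := by positivity
  rw [abs_le]; constructor <;> linarith

theorem sum_digitW_abs_le (hd : 2 ≤ d) (hx : 0 ≤ x) :
    ∑ j ∈ Finset.range d, digitW d x j * |(j : ℝ) - digitMean d x|
      ≤ 2 * d ^ 2 * Real.exp (-x) := by
  have h1 := digitMean_nonneg (x := x) hd
  calc _ ≤ ∑ j ∈ Finset.range d, (digitW d x j * j + digitW d x j * digitMean d x) :=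
        Finset.sum_le_sum fun j _ => by
          rw [← mul_add]
          have := (digitW_pos (x := x) hd j).le
          gcongr
          refine (abs_sub _ _).trans (le_of_eq ?_)
          rw [abs_of_nonneg h1, abs_of_nonneg (by positivity)]
    _ = 2 * digitMean d x := by
        rw [Finset.sum_add_distrib, ← Finset.sum_mul, sum_digitW hd, two_mul, one_mul]
        rfl
    _ ≤ _ := by linarith [digitMean_le_exp hd hx]

theorem sum_digitW_pow_le (hd : 2 ≤ d) (hx : 0 ≤ x) (k : ℕ) :
    ∑ j ∈ Finset.range d, digitW d x j * |(j : ℝ) - digitMean d x| ^ (k + 1)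
      ≤ 2 * d ^ (k + 2) * Real.exp (-x) := by
  calc _ ≤ ∑ j ∈ Finset.range d, (d : ℝ) ^ k * (digitW d x j * |(j : ℝ) - digitMean d x|) :=
        Finset.sum_le_sum fun j hj => by
          have := (digitW_pos (x := x) hd j).le
          have h2 := abs_digit_sub_mean_le (x := x) hd (Finset.mem_range.1 hj)
          rw [pow_succ]
          calc digitW d x j * (|(j : ℝ) - digitMean d x| ^ k * |(j : ℝ) - digitMean d x|)
              ≤ digitW d x j * ((d : ℝ) ^ k * |(j : ℝ) - digitMean d x|) := by gcongr
            _ = _ := by ring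
    _ ≤ (d : ℝ) ^ k * (2 * d ^ 2 * Real.exp (-x)) := by
        rw [← Finset.mul_sum]
        gcongr
        exact sum_digitW_abs_le hd hx
    _ = _ := by ring

theorem digitVar_nonneg (hd : 2 ≤ d) : 0 ≤ digitVar d x :=
  Finset.sum_nonneg fun j _ => mul_nonneg (digitW_pos hd j).le (by positivity)

theorem digitVar_le_exp (hd : 2 ≤ d) (hx : 0 ≤ x) :
    digitVar d x ≤ 2 * d ^ 3 * Real.exp (-x) := by
  have := sum_digitW_pow_le hd hx 1
  simpa [digitVar, sq_abs] using this

theorem digitVar_le (hd : 2 ≤ d) : digitVar d x ≤ (d : ℝ) ^ 2 :=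
  sum_digitW_mul_le hd fun j hj => by
    rw [← sq_abs]
    have := abs_digit_sub_mean_le (x := x) hd hj
    gcongr

theorem digitVar_eq (hd : 2 ≤ d) :
    digitVar d x = ∑ j ∈ Finset.range d, digitW d x j * (j : ℝ) ^ 2 - digitMean d x ^ 2 := by
  have h : ∀ j : ℕ, digitW d x j * ((j : ℝ) - digitMean d x) ^ 2
      = digitW d x j * (j : ℝ) ^ 2 - 2 * digitMean d x * (digitW d x j * j)
        + digitMean d x ^ 2 * digitW d x j := fun j => by ring
  unfold digitVar
  simp only [h]
  rw [Finset.sum_add_distrib, Finset.sum_sub_distrib, ← Finset.mul_sum, ← Finset.mul_sum,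
    sum_digitW hd]
  change _ - 2 * digitMean d x * digitMean d x + _ = _
  ring

/-- As x tends to 0 the digit becomes uniform on d values, with linear rate. The limiting mean (d -
1)/2 and variance (d² - 1)/12 in the theorem come from this. -/
theorem abs_digitW_sub_le (hd : 2 ≤ d) (hx : 0 ≤ x) {j : ℕ} (hj : j < d) :
    |digitW d x j - 1 / d| ≤ d * x := by
  have hd0 : (0 : ℝ) < d := by positivity
  have hZ := digitZ_pos (x := x) hd
  have hexp : ∀ i < d, 1 - d * x ≤ Real.exp (-(i * x)) ∧ Real.exp (-(i * x)) ≤ 1 := by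
    intro i hi
    constructor
    · have h1 := Real.add_one_le_exp (-((i : ℝ) * x))
      have h2 : (i : ℝ) * x ≤ d * x := by gcongr
      linarith
    · rw [Real.exp_le_one_iff]; simp; positivity
  have e : digitW d x j - 1 / d
      = (∑ i ∈ Finset.range d, (Real.exp (-(j * x)) - Real.exp (-(i * x)))) / (d * digitZ d x) := by
    rw [Finset.sum_sub_distrib]
    change _ = (_ - digitZ d x) / _
    simp only [Finset.sum_const, Finset.card_range, nsmul_eq_mul, digitW]
    field_simp
  rw [e, abs_div, abs_of_pos (by positivity : 0 < d * digitZ d x), div_le_iff₀ (by positivity)]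
  calc _ ≤ ∑ i ∈ Finset.range d, (d : ℝ) * x := by
        refine (Finset.abs_sum_le_sum_abs _ _).trans (Finset.sum_le_sum fun i hi => ?_)
        have h1 := hexp j hj
        have h2 := hexp i (Finset.mem_range.1 hi)
        rw [abs_le]; constructor <;> linarith
    _ = d * x * d := by simp; ring
    _ ≤ d * x * (d * digitZ d x) := by
        gcongr
        exact le_mul_of_one_le_right hd0.le (digitZ_ge_one hd)

theorem sum_range_cast (d : ℕ) : ∑ j ∈ Finset.range d, (j : ℝ) = d * (d - 1) / 2 := by
  induction d with
  | zero => simp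
  | succ d ih => rw [Finset.sum_range_succ, ih]; push_cast; ring

theorem sum_range_cast_sq (d : ℕ) :
    ∑ j ∈ Finset.range d, (j : ℝ) ^ 2 = d * (d - 1) * (2 * d - 1) / 6 := by
  induction d with
  | zero => simp
  | succ d ih => rw [Finset.sum_range_succ, ih]; push_cast; ring

theorem abs_sum_digitW_sub_le (hd : 2 ≤ d) (hx : 0 ≤ x) {f : ℕ → ℝ} {M : ℝ}
    (hf : ∀ j < d, |f j| ≤ M) :
    |∑ j ∈ Finset.range d, digitW d x j * f j - (∑ j ∈ Finset.range d, f j) / d|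
      ≤ d ^ 2 * M * x := by
  rw [Finset.sum_div, ← Finset.sum_sub_distrib]
  calc _ ≤ ∑ j ∈ Finset.range d, d * x * M := by
        refine (Finset.abs_sum_le_sum_abs _ _).trans (Finset.sum_le_sum fun j hj => ?_)
        rw [show digitW d x j * f j - f j / d = (digitW d x j - 1 / d) * f j by ring, abs_mul]
        exact mul_le_mul (abs_digitW_sub_le hd hx (Finset.mem_range.1 hj))
          (hf j (Finset.mem_range.1 hj)) (abs_nonneg _) (by positivity)
    _ = _ := by simp; ring

theorem abs_digitMean_sub_le (hd : 2 ≤ d) (hx : 0 ≤ x) :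
    |digitMean d x - (d - 1) / 2| ≤ d ^ 3 * x := by
  have h := abs_sum_digitW_sub_le (x := x) hd hx (f := fun j => (j : ℝ)) (M := d) fun j hj => by
    rw [abs_of_nonneg (by positivity)]; exact_mod_cast hj.le
  have hd0 : (d : ℝ) ≠ 0 := by positivity
  rw [sum_range_cast, show (d : ℝ) * (d - 1) / 2 / d = (d - 1) / 2 by field_simp] at h
  calc _ ≤ _ := h
    _ = _ := by ring

theorem abs_digitVar_sub_le (hd : 2 ≤ d) (hx : 0 ≤ x) :
    |digitVar d x - (d - 1) * (d + 1) / 12| ≤ 3 * d ^ 4 * x := by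
  have h := abs_sum_digitW_sub_le (x := x) hd hx (f := fun j => (j : ℝ) ^ 2) (M := d ^ 2)
    fun j hj => by
      rw [abs_of_nonneg (by positivity)]
      gcongr
  have hd0 : (d : ℝ) ≠ 0 := by positivity
  rw [sum_range_cast_sq, show (d : ℝ) * (d - 1) * (2 * d - 1) / 6 / d = (d - 1) * (2 * d - 1) / 6 by
    field_simp] at h
  have h1 := abs_digitMean_sub_le hd hx
  have h2 := digitMean_nonneg (x := x) hd
  have h3 := digitMean_le (x := x) hd
  have hd1 : (2 : ℝ) ≤ d := by exact_mod_cast hd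
  have h4 : |digitMean d x ^ 2 - ((d - 1) / 2) ^ 2| ≤ d ^ 3 * x * (2 * d) := by
    rw [sq_sub_sq, mul_comm, abs_mul]
    refine mul_le_mul h1 ?_ (abs_nonneg _) (by positivity)
    rw [abs_le]; constructor <;> linarith
  rw [digitVar_eq hd]
  set S := ∑ j ∈ Finset.range d, digitW d x j * (j : ℝ) ^ 2
  have e : S - digitMean d x ^ 2 - (d - 1) * (d + 1) / 12
      = (S - (d - 1) * (2 * d - 1) / 6) - (digitMean d x ^ 2 - (((d : ℝ) - 1) / 2) ^ 2) := by ring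
  rw [e]
  calc _ ≤ _ := abs_sub _ _
    _ ≤ d ^ 2 * d ^ 2 * x + d ^ 3 * x * (2 * d) := add_le_add h h4
    _ = _ := by ring

theorem digitW_one_ge (hx : 0 ≤ x) (hd : 2 ≤ d) (hx1 : x ≤ 1) :
    Real.exp (-1) / d ≤ digitW d x 1 := by
  unfold digitW
  have := digitZ_pos (x := x) hd
  refine div_le_div₀ (Real.exp_pos _).le ?_ this (digitZ_le hx)
  rw [Real.exp_le_exp]; simpa using hx1

theorem digitMean_ge (hd : 2 ≤ d) (hx : 0 ≤ x) (hx1 : x ≤ 1) :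
    Real.exp (-1) / d ≤ digitMean d x := by
  have h1 := Finset.single_le_sum (s := Finset.range d) (f := fun j : ℕ => digitW d x j * j)
    (fun j _ => mul_nonneg (digitW_pos hd j).le (by positivity))
    (Finset.mem_range.2 (by omega : 1 < d))
  simp only [Nat.cast_one, mul_one] at h1
  exact (digitW_one_ge hx hd hx1).trans h1

theorem continuous_digitMean (hd : 2 ≤ d) : Continuous fun x => digitMean d x := by
  unfold digitMean digitW
  have : ∀ x, digitZ d x ≠ 0 := fun x => (digitZ_pos hd).ne'
  have h2 : Continuous fun x => digitZ d x := by unfold digitZ; fun_prop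
  fun_prop (disch := exact this _)

/-- The additive character `exp (2 π i y)`. -/
noncomputable def ech (y : ℝ) : ℂ := Complex.exp ((2 * Real.pi * y : ℝ) * Complex.I)

theorem norm_ech (y : ℝ) : ‖ech y‖ = 1 := Complex.norm_exp_ofReal_mul_I _

theorem ech_add (x y : ℝ) : ech (x + y) = ech x * ech y := by
  unfold ech
  rw [← Complex.exp_add]
  congr 1; push_cast; ring

@[simp] theorem ech_zero : ech 0 = 1 := by simp [ech]

theorem continuous_ech : Continuous ech := by unfold ech; fun_prop

theorem norm_ech_sub_one_le (y : ℝ) : ‖ech y - 1‖ ≤ 2 * Real.pi * |y| := by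
  unfold ech
  have := Real.norm_exp_I_mul_ofReal_sub_one_le (x := 2 * Real.pi * y)
  rw [mul_comm]
  refine this.trans (le_of_eq ?_)
  rw [Real.norm_eq_abs, abs_mul, abs_of_pos (by positivity)]

theorem normSq_add_mul_ech (a b y : ℝ) :
    ‖(a : ℂ) + b * ech y‖ ^ 2 = (a + b) ^ 2 - 2 * a * b * cosGap y := by
  rw [← Complex.normSq_eq_norm_sq, Complex.normSq_apply]
  have h1 : (ech y).re = Real.cos (2 * Real.pi * y) := by
    unfold ech; exact Complex.exp_ofReal_mul_I_re _
  have h2 : (ech y).im = Real.sin (2 * Real.pi * y) := by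
    unfold ech; exact Complex.exp_ofReal_mul_I_im _
  simp only [Complex.add_re, Complex.mul_re, Complex.ofReal_re, Complex.ofReal_im, Complex.add_im,
    Complex.mul_im, h1, h2, cosGap]
  linear_combination b ^ 2 * Real.sin_sq_add_cos_sq (2 * Real.pi * y)

/-- The decay rate of the characteristic function of a digit. -/
noncomputable def digitRate (d : ℕ) : ℝ := Real.exp (-1) / (d : ℝ) ^ 2

/-- The digits 0 and 1 alone provide the cancellation: their probabilities a and b satisfy a b ≥
`digitRate d` when x ≤ 1, and the remaining digits are bounded trivially. -/
theorem norm_digitExp_ech_le (hd : 2 ≤ d) (hx : 0 ≤ x) (hx1 : x ≤ 1) (y : ℝ) :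
    ‖digitExp d x fun j => ech (j * y)‖ ≤ Real.exp (-digitRate d * cosGap y) := by
  have hd0 : (0 : ℝ) < d := by positivity
  obtain ⟨e, rfl⟩ := Nat.exists_eq_add_of_le hd
  set d := 2 + e with hde
  have hsum := sum_digitW (x := x) hd
  rw [hde, add_comm 2 e, Finset.sum_range_succ', Finset.sum_range_succ'] at hsum
  unfold digitExp
  rw [hde, add_comm 2 e, Finset.sum_range_succ', Finset.sum_range_succ']
  rw [add_comm e 2, ← hde] at hsum ⊢
  simp only [zero_add, Nat.cast_zero, zero_mul, ech_zero, mul_one, Nat.cast_one, one_mul] at hsum ⊢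
  set a := digitW d x 0 with ha
  set b := digitW d x 1 with hb
  set S := ∑ k ∈ Finset.range e, digitW d x (k + 1 + 1)
  have ha0 : 1 / (d : ℝ) ≤ a := by
    rw [ha]; unfold digitW
    simp only [Nat.cast_zero, zero_mul, neg_zero, Real.exp_zero]
    exact one_div_le_one_div_of_le (digitZ_pos hd) (digitZ_le hx)
  have hb0 : Real.exp (-1) / d ≤ b := digitW_one_ge hx hd hx1
  have hapos : 0 < a := digitW_pos hd 0
  have hbpos : 0 < b := digitW_pos hd 1
  have hS : 0 ≤ S := Finset.sum_nonneg fun j _ => (digitW_pos hd _).le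
  have hc0 := cosGap_nonneg y
  have hab : digitRate d ≤ a * b := by
    have : digitRate d = 1 / d * (Real.exp (-1) / d) := by unfold digitRate; field_simp
    rw [this]; gcongr
  -- The square of the right side is at least (a + b)² - 2(a + b) a b `cosGap y`, and a + b ≤ 1
  -- brings this above the exact value (a + b)² - 2 a b `cosGap y`.
  have h1 : ‖(a : ℂ) + b * ech y‖ ≤ a + b - a * b * cosGap y := by
    have hsq := normSq_add_mul_ech a b y
    have hab1 : a + b ≤ 1 := by linarith
    have hc2 := cosGap_le_two y
    have hpos : 0 ≤ a + b - a * b * cosGap y := by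
      nlinarith [sq_nonneg (a - b), mul_pos hapos hbpos, mul_le_mul_of_nonneg_left hc2
        (mul_pos hapos hbpos).le]
    refine (sq_le_sq₀ (norm_nonneg _) hpos).1 ?_
    rw [hsq]
    nlinarith [mul_nonneg (mul_pos hapos hbpos).le hc0, sq_nonneg (a * b * cosGap y)]
  calc _ ≤ S + ‖(a : ℂ) + b * ech y‖ := by
        rw [add_assoc, add_comm (_ * ech y)]
        refine (norm_add_le _ _).trans (add_le_add_left ?_ _)
        refine (norm_sum_le _ _).trans (Finset.sum_le_sum fun j _ => ?_)
        rw [norm_mul, norm_ech, mul_one, Complex.norm_real,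
          Real.norm_of_nonneg (digitW_pos hd _).le]
    _ ≤ 1 - a * b * cosGap y := by linarith
    _ ≤ 1 - digitRate d * cosGap y := by gcongr
    _ ≤ _ := by
        have := Real.add_one_le_exp (-digitRate d * cosGap y)
        linarith

/-- The expected distance of a phase from `1`. -/
theorem digitExp_cov_le (hd : 2 ≤ d) (hx : 0 ≤ x) {U : ℕ → ℂ} {u : ℂ} {M : ℝ}
    (hU : ∀ j < d, ‖U j - u‖ ≤ M) (y : ℝ) :
    ‖(digitExp d x fun j => U j * ech (j * y)) - digitExp d x U * digitExp d x fun j => ech (j * y)‖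
      ≤ 2 * M * min 2 (2 * Real.pi * d ^ 2 * |y| * Real.exp (-x)) := by
  have hM : 0 ≤ M := (norm_nonneg _).trans (hU 0 (by omega))
  set κ := ∑ j ∈ Finset.range d, digitW d x j * ‖ech (j * y) - 1‖ with hκ
  have hκ0 : 0 ≤ κ := Finset.sum_nonneg fun j _ => mul_nonneg (digitW_pos hd j).le (norm_nonneg _)
  -- The bound 2 is trivial; the other one uses that a phase differs from 1 only at non-zero digits.
  have hκ1 : κ ≤ min 2 (2 * Real.pi * d ^ 2 * |y| * Real.exp (-x)) := by
    refine le_min (sum_digitW_mul_le hd fun j _ => ?_) ?_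
    · refine (norm_sub_le _ _).trans ?_
      rw [norm_ech, norm_one]; norm_num
    · refine (sum_digitW_mul_le_exp hd hx (M := 2 * Real.pi * (d * |y|)) (by simp)
        (by positivity) fun j hj => ?_).trans (le_of_eq (by ring))
      refine (norm_ech_sub_one_le _).trans ?_
      rw [abs_mul, abs_of_nonneg (by positivity : (0 : ℝ) ≤ j)]
      gcongr
  -- A covariance is unchanged when the constants u and 1 are subtracted from its two arguments.
  have e : (digitExp d x fun j => U j * ech (j * y))
      - digitExp d x U * digitExp d x (fun j => ech (j * y))
      = digitExp d x (fun j => (U j - u) * (ech (j * y) - 1))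
        - digitExp d x (fun j => U j - u) * digitExp d x (fun j => ech (j * y) - 1) := by
    have h1 : (fun j : ℕ => (U j - u) * (ech (j * y) - 1))
        = fun j => (U j * ech (j * y) - U j) - (u * ech (j * y) - u) := by funext j; ring
    rw [h1, digitExp_sub, digitExp_sub, digitExp_sub, digitExp_sub, digitExp_sub,
      digitExp_const_mul, digitExp_const hd, digitExp_const hd]
    ring
  rw [e]
  have h2 : ‖digitExp d x (fun j => (U j - u) * (ech (j * y) - 1))‖ ≤ M * κ := by
    refine (norm_digitExp_le_sum hd _).trans ?_
    rw [hκ, Finset.mul_sum]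
    refine Finset.sum_le_sum fun j hj => ?_
    rw [norm_mul]
    have h3 := hU j (Finset.mem_range.1 hj)
    have h4 := (digitW_pos (x := x) hd j).le
    calc digitW d x j * (‖U j - u‖ * ‖ech (j * y) - 1‖)
        ≤ digitW d x j * (M * ‖ech (j * y) - 1‖) := by gcongr
      _ = _ := by ring
  have h5 : ‖digitExp d x (fun j => U j - u) * digitExp d x (fun j => ech (j * y) - 1)‖ ≤ M * κ := by
    rw [norm_mul]
    exact mul_le_mul (norm_digitExp_le hd hU) (norm_digitExp_le_sum hd _) (norm_nonneg _) hM
  calc _ ≤ M * κ + M * κ := (norm_sub_le _ _).trans (add_le_add h2 h5)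
    _ = 2 * M * κ := by ring
    _ ≤ _ := by gcongr

theorem norm_exp_I_sub_taylor_le (z : ℝ) :
    ‖Complex.exp (z * Complex.I) - (1 + z * Complex.I - z ^ 2 / 2)‖ ≤ 4 * |z| ^ 3 := by
  rcases le_total |z| 1 with h | h
  · have hn : ‖(z : ℂ) * Complex.I‖ = |z| := by simp
    have h1 := Complex.norm_exp_sub_sum_le_norm_mul_exp ((z : ℂ) * Complex.I) 3
    rw [hn] at h1
    simp only [Finset.sum_range_succ, Finset.sum_range_zero, Nat.factorial] at h1
    have e : (1 : ℂ) + z * Complex.I - z ^ 2 / 2 = 0 + (z * Complex.I) ^ 0 / ((1 : ℕ) : ℂ)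
        + (z * Complex.I) ^ 1 / ((((0 : ℕ) + 1) * 1 : ℕ) : ℂ)
        + (z * Complex.I) ^ 2 / ((((1 : ℕ) + 1) * ((0 + 1) * 1) : ℕ) : ℂ) := by
      have : ((z : ℂ) * Complex.I) ^ 2 = -z ^ 2 := by rw [mul_pow, Complex.I_sq]; ring
      rw [this]; push_cast; ring
    rw [e]
    refine h1.trans ?_
    rw [mul_comm]
    gcongr
    calc Real.exp |z| ≤ Real.exp 1 := by gcongr
      _ ≤ 4 := by linarith [Real.exp_one_lt_d9]
  · have h1 : ‖Complex.exp (z * Complex.I)‖ = 1 := Complex.norm_exp_ofReal_mul_I z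
    have h2 : ‖(1 : ℂ) + z * Complex.I - z ^ 2 / 2‖ ≤ 1 + |z| + |z| ^ 2 / 2 := by
      refine (norm_sub_le _ _).trans (add_le_add ((norm_add_le _ _).trans (by simp)) ?_)
      simp
    refine (norm_sub_le _ _).trans ?_
    nlinarith [mul_nonneg (sub_nonneg.2 h) (abs_nonneg z), sq_nonneg (|z|), pow_le_pow_right₀ h
      (by norm_num : 2 ≤ 3), pow_le_pow_right₀ h (by norm_num : 1 ≤ 3),
      pow_le_pow_right₀ h (by norm_num : 0 ≤ 3)]

theorem abs_exp_neg_sub_le {t : ℝ} (ht : 0 ≤ t) : |Real.exp (-t) - (1 - t)| ≤ t ^ 2 / 2 := by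
  have h1 := Real.add_one_le_exp (-t)
  have h2 := Real.quadratic_le_exp_of_nonneg ht
  have h3 : Real.exp (-t) ≤ 1 - t + t ^ 2 / 2 := by
    rw [Real.exp_neg, inv_le_iff_one_le_mul₀ (Real.exp_pos t)]
    have h4 : 0 ≤ 1 - t + t ^ 2 / 2 := by nlinarith [sq_nonneg (t - 1)]
    nlinarith [mul_le_mul_of_nonneg_left h2 h4, pow_nonneg ht 4]
  rw [abs_le]; constructor <;> nlinarith [sq_nonneg t]

/-- Gaussian approximation of the characteristic function of a centred digit. -/
theorem norm_digitExp_sub_gaussian_le (hd : 2 ≤ d) (hx : 0 ≤ x) (y : ℝ) :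
    ‖(digitExp d x fun j => Complex.exp ((y * (j - digitMean d x) : ℝ) * Complex.I))
      - (Real.exp (-(y ^ 2 * digitVar d x / 2)) : ℝ)‖
      ≤ 8 * d ^ 6 * (|y| ^ 3 + y ^ 4) * Real.exp (-x) := by
  set μ := digitMean d x with hμ
  set v := digitVar d x with hv
  have hd1 : (1 : ℝ) ≤ d := by exact_mod_cast (by omega : 1 ≤ d)
  have hv0 : 0 ≤ v := digitVar_nonneg hd
  have hmean : digitExp d x (fun j => ((j - μ : ℝ) : ℂ)) = 0 := by
    simp only [Complex.ofReal_sub]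
    rw [digitExp_sub, digitExp_const hd]
    simp only [digitExp, hμ, digitMean]
    push_cast
    exact sub_self _
  have hvar : digitExp d x (fun j => (((j - μ) ^ 2 : ℝ) : ℂ)) = v := by
    simp only [digitExp, hv, digitVar]
    push_cast
    rfl
  -- Centring removes the linear term, so the characteristic function and the Gaussian are both
  -- compared with 1 - y² v / 2.
  have htaylor : digitExp d x (fun j => 1 + (y * (j - μ) : ℝ) * Complex.I
      - ((y * (j - μ) : ℝ) : ℂ) ^ 2 / 2) = ((1 - y ^ 2 * v / 2 : ℝ) : ℂ) := by
    have e : (fun j : ℕ => 1 + ((y * (j - μ) : ℝ) : ℂ) * Complex.I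
      - ((y * (j - μ) : ℝ) : ℂ) ^ 2 / 2) = fun j : ℕ => (1 + (y * Complex.I) * ((j - μ : ℝ) : ℂ))
        - (y ^ 2 / 2 : ℂ) * (((j - μ) ^ 2 : ℝ) : ℂ) := by
      funext j; push_cast; ring
    rw [e, digitExp_sub, digitExp_add, digitExp_const_mul, digitExp_const_mul, digitExp_const hd,
      hmean, hvar]
    push_cast; ring
  have h1 : ‖(digitExp d x fun j => Complex.exp ((y * (j - μ) : ℝ) * Complex.I))
      - ((1 - y ^ 2 * v / 2 : ℝ) : ℂ)‖ ≤ 8 * d ^ 4 * |y| ^ 3 * Real.exp (-x) := by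
    rw [← htaylor, ← digitExp_sub]
    refine (norm_digitExp_le_sum hd _).trans ?_
    calc _ ≤ ∑ j ∈ Finset.range d, 4 * |y| ^ 3 * (digitW d x j * |(j : ℝ) - μ| ^ (2 + 1)) := by
          refine Finset.sum_le_sum fun j _ => ?_
          have h2 := norm_exp_I_sub_taylor_le (y * (j - μ))
          have h3 := (digitW_pos (x := x) hd j).le
          calc _ ≤ digitW d x j * (4 * |y * (j - μ)| ^ 3) := by gcongr
            _ = _ := by rw [abs_mul, mul_pow]; ring
      _ ≤ 4 * |y| ^ 3 * (2 * d ^ (2 + 2) * Real.exp (-x)) := by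
          rw [← Finset.mul_sum]
          gcongr
          exact sum_digitW_pow_le hd hx 2
      _ = _ := by ring
  have h4 : ‖((1 - y ^ 2 * v / 2 : ℝ) : ℂ) - (Real.exp (-(y ^ 2 * v / 2)) : ℝ)‖
      ≤ 8 * d ^ 6 * y ^ 4 * Real.exp (-x) := by
    rw [← Complex.ofReal_sub, Complex.norm_real, Real.norm_eq_abs, abs_sub_comm]
    refine (abs_exp_neg_sub_le (by positivity)).trans ?_
    have h5 : v ≤ 2 * d ^ 3 * Real.exp (-x) := digitVar_le_exp hd hx
    have h6 : Real.exp (-x) ≤ 1 := by rw [Real.exp_le_one_iff]; linarith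
    calc (y ^ 2 * v / 2) ^ 2 / 2 = y ^ 4 / 8 * (v * v) := by ring
      _ ≤ y ^ 4 / 8 * ((2 * d ^ 3 * Real.exp (-x)) * (2 * d ^ 3 * 1)) := by
          gcongr
          exact h5.trans (by gcongr)
      _ ≤ _ := by
          have : 0 ≤ d ^ 6 * y ^ 4 * Real.exp (-x) := by positivity
          nlinarith
  calc _ ≤ 8 * d ^ 4 * |y| ^ 3 * Real.exp (-x) + 8 * d ^ 6 * y ^ 4 * Real.exp (-x) :=
        (norm_sub_le_norm_sub_add_norm_sub _ _ _).trans (add_le_add h1 h4)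
    _ ≤ 8 * d ^ 6 * |y| ^ 3 * Real.exp (-x) + 8 * d ^ 6 * y ^ 4 * Real.exp (-x) := by
        gcongr
        norm_num
    _ = _ := by ring

end MultiBase

/-! ### Representations as Fourier coefficients -/

namespace MultiBase

theorem integral_ech_int_mul (k : ℤ) :
    ∫ θ in (-1 / 2 : ℝ)..1 / 2, ech (k * θ) = if k = 0 then 1 else 0 := by
  split_ifs with hk
  · subst hk
    simp only [Int.cast_zero, zero_mul, ech_zero, intervalIntegral.integral_const]
    norm_num
  · have hc : (2 * Real.pi * k * Complex.I : ℂ) ≠ 0 := by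
      simp [Real.pi_ne_zero, hk]
    have e : (fun θ : ℝ => ech (k * θ)) = fun θ : ℝ => Complex.exp ((2 * Real.pi * k * Complex.I) * θ) := by
      funext θ; unfold ech; congr 1; push_cast; ring
    rw [e, integral_exp_mul_complex hc, div_eq_zero_iff]
    left
    rw [sub_eq_zero, Complex.exp_eq_exp_iff_exists_int]
    refine ⟨k, ?_⟩
    push_cast; ring

theorem prod_ech {ι : Type*} (s : Finset ι) (f : ι → ℝ) :
    ∏ i ∈ s, ech (f i) = ech (∑ i ∈ s, f i) := by
  classical
  induction s using Finset.induction_on with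
  | empty => simp
  | insert i s hi ih => rw [Finset.prod_insert hi, Finset.sum_insert hi, ech_add, ih]

theorem prod_sum_eq_sum_finsupp (T : Finset ℕ) (d : ℕ) (F : ℕ → ℕ → ℂ) :
    ∏ h ∈ T, ∑ j ∈ Finset.range d, F h j
      = ∑ a ∈ T.finsupp fun _ => Finset.range d, ∏ h ∈ T, F h (a h) := by
  rw [Finset.prod_sum, Finset.finsupp, Finset.sum_map]
  refine Finset.sum_congr (by congr!) fun q _ => ?_
  rw [← Finset.prod_attach T]
  refine Finset.prod_congr rfl fun h _ => ?_
  simp only [Function.Embedding.coeFn_mk]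
  rw [Finsupp.indicator_of_mem h.2]

variable {m : ℕ}

theorem reps_eq_filter {p : Fin m → ℕ} (hp : ∀ j, 1 < p j) {d : ℕ} (hd : 2 ≤ d) (n : ℕ) :
    reps p d n = ((terms p n).finsupp fun _ => Finset.range d).filter
      fun a => ∑ h ∈ terms p n, a h * h = n := by
  classical
  have hp' : ∀ j, 0 < p j := fun j => by have := hp j; omega
  ext a
  have hsum : ∀ {s : Finset ℕ}, a.support ⊆ s → (a.sum fun h c => c * h) = ∑ h ∈ s, a h * h :=
    fun hs => Finsupp.sum_of_support_subset _ hs _ (by simp)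
  rw [Finset.mem_filter, Finset.mem_finsupp_iff]
  constructor
  · intro ha
    have hrep := (mem_reps hp').1 ha
    have hs : a.support ⊆ terms p n := by
      intro h hh
      refine (mem_terms hp).2 ⟨hrep.support_subset h hh, ?_⟩
      unfold reps at ha
      rw [Finset.mem_filter, Finset.mem_finsupp_iff] at ha
      exact_mod_cast (Finset.mem_Icc.1 (ha.1.1 hh)).2
    exact ⟨⟨hs, fun h _ => Finset.mem_range.2 (hrep.digit_lt h)⟩,
      (hsum hs).symm.trans hrep.sum_eq⟩
  · rintro ⟨⟨hs, hr⟩, he⟩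
    rw [mem_reps hp']
    refine ⟨fun h hh => ((mem_terms hp).1 (hs hh)).1, fun h => ?_, (hsum hs).trans he⟩
    by_cases hh : h ∈ terms p n
    · exact Finset.mem_range.1 (hr h hh)
    · have : a h = 0 := Finsupp.notMem_support_iff.1 fun h' => hh (hs h')
      omega

/-- Sums of products over the representations of `n` are Fourier coefficients. -/
theorem sum_reps_prod {p : Fin m → ℕ} (hp : ∀ j, 1 < p j) {d : ℕ} (hd : 2 ≤ d) (n : ℕ)
    (g : ℕ → ℕ → ℂ) :
    ∑ a ∈ reps p d n, ∏ h ∈ terms p n, g h (a h)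
      = ∫ θ in (-1 / 2 : ℝ)..1 / 2, (∏ h ∈ terms p n,
          ∑ j ∈ Finset.range d, g h j * ech (j * (h * θ))) * ech (-(n * θ)) := by
  classical
  have hce := continuous_ech
  have e : ∀ θ : ℝ, (∏ h ∈ terms p n, ∑ j ∈ Finset.range d, g h j * ech (j * (h * θ)))
      * ech (-(n * θ)) = ∑ a ∈ (terms p n).finsupp fun _ => Finset.range d,
        (∏ h ∈ terms p n, g h (a h)) * ech (((∑ h ∈ terms p n, a h * h : ℕ) - n : ℤ) * θ) := by
    intro θ
    rw [prod_sum_eq_sum_finsupp, Finset.sum_mul]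
    refine Finset.sum_congr rfl fun a _ => ?_
    rw [Finset.prod_mul_distrib, prod_ech, mul_assoc, ← ech_add]
    congr 2
    push_cast
    rw [sub_mul, Finset.sum_mul, sub_eq_add_neg]
    simp only [mul_assoc]
  simp only [e]
  rw [intervalIntegral.integral_finsetSum fun a _ =>
    Continuous.intervalIntegrable (by fun_prop) _ _]
  simp only [intervalIntegral.integral_const_mul, integral_ech_int_mul]
  rw [reps_eq_filter hp hd, Finset.sum_filter]
  refine Finset.sum_congr rfl fun a _ => ?_
  simp only [sub_eq_zero, Nat.cast_inj]
  split_ifs <;> simp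

/-- The normalising constant between the uniform measure on representations and the Boltzmann
measure. -/
noncomputable def tiltConst (p : Fin m → ℕ) (d n : ℕ) (r : ℝ) : ℝ :=
  Real.exp (-(n * r)) / ∏ h ∈ terms p n, digitZ d (r * h)

/-- The unnormalised expectation of `∏ u h (a h)` over representations of `n`, as a Fourier
coefficient of a product of single digit expectations. -/
noncomputable def tiltInt (p : Fin m → ℕ) (d n : ℕ) (r : ℝ) (u : ℕ → ℕ → ℂ) : ℂ :=
  ∫ θ in (-1 / 2 : ℝ)..1 / 2, (∏ h ∈ terms p n,
    digitExp d (r * h) fun j => u h j * ech (j * (h * θ))) * ech (-(n * θ))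

/-- The Boltzmann weight of a family is ∏ e^(-r h a_h) = e^(-nr) on every representation, up to the
common partition function. Tilting by r therefore changes a sum over representations only by a
constant factor. -/
theorem sum_reps_mul_tiltConst {p : Fin m → ℕ} (hp : ∀ j, 1 < p j) {d : ℕ} (hd : 2 ≤ d) (n : ℕ)
    (r : ℝ) (u : ℕ → ℕ → ℂ) :
    (∑ a ∈ reps p d n, ∏ h ∈ terms p n, u h (a h)) * tiltConst p d n r = tiltInt p d n r u := by
  have h := sum_reps_prod hp hd n fun h j => (digitW d (r * h) j : ℂ) * u h j
  unfold tiltInt digitExp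
  simp only [mul_assoc] at h ⊢
  rw [← h, Finset.sum_mul]
  refine Finset.sum_congr rfl fun a ha => ?_
  rw [reps_eq_filter hp hd, Finset.mem_filter] at ha
  rw [Finset.prod_mul_distrib, mul_comm]
  congr 1
  rw [← Complex.ofReal_prod]
  congr 1
  unfold tiltConst digitW
  rw [Finset.prod_div_distrib, ← Real.exp_sum]
  congr 2
  have hn : (n : ℝ) * r = ∑ h ∈ terms p n, (a h : ℝ) * (r * h) := by
    conv_lhs => rw [← ha.2]
    push_cast
    rw [Finset.sum_mul]
    exact Finset.sum_congr rfl fun h _ => by ring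
  rw [Finset.sum_neg_distrib, hn]

/-- The Boltzmann probability that the value is `n`. -/
noncomputable def tiltProb (p : Fin m → ℕ) (d n : ℕ) (r : ℝ) : ℂ :=
  tiltInt p d n r fun _ _ => 1

theorem tiltProb_eq {p : Fin m → ℕ} (hp : ∀ j, 1 < p j) {d : ℕ} (hd : 2 ≤ d) (n : ℕ) (r : ℝ) :
    tiltProb p d n r = (((reps p d n).card * tiltConst p d n r : ℝ) : ℂ) := by
  unfold tiltProb
  rw [← sum_reps_mul_tiltConst hp hd]
  simp

/-- The complex-valued average over all representations. -/
noncomputable def avg (p : Fin m → ℕ) (d n : ℕ) (f : (ℕ →₀ ℕ) → ℂ) : ℂ :=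
  (∑ a ∈ reps p d n, f a) / (reps p d n).card

theorem ofReal_expect (p : Fin m → ℕ) (d n : ℕ) (f : (ℕ →₀ ℕ) → ℝ) :
    (expect p d n f : ℂ) = avg p d n fun a => (f a : ℂ) := by
  simp [expect, avg]

/-- Conditional expectation times probability of the condition equals the joint expectation. The
product form holds even without representations, both sides then being 0. -/
theorem avg_prod_mul_tiltProb {p : Fin m → ℕ} (hp : ∀ j, 1 < p j) {d : ℕ} (hd : 2 ≤ d) (n : ℕ)
    (r : ℝ) (u : ℕ → ℕ → ℂ) :
    avg p d n (fun a => ∏ h ∈ terms p n, u h (a h)) * tiltProb p d n r = tiltInt p d n r u := by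
  rw [tiltProb_eq hp hd, ← sum_reps_mul_tiltConst hp hd, avg]
  rcases Finset.eq_empty_or_nonempty (reps p d n) with h | h
  · simp [h]
  · have : ((reps p d n).card : ℂ) ≠ 0 := by exact_mod_cast h.card_pos.ne'
    push_cast
    field_simp

end MultiBase

/-! ### The tilting parameter and the major and minor arcs -/

namespace MultiBase

/-- Every moment weight concentrates at x ≍ 1. Dominating all of them by one function lets
`sum_terms_min_le` control every sum over h. -/
theorem pow_mul_exp_neg_le (k : ℕ) {x : ℝ} (hx : 0 < x) :
    x ^ (k + 1) * Real.exp (-x) ≤ (k + 2).factorial * min x x⁻¹ := by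
  have key : ∀ i : ℕ, x ^ i * Real.exp (-x) ≤ i.factorial := by
    intro i
    have := Real.pow_div_factorial_le_exp x hx.le i
    rw [div_le_iff₀ (by positivity)] at this
    rw [Real.exp_neg, ← div_eq_mul_inv, div_le_iff₀ (Real.exp_pos x), mul_comm]
    exact this
  rw [mul_min_of_nonneg _ _ (by positivity)]
  refine le_min ?_ ?_
  · calc x ^ (k + 1) * Real.exp (-x) = x ^ k * Real.exp (-x) * x := by ring
      _ ≤ k.factorial * x := by gcongr; exact key k
      _ ≤ _ := by gcongr; omega
  · rw [← div_eq_mul_inv, le_div_iff₀ hx]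
    calc x ^ (k + 1) * Real.exp (-x) * x = x ^ (k + 2) * Real.exp (-x) := by ring
      _ ≤ _ := key _

theorem card_expSet_le_of_one_le_log {m : ℕ} {p : Fin m → ℕ} (hp : ∀ j, 1 < p j) :
    ∃ C ≥ 1, ∀ x : ℝ, 0 < x → 1 ≤ Real.log x → ((expSet p x).card : ℝ) ≤ C * Real.log x ^ m := by
  set Λ := ∑ j, Real.log (p j)
  have hΛ : 0 ≤ Λ := Finset.sum_nonneg fun j _ => Real.log_nonneg (by exact_mod_cast (hp j).le)
  have hc := countConst_pos hp
  refine ⟨max 1 (countConst p * (1 + Λ) ^ m), le_max_left _ _, fun x hx0 hx => ?_⟩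
  have hx1 : 1 ≤ x := by
    by_contra h
    have := Real.log_nonpos hx0.le (not_le.1 h).le
    linarith
  refine (card_expSet_bounds hp hx1).2.trans ?_
  calc countConst p * (Real.log x + Λ) ^ m ≤ countConst p * ((1 + Λ) * Real.log x) ^ m := by
        gcongr
        nlinarith
    _ = countConst p * (1 + Λ) ^ m * Real.log x ^ m := by rw [mul_pow]; ring
    _ ≤ _ := by gcongr; exact le_max_right _ _

variable {k : ℕ} {p : Fin (k + 1) → ℕ}

/-- By the counting recursion, the elements of S in (x / p_0, x] are as many as exponent vectors in
one dimension less. This supplies the order (log x)^k of terms of size about x. -/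
theorem card_terms_sdiff (hp : ∀ j, 1 < p j) (hcop : ∀ i j, i ≠ j → Nat.Coprime (p i) (p j))
    {x : ℝ} (hx : 0 ≤ x) :
    (terms p x \ terms p (x / p 0)).card = (expSet (Fin.tail p) x).card := by
  have hp0 : (1 : ℝ) ≤ p 0 := by exact_mod_cast (hp 0).le
  rw [Finset.card_sdiff_of_subset (terms_mono hp (div_le_self hx hp0)), card_terms hp hcop,
    card_terms hp hcop, card_expSet_succ hp x]
  omega

/-- The tilting parameter `r` makes the expected value of the random digits equal to `n`, and has
the correct order of magnitude. -/
structure IsTilt (p : Fin (k + 1) → ℕ) (d : ℕ) (C : ℝ) (n : ℕ) (r : ℝ) : Prop where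
  lower : 1 ≤ r * n
  upper : r * n ≤ C * Real.log n ^ k
  mean_eq : ∑ h ∈ terms p n, h * digitMean d (r * h) = n

/-- The expected value is continuous in r, so the intermediate value theorem applies between r =
1/n, where it is at least n, and r = C L^k / n, where it is at most n. -/
theorem exists_isTilt (hk : 1 ≤ k) (hp : ∀ j, 1 < p j)
    (hcop : ∀ i j, i ≠ j → Nat.Coprime (p i) (p j)) {d : ℕ} (hd : 2 ≤ d) :
    ∃ C ≥ 1, ∀ᶠ n : ℕ in atTop, ∃ r, IsTilt p d C n r := by
  have hpt : ∀ j, 1 < Fin.tail p j := fun j => hp _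
  obtain ⟨C', hC', hcard⟩ := card_expSet_le_of_one_le_log hpt
  have hd0 : (0 : ℝ) < d := by positivity
  have hd1 : (1 : ℝ) ≤ d := by exact_mod_cast (by omega : 1 ≤ d)
  have hp0 : (1 : ℝ) < p 0 := by exact_mod_cast hp 0
  have hc := countConst_pos hpt
  -- The factor 2 d² comes from the mean d² e^(-x) with x e^(-x) ≤ 2 min(x, 1/x), and 4 C' from
  -- `sum_terms_min_le`.
  set C := 8 * d ^ 2 * C' with hC
  have hC1 : 1 ≤ C := by nlinarith [one_le_pow₀ hd1 (n := 2)]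
  refine ⟨C, hC1, ?_⟩
  have hlog : Tendsto (fun n : ℕ => Real.log n) atTop atTop :=
    Real.tendsto_log_atTop.comp tendsto_natCast_atTop_atTop
  filter_upwards [hlog.eventually_ge_atTop 1,
    hlog.eventually_ge_atTop ((p 0 * d * Real.exp 1) / countConst (Fin.tail p)),
    eventually_ge_atTop 1] with n h1 h2 hn
  have hn0 : (0 : ℝ) < n := by positivity
  have hn1 : (1 : ℝ) ≤ n := by exact_mod_cast hn
  set L := Real.log n
  have hLk : L ≤ L ^ k := le_self_pow₀ h1 (by omega)
  have hLk1 : 1 ≤ L ^ k := h1.trans hLk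
  set f : ℝ → ℝ := fun r => ∑ h ∈ terms p n, h * digitMean d (r * h) with hf
  have hfc : Continuous f := by
    have := continuous_digitMean hd
    rw [hf]; fun_prop
  have hmpos : ∀ x, 0 ≤ digitMean d x := fun x => digitMean_nonneg hd
  set r1 : ℝ := 1 / n with hr1
  set r2 : ℝ := C * L ^ k / n with hr2
  have hr12 : r1 ≤ r2 := by
    rw [hr1, hr2]; gcongr; nlinarith
  have hr2pos : 0 < r2 := by positivity
  -- The elements of S in (n / p_0, n] suffice: each contributes at least n / (e d p_0), and their
  -- number is at least a constant times L^k ≥ L, hence eventually large enough.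
  have hf1 : (n : ℝ) ≤ f r1 := by
    have hsub : terms p n \ terms p (n / p 0) ⊆ terms p n := Finset.sdiff_subset
    calc (n : ℝ) ≤ (expSet (Fin.tail p) n).card * (n / p 0 * (Real.exp (-1) / d)) := by
          have h3 := (card_expSet_bounds hpt hn1).1
          rw [div_le_iff₀ hc] at h2
          have h4 : p 0 * d * Real.exp 1 ≤ (expSet (Fin.tail p) n).card := by
            refine h2.trans (le_trans ?_ h3)
            rw [mul_comm]; gcongr
          calc (n : ℝ) = (p 0 * d * Real.exp 1) * (n / p 0 * (Real.exp (-1) / d)) := by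
                rw [Real.exp_neg]; field_simp
            _ ≤ _ := by gcongr
      _ = ∑ h ∈ terms p n \ terms p (n / p 0), (n / p 0 * (Real.exp (-1) / d)) := by
          rw [Finset.sum_const, card_terms_sdiff hp hcop hn0.le, nsmul_eq_mul]
      _ ≤ ∑ h ∈ terms p n \ terms p (n / p 0), h * digitMean d (r1 * h) := by
          refine Finset.sum_le_sum fun h hh => ?_
          rw [Finset.mem_sdiff, mem_terms hp, mem_terms hp] at hh
          obtain ⟨⟨hb, hle⟩, hnot⟩ := hh
          have hgt : (n : ℝ) / p 0 ≤ h := by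
            by_contra hlt
            exact hnot ⟨hb, (not_le.1 hlt).le⟩
          have := digitMean_ge (x := r1 * h) hd (by positivity) (by
            rw [hr1, one_div, inv_mul_le_iff₀ hn0, mul_one]; exact hle)
          gcongr
      _ ≤ f r1 := Finset.sum_le_sum_of_subset_of_nonneg hsub fun h _ _ =>
          mul_nonneg (by positivity) (hmpos _)
  have hf2 : f r2 ≤ n := by
    calc f r2 ≤ ∑ h ∈ terms p n, d ^ 2 / r2 * (2 * min (r2 * h) (r2 * h)⁻¹) := by
          refine Finset.sum_le_sum fun h hh => ?_
          have hh0 : (0 : ℝ) < h := by exact_mod_cast pos_of_mem_terms hp hh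
          have h3 := digitMean_le_exp (x := r2 * h) hd (by positivity)
          have h4 := pow_mul_exp_neg_le 0 (x := r2 * h) (by positivity)
          have h5 : ((0 + 2).factorial : ℝ) = 2 := by norm_num [Nat.factorial]
          rw [zero_add, pow_one, ← zero_add 2, h5] at h4
          calc (h : ℝ) * digitMean d (r2 * h) ≤ h * (d ^ 2 * Real.exp (-(r2 * h))) := by gcongr
            _ = d ^ 2 / r2 * (r2 * h * Real.exp (-(r2 * h))) := by field_simp
            _ ≤ _ := by
                exact mul_le_mul_of_nonneg_left h4 (by positivity)
      _ = 2 * d ^ 2 / r2 * ∑ h ∈ terms p n, min (r2 * h) (r2 * h)⁻¹ := by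
          rw [Finset.mul_sum]
          exact Finset.sum_congr rfl fun _ _ => by ring
      _ ≤ 2 * d ^ 2 / r2 * (4 * (C' * L ^ k)) := by
          gcongr
          refine (sum_terms_min_le hp hcop n hr2pos).trans ?_
          gcongr
          exact hcard n hn0 h1
      _ = n := by
          rw [hr2, hC]; field_simp; norm_num
  obtain ⟨r, hr, hrn⟩ := intermediate_value_Icc' hr12 hfc.continuousOn ⟨hf2, hf1⟩
  refine ⟨r, ?_, ?_, hrn⟩
  · rw [← div_le_iff₀ hn0]; exact hr.1
  · rw [← le_div_iff₀ hn0]; exact hr.2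

theorem tendsto_log_natCast : Tendsto (fun n : ℕ => Real.log n) atTop atTop :=
  Real.tendsto_log_atTop.comp tendsto_natCast_atTop_atTop

theorem IsTilt.pos {d n : ℕ} {C r : ℝ} (h : IsTilt p d C n r) : 0 < r := by
  by_contra hr
  have := h.lower
  have : r * n ≤ 0 := mul_nonpos_of_nonpos_of_nonneg (not_lt.1 hr) (by positivity)
  linarith

/-- Eventual properties of `1 / r` hold for tilting parameters of large `n`. -/
theorem eventually_isTilt_of_eventually {d : ℕ} {C : ℝ} {P : ℝ → Prop}
    (hP : ∀ᶠ M in atTop, P M) :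
    ∀ᶠ n : ℕ in atTop, ∀ r, IsTilt p d C n r → P r⁻¹ := by
  obtain ⟨M0, hM0⟩ := eventually_atTop.1 hP
  have h1 := tendsto_natCast_atTop_atTop (R := ℝ) |>.eventually
    (eventually_mul_log_pow_le (C * max M0 1) k)
  filter_upwards [h1, tendsto_log_natCast.eventually_ge_atTop 1, eventually_ge_atTop 1]
    with n hn hL hn1 r hr
  have hr0 := hr.pos
  have hu := hr.upper
  refine hM0 _ ?_
  have hn0 : (0 : ℝ) < n := by positivity
  rw [← one_div, le_div_iff₀ hr0]
  refine le_trans (mul_le_mul_of_nonneg_right (le_max_left M0 1) hr0.le) ?_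
  have : max M0 1 * (r * n) ≤ max M0 1 * (C * Real.log n ^ k) := by gcongr
  refine le_of_mul_le_mul_right ?_ hn0
  linarith

/-- Taking logarithms of 1 ≤ r n ≤ C L^k. The O(log log n) gap between log (1/r) and log n is the
origin of the error term of the theorem. -/
theorem eventually_isTilt_log {d : ℕ} {C : ℝ} (hC : 1 ≤ C) :
    ∃ K ≥ 1, ∀ᶠ n : ℕ in atTop, ∀ r, IsTilt p d C n r →
      Real.log r⁻¹ ≤ Real.log n ∧ Real.log n / 2 ≤ Real.log r⁻¹ ∧
      Real.log n - Real.log r⁻¹ ≤ K * Real.log (Real.log n) := by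
  have hlC := Real.log_nonneg hC
  refine ⟨Real.log C + k + 1, by
    have : (0 : ℝ) ≤ k := by positivity
    linarith, ?_⟩
  have h1 := tendsto_log_natCast.eventually
    (eventually_mul_log_pow_le (2 * (Real.log C + k + 1)) 1)
  filter_upwards [h1, tendsto_log_natCast.eventually_ge_atTop 1,
    (Real.tendsto_log_atTop.comp tendsto_log_natCast).eventually_ge_atTop 1,
    eventually_ge_atTop 1] with n hn hL hLL hn1 r hr
  have hr0 := hr.pos
  have hn0 : (0 : ℝ) < n := by positivity
  simp only [Function.comp] at hLL
  set L := Real.log n with hLdef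
  have e : Real.log (r * n) = L - Real.log r⁻¹ := by
    rw [Real.log_mul hr0.ne' hn0.ne', Real.log_inv]; ring
  have h2 := Real.log_nonneg hr.lower
  have h3 := Real.log_le_log (by linarith [hr.lower]) hr.upper
  rw [e, Real.log_mul (by linarith) (by positivity), Real.log_pow] at h3
  rw [pow_one] at hn
  have h4 : Real.log C + k * Real.log L ≤ (Real.log C + k + 1) * Real.log L := by nlinarith
  refine ⟨by linarith, by linarith, by linarith⟩

theorem eventually_sum_min_le (hp : ∀ j, 1 < p j)
    (hcop : ∀ i j, i ≠ j → Nat.Coprime (p i) (p j)) :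
    ∃ K ≥ 1, ∀ᶠ n : ℕ in atTop, ∀ r : ℝ, 0 < r →
      ∑ h ∈ terms p n, min (r * h) (r * h)⁻¹ ≤ K * Real.log n ^ k := by
  obtain ⟨C', hC', hcard⟩ := card_expSet_le_of_one_le_log
    (p := Fin.tail p) fun j => hp _
  refine ⟨4 * C', by linarith, ?_⟩
  filter_upwards [tendsto_log_natCast.eventually_ge_atTop 1, eventually_ge_atTop 1]
    with n hL hn1 r hr
  refine (sum_terms_min_le hp hcop n hr).trans ?_
  have := hcard n (by positivity) hL
  linarith

theorem eventually_card_terms_le (hp : ∀ j, 1 < p j)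
    (hcop : ∀ i j, i ≠ j → Nat.Coprime (p i) (p j)) :
    ∃ K ≥ 1, ∀ᶠ n : ℕ in atTop, ((terms p n).card : ℝ) ≤ K * Real.log n ^ (k + 1) := by
  obtain ⟨C', hC', hcard⟩ := card_expSet_le_of_one_le_log hp
  refine ⟨C', hC', ?_⟩
  filter_upwards [tendsto_log_natCast.eventually_ge_atTop 1, eventually_ge_atTop 1] with n hL hn1
  rw [card_terms hp hcop]
  exact hcard n (by positivity) hL

/-- Near the origin the terms of size about `1 / r` give Gaussian decay. -/
theorem eventually_sum_cosGap_ge (hp : ∀ j, 1 < p j)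
    (hcop : ∀ i j, i ≠ j → Nat.Coprime (p i) (p j)) {d : ℕ} {C : ℝ} (hC : 1 ≤ C) :
    ∃ c > 0, ∀ᶠ n : ℕ in atTop, ∀ r, IsTilt p d C n r → ∀ θ : ℝ, |θ| ≤ r / 2 →
      c * Real.log n ^ k * (θ / r) ^ 2 ≤ ∑ h ∈ terms p r⁻¹, cosGap (h * θ) := by
  have hpt : ∀ j, 1 < Fin.tail p j := fun j => hp _
  have hc := countConst_pos hpt
  have hp0 : (1 : ℝ) < p 0 := by exact_mod_cast hp 0
  obtain ⟨K, -, hK⟩ := eventually_isTilt_log (p := p) (d := d) hC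
  refine ⟨countConst (Fin.tail p) * (1 / 2) ^ k * (8 / p 0 ^ 2), by positivity, ?_⟩
  filter_upwards [hK, eventually_isTilt_of_eventually (p := p) (d := d) (C := C)
    (eventually_ge_atTop (1 : ℝ)), tendsto_log_natCast.eventually_ge_atTop 1]
    with n hn hn1 hL r hr θ hθ
  have hr0 := hr.pos
  have hM := hn1 r hr
  have hM0 : 0 < r⁻¹ := by positivity
  obtain ⟨-, h2, -⟩ := hn r hr
  calc _ = (countConst (Fin.tail p) * (Real.log n / 2) ^ k) * (8 * (θ / (p 0 * r)) ^ 2) := by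
        rw [show θ / (p 0 * r) = θ / r / p 0 by field_simp, div_pow (θ / r),
          show Real.log n / 2 = 1 / 2 * Real.log n by ring, mul_pow]
        ring
    _ ≤ (expSet (Fin.tail p) r⁻¹).card * (8 * (θ / (p 0 * r)) ^ 2) := by
        gcongr
        refine le_trans ?_ (card_expSet_bounds hpt hM).1
        gcongr
    _ = ∑ h ∈ terms p r⁻¹ \ terms p (r⁻¹ / p 0), 8 * (θ / (p 0 * r)) ^ 2 := by
        rw [Finset.sum_const, card_terms_sdiff hp hcop hM0.le, nsmul_eq_mul]
    _ ≤ ∑ h ∈ terms p r⁻¹ \ terms p (r⁻¹ / p 0), cosGap (h * θ) := by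
        refine Finset.sum_le_sum fun h hh => ?_
        rw [Finset.mem_sdiff, mem_terms hp, mem_terms hp] at hh
        obtain ⟨⟨hb, hle⟩, hnot⟩ := hh
        have hgt : r⁻¹ / p 0 ≤ h := by
          by_contra hlt
          exact hnot ⟨hb, (not_le.1 hlt).le⟩
        refine le_trans ?_ (cosGap_ge_sq ?_)
        · rw [← sq_abs (θ / _), ← sq_abs (h * θ), abs_div, abs_mul (h : ℝ),
            abs_of_pos (by positivity : 0 < p 0 * r), abs_of_nonneg (by positivity : (0 : ℝ) ≤ h)]
          gcongr
          calc |θ| / (p 0 * r) = r⁻¹ / p 0 * |θ| := by field_simp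
            _ ≤ _ := by gcongr
        · rw [abs_mul, abs_of_nonneg (by positivity : (0 : ℝ) ≤ h)]
          calc (h : ℝ) * |θ| ≤ r⁻¹ * (r / 2) := by gcongr
            _ = 1 / 2 := by field_simp
    _ ≤ _ := Finset.sum_le_sum_of_subset_of_nonneg Finset.sdiff_subset
        fun _ _ _ => cosGap_nonneg _

theorem eventually_log_pow_mul_exp_le {c : ℝ} (hc : 0 < c) (N : ℕ) (ε : ℝ) (hε : 0 < ε) :
    ∀ᶠ n : ℕ in atTop, Real.log n ^ N * Real.exp (-(c * Real.log n)) ≤ ε := by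
  have h1 : Tendsto (fun x : ℝ => x ^ N * Real.exp (-(c * x))) atTop (𝓝 0) := by
    have h2 := (Real.tendsto_pow_mul_exp_neg_atTop_nhds_zero N).comp
      (tendsto_id.const_mul_atTop hc)
    have h3 := h2.const_mul ((c ^ N)⁻¹)
    rw [mul_zero] at h3
    refine h3.congr fun x => ?_
    simp only [Function.comp, id, mul_pow]
    field_simp
  exact (h1.comp tendsto_log_natCast).eventually_le_const hε

/-- Pointwise bound for the decay function: Gaussian on the major arc, plus a contribution of
negligible mass from the minor arcs. -/
theorem exists_decay_le (hk : 1 ≤ k) (hp : ∀ j, 1 < p j)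
    (hcop : ∀ i j, i ≠ j → Nat.Coprime (p i) (p j)) {d : ℕ} {C : ℝ} (hC : 1 ≤ C)
    {c : ℝ} (hc : 0 < c) :
    ∃ c1 > 0, ∀ N : ℕ, ∀ᶠ n : ℕ in atTop, ∀ r, IsTilt p d C n r → ∃ Ψ : ℝ → ℝ, Continuous Ψ ∧
      (∀ θ, 0 ≤ Ψ θ) ∧ (Real.log n ^ N * ∫ θ in (-1 / 2 : ℝ)..1 / 2, Ψ θ) ≤ r ∧
      ∀ θ : ℝ, |θ| ≤ 1 / 2 → decay c (terms p r⁻¹) θ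
        ≤ Real.exp (-(c1 * (Real.log n ^ k * (θ / r) ^ 2))) + Ψ θ := by
  obtain ⟨c2, hc2, hmajor⟩ := eventually_sum_cosGap_ge hp hcop (d := d) hC
  have h01 : (0 : Fin (k + 1)) ≠ ⟨1, by omega⟩ := by
    intro h; simpa using congrArg Fin.val h
  obtain ⟨c3, hc3, hminor⟩ := exists_decay_exponent_ge (hp 0) (hp ⟨1, by omega⟩) (hcop _ _ h01)
  obtain ⟨N0, hint⟩ := exists_integral_decay_le (hp 0) (hp ⟨1, by omega⟩) (hcop _ _ h01)
    (half_pos hc)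
  obtain ⟨K, -, hlog⟩ := eventually_isTilt_log (p := p) (d := d) hC
  refine ⟨c * c2, by positivity, fun N => ?_⟩
  filter_upwards [hmajor, eventually_isTilt_of_eventually (p := p) (d := d) (C := C) hminor,
    eventually_isTilt_of_eventually (p := p) (d := d) (C := C) hint,
    eventually_isTilt_of_eventually (p := p) (d := d) (C := C) (eventually_ge_atTop (1 : ℝ)), hlog,
    tendsto_log_natCast.eventually_ge_atTop 1,
    eventually_log_pow_mul_exp_le (c := c * c3 / 4) (by positivity) (N + N0) 1 one_pos]
    with n h1 h2 h3 h4 h5 hL h6 r hr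
  have hr0 := hr.pos
  have hM := h4 r hr
  obtain ⟨h7, h8, -⟩ := h5 r hr
  have hTmem : ∀ a b : ℕ, (p 0 : ℝ) ^ a * (p ⟨1, by omega⟩ : ℝ) ^ b ≤ r⁻¹ →
      p 0 ^ a * p ⟨1, by omega⟩ ^ b ∈ terms p r⁻¹ := by
    intro a b hab
    exact (mem_terms hp).2 ⟨pow_mul_pow_mem_baseSet a b, by push_cast; exact hab⟩
  have hcd := continuous_decay (c / 2) (terms p r⁻¹)
  -- Half of the exponent c is spent on the pointwise minor arc bound, with log (1/r) ≥ (log n) / 2.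
  -- The other half keeps the total mass at r times a power of log n, and the saving n^(-c c3 / 4)
  -- beats every such power.
  refine ⟨fun θ => Real.exp (-(c * c3 / 4 * Real.log n)) * decay (c / 2) (terms p r⁻¹) θ,
    by fun_prop, fun θ => mul_nonneg (Real.exp_pos _).le (decay_pos _ _ _).le, ?_, ?_⟩
  · rw [intervalIntegral.integral_const_mul]
    have h9 := h3 r hr _ hTmem
    rw [inv_inv] at h9
    calc _ ≤ Real.log n ^ N * (Real.exp (-(c * c3 / 4 * Real.log n)) * (r * Real.log n ^ N0)) := by
          gcongr
          refine h9.trans ?_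
          gcongr
          exact Real.log_nonneg hM
      _ = r * (Real.log n ^ (N + N0) * Real.exp (-(c * c3 / 4 * Real.log n))) := by ring
      _ ≤ r * 1 := by gcongr
      _ = r := mul_one r
  · intro θ hθ
    by_cases hθr : |θ| ≤ r / 2
    · have h9 := h1 r hr θ hθr
      refine le_add_of_le_of_nonneg ?_ (mul_nonneg (Real.exp_pos _).le (decay_pos _ _ _).le)
      unfold decay
      rw [Real.exp_le_exp]
      nlinarith [mul_le_mul_of_nonneg_left h9 hc.le]
    · have h9 := h2 r hr _ hTmem θ (by
        rw [show 1 / (2 * r⁻¹) = r / 2 by field_simp]; exact (not_le.1 hθr).le) hθ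
      refine le_add_of_nonneg_of_le (Real.exp_pos _).le ?_
      change Real.exp _ ≤ Real.exp _ * Real.exp _
      rw [← Real.exp_add, Real.exp_le_exp]
      have h10 : c3 * (Real.log n / 2) ≤ ∑ h ∈ terms p r⁻¹, cosGap (h * θ) :=
        le_trans (by gcongr) h9
      nlinarith [mul_le_mul_of_nonneg_left h10 hc.le]

end MultiBase

/-! ### Dependence between digits and phases -/

namespace MultiBase

/-- Telescoping exchanges one factor at a time. The majorant ∏ β is kept so that Fourier decay
survives, and dividing by b0 restores the bound of the exchanged factor. -/
theorem norm_prod_sub_prod_le {ι : Type*} (s : Finset ι) {a b : ι → ℂ} {β : ι → ℝ} {b0 : ℝ}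
    (hb0 : 0 < b0) (ha : ∀ i ∈ s, ‖a i‖ ≤ β i) (hb : ∀ i ∈ s, ‖b i‖ ≤ β i)
    (hβ : ∀ i ∈ s, b0 ≤ β i) :
    ‖∏ i ∈ s, a i - ∏ i ∈ s, b i‖ ≤ (∏ i ∈ s, β i) * ∑ i ∈ s, ‖a i - b i‖ / b0 := by
  classical
  induction s using Finset.induction_on with
  | empty => simp
  | insert i s hi ih =>
    simp only [Finset.mem_insert, forall_eq_or_imp] at ha hb hβ
    have ih' := ih ha.2 hb.2 hβ.2
    rw [Finset.prod_insert hi, Finset.prod_insert hi, Finset.prod_insert hi, Finset.sum_insert hi]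
    have hpos : 0 ≤ ∏ i ∈ s, β i := Finset.prod_nonneg fun j hj => hb0.le.trans (hβ.2 j hj)
    have hA : ‖∏ i ∈ s, a i‖ ≤ ∏ i ∈ s, β i := by
      rw [norm_prod]
      exact Finset.prod_le_prod (fun _ _ => norm_nonneg _) ha.2
    have hβi : 0 ≤ β i := hb0.le.trans hβ.1
    have e : a i * ∏ i ∈ s, a i - b i * ∏ i ∈ s, b i
        = (a i - b i) * ∏ i ∈ s, a i + b i * (∏ i ∈ s, a i - ∏ i ∈ s, b i) := by ring
    have h1 : ‖a i - b i‖ ≤ β i * (‖a i - b i‖ / b0) := by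
      rw [mul_div_assoc', le_div_iff₀ hb0, mul_comm]
      gcongr
      exact hβ.1
    rw [e]
    calc _ ≤ ‖a i - b i‖ * ∏ i ∈ s, β i
          + β i * ((∏ i ∈ s, β i) * ∑ i ∈ s, ‖a i - b i‖ / b0) := by
          refine (norm_add_le _ _).trans ?_
          rw [norm_mul, norm_mul]
          gcongr
          exact hb.1
      _ ≤ β i * (‖a i - b i‖ / b0) * ∏ i ∈ s, β i
          + β i * ((∏ i ∈ s, β i) * ∑ i ∈ s, ‖a i - b i‖ / b0) := by gcongr
      _ = _ := by ring

variable {m : ℕ} {p : Fin m → ℕ}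

/-- The bound for the dependence between the digit at `h` and its phase at frequency `θ`. -/
noncomputable def shift (d : ℕ) (r θ : ℝ) (h : ℕ) : ℝ :=
  min 2 (2 * Real.pi * d ^ 2 * |h * θ| * Real.exp (-(r * h)))

theorem shift_nonneg (d : ℕ) (r θ : ℝ) (h : ℕ) : 0 ≤ shift d r θ h :=
  le_min (by norm_num) (by have := Real.pi_pos; positivity)

theorem continuous_shift (d : ℕ) (r : ℝ) (h : ℕ) : Continuous fun θ => shift d r θ h := by
  unfold shift; fun_prop

/-- The sum of all dependence bounds. -/
noncomputable def shiftSum (p : Fin m → ℕ) (d n : ℕ) (r θ : ℝ) : ℝ :=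
  ∑ h ∈ terms p n, shift d r θ h

theorem shiftSum_nonneg (p : Fin m → ℕ) (d n : ℕ) (r θ : ℝ) : 0 ≤ shiftSum p d n r θ :=
  Finset.sum_nonneg fun _ _ => shift_nonneg _ _ _ _

theorem continuous_shiftSum (p : Fin m → ℕ) (d n : ℕ) (r : ℝ) :
    Continuous fun θ => shiftSum p d n r θ := by
  unfold shiftSum
  have := continuous_shift d r
  fun_prop

/-- The decay of a single digit; digits at positions outside `S` are bounded trivially. -/
noncomputable def factorBound (c : ℝ) (S : Finset ℕ) (θ : ℝ) (h : ℕ) : ℝ :=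
  if h ∈ S then Real.exp (-c * cosGap (h * θ)) else 1

theorem prod_factorBound (c : ℝ) {S T : Finset ℕ} (hST : S ⊆ T) (θ : ℝ) :
    ∏ h ∈ T, factorBound c S θ h = decay c S θ := by
  unfold factorBound decay
  rw [Finset.prod_ite_mem, Finset.inter_eq_right.2 hST, Finset.mul_sum, Real.exp_sum]

/-- A single factor of the decay is bounded below, so one lost in an estimate can be reinserted at
the cost of the constant e^(2c). -/
theorem factorBound_ge {c : ℝ} (hc : 0 ≤ c) (S : Finset ℕ) (θ : ℝ) (h : ℕ) :
    Real.exp (-(2 * c)) ≤ factorBound c S θ h := by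
  unfold factorBound
  split_ifs
  · rw [Real.exp_le_exp]
    nlinarith [cosGap_le_two (h * θ)]
  · rw [Real.exp_le_one_iff]; linarith

variable {d n : ℕ} {r : ℝ}

theorem digitRate_pos (hd : 2 ≤ d) : 0 < digitRate d := by unfold digitRate; positivity

theorem norm_digitExp_ech_le_factorBound (hp : ∀ j, 1 < p j) (hd : 2 ≤ d) (hr : 0 < r) (θ : ℝ)
    (h : ℕ) :
    ‖digitExp d (r * h) fun j => ech (j * (h * θ))‖
      ≤ factorBound (digitRate d) (terms p r⁻¹) θ h := by
  unfold factorBound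
  split_ifs with hh
  · have h1 := ((mem_terms hp).1 hh).2
    refine norm_digitExp_ech_le hd (by positivity) ?_ _
    calc r * h ≤ r * r⁻¹ := by gcongr
      _ = 1 := mul_inv_cancel₀ hr.ne'
  · exact norm_digitExp_le hd fun j _ => (norm_ech _).le

theorem terms_inv_subset (hp : ∀ j, 1 < p j) (hr : 0 < r) (hrn : 1 ≤ r * n) :
    terms p r⁻¹ ⊆ terms p n :=
  terms_mono hp (by rw [inv_le_iff_one_le_mul₀ hr, mul_comm]; exact hrn)

theorem continuous_digitExp_ech (d : ℕ) (x y : ℝ) (u : ℕ → ℂ) :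
    Continuous fun θ => digitExp d x fun j => u j * ech (j * (y * θ)) := by
  unfold digitExp
  have := continuous_ech
  fun_prop

theorem norm_prod_le_prod_mul {ι : Type*} (s : Finset ι) {A : ι → ℂ} {β w : ι → ℝ}
    (h : ∀ i ∈ s, ‖A i‖ ≤ β i * w i) :
    ‖∏ i ∈ s, A i‖ ≤ (∏ i ∈ s, β i) * ∏ i ∈ s, w i := by
  rw [norm_prod, ← Finset.prod_mul_distrib]
  exact Finset.prod_le_prod (fun _ _ => norm_nonneg _) h

theorem norm_tiltInt_le {u : ℕ → ℕ → ℂ} {g : ℝ → ℝ} (hg : Continuous g)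
    (h : ∀ θ, ‖∏ h ∈ terms p n, digitExp d (r * h) fun j => u h j * ech (j * (h * θ))‖ ≤ g θ) :
    ‖tiltInt p d n r u‖ ≤ ∫ θ in (-1 / 2 : ℝ)..1 / 2, g θ := by
  unfold tiltInt
  refine intervalIntegral.norm_integral_le_of_norm_le (by norm_num)
    (Filter.Eventually.of_forall fun θ _ => ?_) (hg.intervalIntegrable _ _)
  rw [norm_mul, norm_ech, mul_one]
  exact h θ

theorem norm_digitExp_mul_ech_le (hd : 2 ≤ d) (hr : 0 < r) {f : ℕ → ℂ} {M : ℝ}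
    {h : ℕ} (hM : ∀ j < d, ‖f j‖ ≤ M) (h0 : digitExp d (r * h) f = 0) (θ : ℝ) :
    ‖digitExp d (r * h) fun j => f j * ech (j * (h * θ))‖
      ≤ factorBound (digitRate d) (terms p r⁻¹) θ h
        * (2 * M * Real.exp (2 * digitRate d) * shift d r θ h) := by
  have h1 := digitExp_cov_le (x := r * h) hd (by positivity) (U := f) (u := 0) (M := M)
    (by simpa using hM) (h * θ)
  rw [h0, zero_mul, sub_zero] at h1
  refine h1.trans ?_
  have h2 := factorBound_ge (digitRate_pos hd).le (terms p r⁻¹) θ h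
  have hM0 : 0 ≤ M := (norm_nonneg _).trans (hM 0 (by omega))
  have h3 := shift_nonneg d r θ h
  calc 2 * M * shift d r θ h
      = Real.exp (-(2 * digitRate d)) * (2 * M * Real.exp (2 * digitRate d) * shift d r θ h) := by
        rw [Real.exp_neg]; field_simp
    _ ≤ _ := by gcongr

/-- A centred function of one digit has mean 0 under the independent law. Its conditional mean comes
only from the covariance with the phase, which is one factor `shift`. -/
theorem norm_avg_single_le (hp : ∀ j, 1 < p j) (hd : 2 ≤ d) (hr : 0 < r) (hrn : 1 ≤ r * n)
    {f : ℕ → ℂ} {M : ℝ} {h : ℕ} (hh : h ∈ terms p n) (hM : ∀ j < d, ‖f j‖ ≤ M)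
    (h0 : digitExp d (r * h) f = 0) :
    ‖avg p d n fun a => f (a h)‖ * ‖tiltProb p d n r‖
      ≤ ∫ θ in (-1 / 2 : ℝ)..1 / 2, decay (digitRate d) (terms p r⁻¹) θ
        * (2 * M * Real.exp (2 * digitRate d) * shift d r θ h) := by
  classical
  have e : (fun a : ℕ →₀ ℕ => f (a h))
      = fun a => ∏ i ∈ terms p n, (fun i j => if i = h then f j else 1) i (a i) := by
    funext a
    simp only
    rw [Finset.prod_ite_eq' _ _ (fun i => f (a i)), if_pos hh]
  rw [e, ← norm_mul, avg_prod_mul_tiltProb hp hd n r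
    (fun i j => if i = h then f j else 1)]
  have hcs := continuous_shift d r h
  have hcd := continuous_decay (digitRate d) (terms p r⁻¹)
  refine norm_tiltInt_le (by fun_prop) fun θ => ?_
  rw [← prod_factorBound _ (terms_inv_subset hp hr hrn)]
  have hw : 2 * M * Real.exp (2 * digitRate d) * shift d r θ h = ∏ i ∈ terms p n,
      if i = h then 2 * M * Real.exp (2 * digitRate d) * shift d r θ i else 1 := by
    rw [Finset.prod_ite_eq', if_pos hh]
  rw [hw]
  refine norm_prod_le_prod_mul _ fun i _ => ?_
  by_cases hi : i = h
  · subst hi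
    simp only [if_true]
    exact norm_digitExp_mul_ech_le (p := p) hd hr hM h0 θ
  · simp only [hi, if_false, one_mul, mul_one]
    exact norm_digitExp_ech_le_factorBound hp hd hr θ i

/-- Each of the two centred factors produces its own covariance factor, so a correlation of distinct
digits gains two factors `shift`. -/
theorem norm_avg_pair_le (hp : ∀ j, 1 < p j) (hd : 2 ≤ d) (hr : 0 < r) (hrn : 1 ≤ r * n)
    {f : ℕ → ℕ → ℂ} {M : ℝ} {h h' : ℕ} (hh : h ∈ terms p n) (hh' : h' ∈ terms p n) (hne : h ≠ h')
    (hM : ∀ i, ∀ j < d, ‖f i j‖ ≤ M) (h0 : ∀ i : ℕ, digitExp d (r * i) (f i) = 0) :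
    ‖avg p d n fun a => f h (a h) * f h' (a h')‖ * ‖tiltProb p d n r‖
      ≤ ∫ θ in (-1 / 2 : ℝ)..1 / 2, decay (digitRate d) (terms p r⁻¹) θ
        * ((2 * M * Real.exp (2 * digitRate d)) ^ 2 * (shift d r θ h * shift d r θ h')) := by
  classical
  have e : (fun a : ℕ →₀ ℕ => f h (a h) * f h' (a h'))
      = fun a => ∏ i ∈ terms p n,
        (fun i j => (if i = h then f i j else 1) * (if i = h' then f i j else 1)) i (a i) := by
    funext a
    simp only
    rw [Finset.prod_mul_distrib, Finset.prod_ite_eq' _ _ (fun i => f i (a i)), if_pos hh,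
      Finset.prod_ite_eq' _ _ (fun i => f i (a i)), if_pos hh']
  rw [e, ← norm_mul, avg_prod_mul_tiltProb hp hd n r
    (fun i j => (if i = h then f i j else 1) * (if i = h' then f i j else 1))]
  have hcs := continuous_shift d r h
  have hcs' := continuous_shift d r h'
  have hcd := continuous_decay (digitRate d) (terms p r⁻¹)
  refine norm_tiltInt_le (by fun_prop) fun θ => ?_
  rw [← prod_factorBound _ (terms_inv_subset hp hr hrn)]
  have hw : (2 * M * Real.exp (2 * digitRate d)) ^ 2 * (shift d r θ h * shift d r θ h')
      = ∏ i ∈ terms p n,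
      (if i = h then 2 * M * Real.exp (2 * digitRate d) * shift d r θ i else 1)
      * (if i = h' then 2 * M * Real.exp (2 * digitRate d) * shift d r θ i else 1) := by
    rw [Finset.prod_mul_distrib, Finset.prod_ite_eq', if_pos hh, Finset.prod_ite_eq', if_pos hh']
    ring
  rw [hw]
  refine norm_prod_le_prod_mul _ fun i _ => ?_
  by_cases hi : i = h
  · have hi' : i ≠ h' := fun hc => hne (hi.symm.trans hc)
    simp only [hi, hne, if_true, if_false, mul_one]
    exact norm_digitExp_mul_ech_le (p := p) hd hr (hM h) (h0 h) θ
  · by_cases hi' : i = h'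
    · simp only [hi', hne.symm, if_true, if_false, one_mul]
      exact norm_digitExp_mul_ech_le (p := p) hd hr (hM h') (h0 h') θ
    · simp only [hi, hi', if_false, one_mul, mul_one]
      exact norm_digitExp_ech_le_factorBound hp hd hr θ i

end MultiBase

/-! ### Moments of the dependence bound and the local lower bound -/

namespace MultiBase

theorem exists_pow_mul_exp_neg_sq_le (j : ℕ) {c : ℝ} (hc : 0 < c) :
    ∃ K ≥ 1, ∀ x : ℝ, |x| ^ j * Real.exp (-(c * x ^ 2)) ≤ K * Real.exp (-(c / 2 * x ^ 2)) := by
  refine ⟨1 + j.factorial * (2 / c) ^ j, le_add_of_nonneg_right (by positivity), fun x => ?_⟩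
  have h1 := Real.pow_div_factorial_le_exp (c / 2 * x ^ 2) (by positivity) j
  have h2 : 1 ≤ Real.exp (c / 2 * x ^ 2) := Real.one_le_exp (by positivity)
  have h3 : |x| ^ j ≤ 1 + (x ^ 2) ^ j := by
    rw [← sq_abs, ← pow_mul, mul_comm, pow_mul]
    nlinarith [sq_nonneg (|x| ^ j - 1), sq_nonneg (|x| ^ j)]
  have h4 : (x ^ 2) ^ j ≤ j.factorial * (2 / c) ^ j * Real.exp (c / 2 * x ^ 2) := by
    rw [div_le_iff₀ (by positivity), mul_pow] at h1
    calc (x ^ 2) ^ j = (2 / c) ^ j * ((c / 2) ^ j * (x ^ 2) ^ j) := by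
          rw [← mul_assoc, ← mul_pow]; field_simp; simp
      _ ≤ (2 / c) ^ j * (Real.exp (c / 2 * x ^ 2) * j.factorial) := by gcongr
      _ = _ := by ring
  have e : Real.exp (-(c * x ^ 2)) = Real.exp (-(c / 2 * x ^ 2)) * Real.exp (-(c / 2 * x ^ 2)) := by
    rw [← Real.exp_add]; congr 1; ring
  have e2 : Real.exp (c / 2 * x ^ 2) * Real.exp (-(c / 2 * x ^ 2)) = 1 := by
    rw [← Real.exp_add]; simp
  rw [e, ← mul_assoc]
  gcongr
  calc |x| ^ j * Real.exp (-(c / 2 * x ^ 2))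
      ≤ ((1 + j.factorial * (2 / c) ^ j) * Real.exp (c / 2 * x ^ 2))
        * Real.exp (-(c / 2 * x ^ 2)) := by
        gcongr; linarith
    _ = _ := by rw [mul_assoc, e2, mul_one]

theorem integral_exp_neg_mul_sq_le {b : ℝ} (hb : 0 < b) :
    ∫ θ in (-1 / 2 : ℝ)..1 / 2, Real.exp (-(b * θ ^ 2)) ≤ Real.sqrt (Real.pi / b) := by
  rw [← integral_gaussian b, intervalIntegral.integral_of_le (by norm_num)]
  have hint := integrable_exp_neg_mul_sq hb
  simp only [neg_mul] at hint ⊢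
  exact MeasureTheory.setIntegral_le_integral hint
    (Filter.Eventually.of_forall fun _ => (Real.exp_pos _).le)

variable {k : ℕ} {p : Fin (k + 1) → ℕ} {d : ℕ} {C : ℝ}

/-- The first bound is of use on the Gaussian scale |θ| ≈ r / √(L^k); the second, a mere term count,
suffices against the minor arc majorant, which saves every power of log n. -/
theorem eventually_shiftSum_le (hp : ∀ j, 1 < p j)
    (hcop : ∀ i j, i ≠ j → Nat.Coprime (p i) (p j)) :
    ∃ K ≥ 1, ∀ᶠ n : ℕ in atTop, ∀ r, IsTilt p d C n r → ∀ θ,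
      shiftSum p d n r θ ≤ K * (Real.log n ^ k * (|θ| / r)) ∧
      shiftSum p d n r θ ≤ K * Real.log n ^ (k + 1) := by
  obtain ⟨K1, hK1, h1⟩ := eventually_sum_min_le hp hcop
  obtain ⟨K2, hK2, h2⟩ := eventually_card_terms_le hp hcop
  have hpi := Real.pi_pos
  have hnn : 0 ≤ 4 * Real.pi * d ^ 2 * K1 := by positivity
  refine ⟨4 * Real.pi * d ^ 2 * K1 + 2 * K2, by linarith, ?_⟩
  filter_upwards [h1, h2, tendsto_log_natCast.eventually_ge_atTop 1] with n h1 h2 hL r hr θ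
  have hr0 := hr.pos
  constructor
  · calc shiftSum p d n r θ
        ≤ ∑ h ∈ terms p n, 4 * Real.pi * d ^ 2 * (|θ| / r) * min (r * h) (r * h)⁻¹ := by
          refine Finset.sum_le_sum fun h hh => (min_le_right _ _).trans ?_
          have hh0 : (0 : ℝ) < h := by exact_mod_cast pos_of_mem_terms hp hh
          have h3 := pow_mul_exp_neg_le 0 (x := r * h) (by positivity)
          have h5 : ((0 + 2).factorial : ℝ) = 2 := by norm_num [Nat.factorial]
          rw [zero_add, pow_one, ← zero_add 2, h5] at h3
          rw [abs_mul, abs_of_pos hh0]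
          calc 2 * Real.pi * d ^ 2 * (h * |θ|) * Real.exp (-(r * h))
              = 2 * Real.pi * d ^ 2 * (|θ| / r) * (r * h * Real.exp (-(r * h))) := by field_simp
            _ ≤ 2 * Real.pi * d ^ 2 * (|θ| / r) * (2 * min (r * h) (r * h)⁻¹) :=
                mul_le_mul_of_nonneg_left h3 (by positivity)
            _ = _ := by ring
      _ = 4 * Real.pi * d ^ 2 * (|θ| / r) * ∑ h ∈ terms p n, min (r * h) (r * h)⁻¹ := by
          rw [Finset.mul_sum]
      _ ≤ 4 * Real.pi * d ^ 2 * (|θ| / r) * (K1 * Real.log n ^ k) := by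
          gcongr; exact h1 r hr0
      _ = 4 * Real.pi * d ^ 2 * K1 * (Real.log n ^ k * (|θ| / r)) := by ring
      _ ≤ _ := by gcongr; linarith
  · calc shiftSum p d n r θ ≤ ∑ h ∈ terms p n, (2 : ℝ) :=
          Finset.sum_le_sum fun h _ => min_le_left _ _
      _ = 2 * (terms p n).card := by simp [mul_comm]
      _ ≤ 2 * (K2 * Real.log n ^ (k + 1)) := by gcongr
      _ = 2 * K2 * Real.log n ^ (k + 1) := by ring
      _ ≤ _ := by gcongr; linarith

/-- Moments of the dependence bound against the decay function. -/
theorem exists_integral_decay_mul_shiftSum_le (hk : 1 ≤ k) (hp : ∀ j, 1 < p j)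
    (hcop : ∀ i j, i ≠ j → Nat.Coprime (p i) (p j)) (hC : 1 ≤ C) {c : ℝ} (hc : 0 < c) (j : ℕ) :
    ∃ K ≥ 1, ∀ᶠ n : ℕ in atTop, ∀ r, IsTilt p d C n r →
      ∫ θ in (-1 / 2 : ℝ)..1 / 2, decay c (terms p r⁻¹) θ * shiftSum p d n r θ ^ (j + 1)
        ≤ K * (r * Real.sqrt (Real.log n ^ k) ^ j) := by
  obtain ⟨K1, hK1, hshift⟩ := eventually_shiftSum_le (d := d) (C := C) hp hcop
  obtain ⟨c1, hc1, hdecay⟩ := exists_decay_le hk hp hcop (d := d) hC hc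
  obtain ⟨K2, hK2, hgauss⟩ := exists_pow_mul_exp_neg_sq_le (j + 1) hc1
  set D := K2 * Real.sqrt (Real.pi / (c1 / 2)) with hD
  have hD0 : 0 ≤ D := by positivity
  refine ⟨K1 ^ (j + 1) * (D + 1), by
    nlinarith [one_le_pow₀ hK1 (n := j + 1)], ?_⟩
  filter_upwards [hshift, hdecay ((k + 1) * (j + 1)),
    tendsto_log_natCast.eventually_ge_atTop 1] with n h1 h2 hL r hr
  have hr0 := hr.pos
  obtain ⟨Ψ, hΨc, hΨ0, hΨint, hΨ⟩ := h2 r hr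
  set L := Real.log n with hLdef
  set s := Real.sqrt (L ^ k) with hs
  have hs2 : s ^ 2 = L ^ k := Real.sq_sqrt (by positivity)
  have hs1 : 1 ≤ s := Real.one_le_sqrt.2 (one_le_pow₀ hL)
  have hs0 : 0 < s := by linarith
  have hcd := continuous_decay c (terms p r⁻¹)
  have hcs := continuous_shiftSum p d n r
  -- In the variable y = s θ / r, with s² = L^k, the decay is e^(-c1 y²) and the dependence is O(s
  -- |y|). Since dθ = (r / s) dy, the integral has order r s^j.
  have hpt : ∀ θ ∈ Set.Icc (-1 / 2 : ℝ) (1 / 2),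
      decay c (terms p r⁻¹) θ * shiftSum p d n r θ ^ (j + 1)
        ≤ K1 ^ (j + 1) * s ^ (j + 1) * K2 * Real.exp (-(c1 / 2 * (s / r) ^ 2 * θ ^ 2))
          + K1 ^ (j + 1) * L ^ ((k + 1) * (j + 1)) * Ψ θ := by
    intro θ hθ
    obtain ⟨h3, h4⟩ := h1 r hr θ
    have hW := shiftSum_nonneg p d n r θ
    have h5 := hΨ θ (abs_le.2 ⟨by linarith [hθ.1], hθ.2⟩)
    have h6 := hgauss (s * (θ / r))
    have e1 : L ^ k * (θ / r) ^ 2 = (s * (θ / r)) ^ 2 := by rw [mul_pow, hs2]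
    have e2 : L ^ k * (|θ| / r) = s * |s * (θ / r)| := by
      rw [abs_mul, abs_div, abs_of_pos hs0, abs_of_pos hr0, ← hs2]; ring
    rw [e1] at h5
    rw [e2] at h3
    have h3' := pow_le_pow_left₀ hW h3 (j + 1)
    have h4' := pow_le_pow_left₀ hW h4 (j + 1)
    obtain ⟨y, hy⟩ : ∃ y, y = s * (θ / r) := ⟨_, rfl⟩
    rw [← hy] at h3 h3' h5 h6
    calc _ ≤ (Real.exp (-(c1 * y ^ 2)) + Ψ θ) * shiftSum p d n r θ ^ (j + 1) := by gcongr
      _ = shiftSum p d n r θ ^ (j + 1) * Real.exp (-(c1 * y ^ 2))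
          + shiftSum p d n r θ ^ (j + 1) * Ψ θ := by ring
      _ ≤ (K1 * (s * |y|)) ^ (j + 1) * Real.exp (-(c1 * y ^ 2))
          + (K1 * L ^ (k + 1)) ^ (j + 1) * Ψ θ := by
          have := hΨ0 θ
          gcongr
      _ = K1 ^ (j + 1) * s ^ (j + 1) * (|y| ^ (j + 1) * Real.exp (-(c1 * y ^ 2)))
          + K1 ^ (j + 1) * L ^ ((k + 1) * (j + 1)) * Ψ θ := by
          rw [mul_pow, mul_pow, mul_pow, ← pow_mul]; ring
      _ ≤ K1 ^ (j + 1) * s ^ (j + 1) * (K2 * Real.exp (-(c1 / 2 * y ^ 2)))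
          + K1 ^ (j + 1) * L ^ ((k + 1) * (j + 1)) * Ψ θ := by gcongr
      _ = _ := by
          have : c1 / 2 * (s / r) ^ 2 * θ ^ 2 = c1 / 2 * y ^ 2 := by
            rw [hy]; ring
          rw [this]; ring
  have hb : 0 < c1 / 2 * (s / r) ^ 2 := by positivity
  have hsqrt : Real.sqrt (Real.pi / (c1 / 2 * (s / r) ^ 2))
      = Real.sqrt (Real.pi / (c1 / 2)) * (r / s) := by
    rw [← div_div, Real.sqrt_div (by positivity), Real.sqrt_sq (by positivity)]
    field_simp
  calc _ ≤ ∫ θ in (-1 / 2 : ℝ)..1 / 2,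
        (K1 ^ (j + 1) * s ^ (j + 1) * K2 * Real.exp (-(c1 / 2 * (s / r) ^ 2 * θ ^ 2))
          + K1 ^ (j + 1) * L ^ ((k + 1) * (j + 1)) * Ψ θ) :=
        intervalIntegral.integral_mono_on (by norm_num)
          (Continuous.intervalIntegrable (by fun_prop) _ _)
          (Continuous.intervalIntegrable (by fun_prop) _ _) hpt
    _ = K1 ^ (j + 1) * s ^ (j + 1) * K2
          * (∫ θ in (-1 / 2 : ℝ)..1 / 2, Real.exp (-(c1 / 2 * (s / r) ^ 2 * θ ^ 2)))
        + K1 ^ (j + 1) * (L ^ ((k + 1) * (j + 1)) * ∫ θ in (-1 / 2 : ℝ)..1 / 2, Ψ θ) := by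
        rw [intervalIntegral.integral_add (Continuous.intervalIntegrable (by fun_prop) _ _)
          (Continuous.intervalIntegrable (by fun_prop) _ _),
          intervalIntegral.integral_const_mul, intervalIntegral.integral_const_mul, mul_assoc
          (K1 ^ (j + 1)) (L ^ _)]
    _ ≤ K1 ^ (j + 1) * s ^ (j + 1) * K2 * (Real.sqrt (Real.pi / (c1 / 2)) * (r / s))
        + K1 ^ (j + 1) * (r * s ^ j) := by
        refine add_le_add (mul_le_mul_of_nonneg_left ?_ (by positivity))
          (mul_le_mul_of_nonneg_left ?_ (by positivity))
        · exact (integral_exp_neg_mul_sq_le hb).trans hsqrt.le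
        · exact hΨint.trans (le_mul_of_one_le_right hr0.le (one_le_pow₀ hs1))
    _ = _ := by
        rw [hD]; field_simp; ring

/-- The centred form of the Fourier transform. -/
theorem prod_digitExp_mul_ech {n : ℕ} {r : ℝ}
    (hmean : ∑ h ∈ terms p n, h * digitMean d (r * h) = n) (θ : ℝ) :
    (∏ h ∈ terms p n, digitExp d (r * h) fun j => 1 * ech (j * (h * θ))) * ech (-(n * θ))
      = ∏ h ∈ terms p n, digitExp d (r * h) fun j =>
        Complex.exp ((2 * Real.pi * (h * θ) * (j - digitMean d (r * h)) : ℝ) * Complex.I) := by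
  have e : ech (-(n * θ)) = ∏ h ∈ terms p n, ech (-(digitMean d (r * h) * (h * θ))) := by
    rw [prod_ech, Finset.sum_neg_distrib, ← congrArg (· * θ) hmean]
    simp only [Finset.sum_mul]
    congr 2
    exact Finset.sum_congr rfl fun h _ => by ring
  rw [e, ← Finset.prod_mul_distrib]
  refine Finset.prod_congr rfl fun h _ => ?_
  rw [mul_comm, ← digitExp_const_mul]
  congr 1
  funext j
  rw [one_mul, ← ech_add]
  unfold ech
  congr 2
  push_cast; ring

/-- B bounds 2πθ in units of r, so the digit at h sees the frequency B r h. Its cubic and quartic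
errors are summed with the weight e^(-rh); the constant is 960 = 8 · 5!. -/
theorem norm_prod_sub_gaussian_le (hp : ∀ j, 1 < p j) (hd : 2 ≤ d) {n : ℕ} {r : ℝ} (hr : 0 < r)
    {K B : ℝ} (hK : ∑ h ∈ terms p n, min (r * h) (r * h)⁻¹ ≤ K) (hB : 0 ≤ B) {θ : ℝ}
    (hθ : 2 * Real.pi * |θ| / r ≤ B) :
    ‖∏ h ∈ terms p n, (digitExp d (r * h) fun j =>
        Complex.exp ((2 * Real.pi * (h * θ) * (j - digitMean d (r * h)) : ℝ) * Complex.I))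
      - (∏ h ∈ terms p n, Real.exp (-((2 * Real.pi * (h * θ)) ^ 2 * digitVar d (r * h) / 2)) : ℝ)‖
      ≤ 960 * d ^ 6 * (B ^ 3 + B ^ 4) * K := by
  rw [Complex.ofReal_prod]
  have hpi := Real.pi_pos
  refine (norm_prod_sub_prod_le _ (β := fun _ => 1) one_pos (fun h _ => ?_) (fun h _ => ?_)
    fun _ _ => le_rfl).trans ?_
  · exact norm_digitExp_le hd fun j _ => (Complex.norm_exp_ofReal_mul_I _).le
  · rw [Complex.norm_real, Real.norm_of_nonneg (Real.exp_pos _).le, Real.exp_le_one_iff,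
      neg_nonpos]
    have := digitVar_nonneg (x := r * h) hd
    positivity
  · simp only [Finset.prod_const_one, one_mul, div_one]
    calc _ ≤ ∑ h ∈ terms p n, 960 * d ^ 6 * (B ^ 3 + B ^ 4) * min (r * h) (r * h)⁻¹ := by
          refine Finset.sum_le_sum fun h hh => ?_
          have hh0 : (0 : ℝ) < h := by exact_mod_cast pos_of_mem_terms hp hh
          refine (norm_digitExp_sub_gaussian_le hd (by positivity) _).trans ?_
          have h3 := pow_mul_exp_neg_le 2 (x := r * h) (by positivity)
          have h4 := pow_mul_exp_neg_le 3 (x := r * h) (by positivity)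
          have e3 : ((2 + 2).factorial : ℝ) = 24 := by norm_num [Nat.factorial]
          have e4 : ((3 + 2).factorial : ℝ) = 120 := by norm_num [Nat.factorial]
          rw [e3] at h3
          rw [e4] at h4
          have hm : 0 ≤ min (r * h) (r * h)⁻¹ := le_min (by positivity) (by positivity)
          generalize min (r * h) (r * h)⁻¹ = mn at h3 h4 hm ⊢
          have hy : |2 * Real.pi * (h * θ)| ≤ B * (r * h) := by
            rw [abs_mul, abs_mul (h : ℝ), abs_of_pos hh0, abs_of_pos (by positivity)]
            calc 2 * Real.pi * (h * |θ|) = 2 * Real.pi * |θ| / r * (r * h) := by field_simp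
              _ ≤ _ := by gcongr
          have hy4 : (2 * Real.pi * (h * θ)) ^ 4 ≤ (B * (r * h)) ^ 4 := by
            rw [← Even.pow_abs (by decide)]
            gcongr
          calc _ ≤ 8 * d ^ 6 * ((B * (r * h)) ^ 3 + (B * (r * h)) ^ 4) * Real.exp (-(r * h)) := by
                gcongr
            _ = 8 * d ^ 6 * (B ^ 3 * ((r * h) ^ (2 + 1) * Real.exp (-(r * h)))
                + B ^ 4 * ((r * h) ^ (3 + 1) * Real.exp (-(r * h)))) := by ring
            _ ≤ 8 * d ^ 6 * (B ^ 3 * (120 * mn) + B ^ 4 * (120 * mn)) := by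
                have h3' := mul_le_mul_of_nonneg_left (h3.trans (by linarith : 24 * mn ≤ 120 * mn))
                  (pow_nonneg hB 3)
                have h4' := mul_le_mul_of_nonneg_left h4 (pow_nonneg hB 4)
                exact mul_le_mul_of_nonneg_left (add_le_add h3' h4') (by positivity)
            _ = _ := by ring
      _ = 960 * d ^ 6 * (B ^ 3 + B ^ 4) * ∑ h ∈ terms p n, min (r * h) (r * h)⁻¹ := by
          rw [Finset.mul_sum]
      _ ≤ _ := by gcongr

/-- Up to constants the exponent is θ² times the variance of the value, and this variance is O(K /
r²). -/
theorem prod_gaussian_ge (hp : ∀ j, 1 < p j) (hd : 2 ≤ d) {n : ℕ} {r : ℝ} (hr : 0 < r)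
    {K B : ℝ} (hK : ∑ h ∈ terms p n, min (r * h) (r * h)⁻¹ ≤ K) {θ : ℝ}
    (hθ : 2 * Real.pi * |θ| / r ≤ B) :
    Real.exp (-(6 * d ^ 3 * B ^ 2 * K))
      ≤ ∏ h ∈ terms p n, Real.exp (-((2 * Real.pi * (h * θ)) ^ 2 * digitVar d (r * h) / 2)) := by
  rw [← Real.exp_sum, Real.exp_le_exp, Finset.sum_neg_distrib, neg_le_neg_iff]
  have hpi := Real.pi_pos
  calc _ ≤ ∑ h ∈ terms p n, 6 * d ^ 3 * B ^ 2 * min (r * h) (r * h)⁻¹ := by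
        refine Finset.sum_le_sum fun h hh => ?_
        have hh0 : (0 : ℝ) < h := by exact_mod_cast pos_of_mem_terms hp hh
        have h3 := pow_mul_exp_neg_le 1 (x := r * h) (by positivity)
        have e3 : ((1 + 2).factorial : ℝ) = 6 := by norm_num [Nat.factorial]
        rw [e3] at h3
        generalize min (r * h) (r * h)⁻¹ = mn at h3 ⊢
        have hv := digitVar_le_exp (x := r * h) hd (by positivity)
        have hv0 := digitVar_nonneg (x := r * h) hd
        calc (2 * Real.pi * (h * θ)) ^ 2 * digitVar d (r * h) / 2
            = (2 * Real.pi * |θ| / r) ^ 2 * ((r * h) ^ 2 * digitVar d (r * h) / 2) := by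
              rw [div_pow, mul_pow _ |θ|, sq_abs]; field_simp
          _ ≤ B ^ 2 * ((r * h) ^ 2 * (2 * d ^ 3 * Real.exp (-(r * h))) / 2) := by gcongr
          _ = d ^ 3 * B ^ 2 * ((r * h) ^ (1 + 1) * Real.exp (-(r * h))) := by ring
          _ ≤ d ^ 3 * B ^ 2 * (6 * mn) := by gcongr
          _ = _ := by ring
    _ = 6 * d ^ 3 * B ^ 2 * ∑ h ∈ terms p n, min (r * h) (r * h)⁻¹ := by rw [Finset.mul_sum]
    _ ≤ _ := by gcongr

theorem norm_prod_digitExp_ech_le_decay (hp : ∀ j, 1 < p j) (hd : 2 ≤ d) {n : ℕ} {r : ℝ}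
    (hr : 0 < r) (hrn : 1 ≤ r * n) (θ : ℝ) :
    ‖∏ h ∈ terms p n, digitExp d (r * h) fun j => 1 * ech (j * (h * θ))‖
      ≤ decay (digitRate d) (terms p r⁻¹) θ := by
  rw [← prod_factorBound _ (terms_inv_subset hp hr hrn), norm_prod]
  refine Finset.prod_le_prod (fun _ _ => norm_nonneg _) fun h _ => ?_
  simp only [one_mul]
  exact norm_digitExp_ech_le_factorBound hp hd hr θ h

theorem eventually_sqrt_log_pow_ge (hk : 1 ≤ k) (B : ℝ) :
    ∀ᶠ n : ℕ in atTop, B ≤ Real.sqrt (Real.log n ^ k) := by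
  filter_upwards [tendsto_log_natCast.eventually_ge_atTop 1,
    tendsto_log_natCast.eventually_ge_atTop (B ^ 2)] with n h1 h2
  exact Real.le_sqrt_of_sq_le (h2.trans (le_self_pow₀ h1 (by omega)))

/-- The probability that the random value equals `n` is at least of order `1 / standard
deviation`. -/
theorem exists_tiltProb_ge (hk : 1 ≤ k) (hp : ∀ j, 1 < p j)
    (hcop : ∀ i j, i ≠ j → Nat.Coprime (p i) (p j)) (hd : 2 ≤ d) (hC : 1 ≤ C) :
    ∃ c > 0, ∀ᶠ n : ℕ in atTop, ∀ r, IsTilt p d C n r →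
      c * (r / Real.sqrt (Real.log n ^ k)) ≤ ‖tiltProb p d n r‖ := by
  obtain ⟨K, hK1, hsum⟩ := eventually_sum_min_le hp hcop
  obtain ⟨c1, hc1, hdecay⟩ := exists_decay_le hk hp hcop (d := d) hC (digitRate_pos hd)
  obtain ⟨K2, hK2, hgauss⟩ := exists_pow_mul_exp_neg_sq_le 1 hc1
  have hpi := Real.pi_pos
  set g0 := Real.exp (-(6 * d ^ 3 * (2 * Real.pi) ^ 2 * K)) with hg0
  have hg0pos : 0 < g0 := Real.exp_pos _
  set D := K2 * Real.sqrt (Real.pi / (c1 / 2)) with hD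
  have hD0 : 0 ≤ D := by positivity
  -- A cuts the integral at |θ| = A r / s, with A independent of n. The Gaussian tail beyond is at
  -- most D/A ≤ g0/3 in units of r / s: the inequality for |y| e^(-c1 y²) gives the factor 1/A when
  -- |y| ≥ A.
  set A := max 1 (3 * D / g0) with hA
  have hA1 : 1 ≤ A := le_max_left _ _
  have hA0 : 0 < A := by linarith
  have hDA : D / A ≤ g0 / 3 := by
    have : 3 * D / g0 ≤ A := le_max_right _ _
    rw [div_le_iff₀ hg0pos] at this
    rw [div_le_iff₀ hA0]
    linarith
  set E := 960 * d ^ 6 * ((2 * Real.pi * A) ^ 3 + (2 * Real.pi * A) ^ 4) * K with hE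
  have hE0 : 0 ≤ E := by positivity
  refine ⟨g0, hg0pos, ?_⟩
  filter_upwards [hsum, hdecay (k + 1), eventually_sqrt_log_pow_ge hk 1,
    eventually_sqrt_log_pow_ge hk (2 * A * E * 3 / g0),
    tendsto_log_natCast.eventually_ge_atTop 1,
    tendsto_log_natCast.eventually_ge_atTop (3 / g0),
    eventually_isTilt_of_eventually (p := p) (d := d) (C := C) (eventually_ge_atTop (2 * A))]
    with n hsum hdec hs1 hs2 hL1 hL2 hM r hr
  have hr0 := hr.pos
  obtain ⟨Ψ, hΨc, hΨ0, hΨint, hΨ⟩ := hdec r hr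
  have hsumr := hsum r hr0
  have hMr := hM r hr
  set L := Real.log n with hLdef
  set s := Real.sqrt (L ^ k) with hs
  have hss : s ^ 2 = L ^ k := Real.sq_sqrt (by positivity)
  have hs0 : 0 < s := by linarith
  set a := A * (r / s) with ha
  have hrs : r / s ≤ r := div_le_self hr0.le hs1
  have ha0 : 0 < a := by positivity
  have ha2 : a ≤ 1 / 2 := by
    have : r * (2 * A) ≤ r * r⁻¹ := by gcongr
    rw [mul_inv_cancel₀ hr0.ne'] at this
    calc a ≤ A * r := by rw [ha]; gcongr
      _ ≤ 1 / 2 := by linarith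
  set φ : ℝ → ℂ := fun θ => (∏ h ∈ terms p n, digitExp d (r * h) fun j => 1 * ech (j * (h * θ)))
    * ech (-(n * θ)) with hφ
  have hφc : Continuous φ := by
    have := continuous_ech
    have h2 := fun h : ℕ => continuous_digitExp_ech d (r * h) h fun _ => 1
    rw [hφ]; fun_prop
  set G : ℝ → ℝ := fun θ => ∏ h ∈ terms p n,
    Real.exp (-((2 * Real.pi * (h * θ)) ^ 2 * digitVar d (r * h) / 2)) with hG
  have hGc : Continuous G := by rw [hG]; fun_prop
  have hG0 : ∀ θ, 0 ≤ G θ := fun θ => Finset.prod_nonneg fun _ _ => (Real.exp_pos _).le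
  set tl : ℝ → ℝ := fun θ => K2 / A * Real.exp (-(c1 / 2 * (s / r) ^ 2 * θ ^ 2)) + Ψ θ with htl
  have htlc : Continuous tl := by rw [htl]; fun_prop
  have htl0 : ∀ θ, 0 ≤ tl θ := fun θ => add_nonneg (by positivity) (hΨ0 θ)
  have hφtl : ∀ θ, a ≤ |θ| → |θ| ≤ 1 / 2 → ‖φ θ‖ ≤ tl θ := by
    intro θ hθ1 hθ2
    have h1 : ‖φ θ‖ ≤ decay (digitRate d) (terms p r⁻¹) θ := by
      rw [hφ]
      simp only [norm_mul, norm_ech, mul_one]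
      exact norm_prod_digitExp_ech_le_decay hp hd hr0 hr.lower θ
    refine h1.trans ((hΨ θ hθ2).trans ?_)
    refine add_le_add ?_ le_rfl
    have h2 := hgauss (s * (θ / r))
    have e1 : L ^ k * (θ / r) ^ 2 = (s * (θ / r)) ^ 2 := by rw [mul_pow, hss]
    have e2 : c1 / 2 * (s / r) ^ 2 * θ ^ 2 = c1 / 2 * (s * (θ / r)) ^ 2 := by ring
    have h3 : A ≤ |s * (θ / r)| := by
      rw [abs_mul, abs_div, abs_of_pos hs0, abs_of_pos hr0]
      calc A = s * (a / r) := by rw [ha]; field_simp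
        _ ≤ _ := by gcongr
    rw [e1, e2]
    generalize s * (θ / r) = y at h2 h3
    rw [pow_one] at h2
    rw [div_mul_eq_mul_div, le_div_iff₀ hA0, mul_comm]
    exact le_trans (by gcongr) h2
  have hint : ∀ {f : ℝ → ℂ}, Continuous f → ∀ x y, IntervalIntegrable f MeasureTheory.volume x y :=
    fun hf x y => hf.intervalIntegrable x y
  have hintR : ∀ {f : ℝ → ℝ}, Continuous f → ∀ x y,
    IntervalIntegrable f MeasureTheory.volume x y := fun hf x y => hf.intervalIntegrable x y
  have hsplit : tiltProb p d n r = (∫ θ in (-1 / 2 : ℝ)..(-a), φ θ) + (∫ θ in (-a)..a, φ θ)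
      + ∫ θ in a..1 / 2, φ θ := by
    rw [intervalIntegral.integral_add_adjacent_intervals (hint hφc _ _) (hint hφc _ _),
      intervalIntegral.integral_add_adjacent_intervals (hint hφc _ _) (hint hφc _ _)]
    rfl
  have htail1 : ‖∫ θ in (-1 / 2 : ℝ)..(-a), φ θ‖ ≤ ∫ θ in (-1 / 2 : ℝ)..(-a), tl θ := by
    refine intervalIntegral.norm_integral_le_of_norm_le (by linarith)
      (Filter.Eventually.of_forall fun θ hθ => ?_) (hintR htlc _ _)
    have h1 : |θ| = -θ := abs_of_neg (by linarith [hθ.2])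
    exact hφtl θ (by rw [h1]; linarith [hθ.2]) (by rw [h1]; linarith [hθ.1])
  have htail2 : ‖∫ θ in a..1 / 2, φ θ‖ ≤ ∫ θ in a..1 / 2, tl θ := by
    refine intervalIntegral.norm_integral_le_of_norm_le (by linarith)
      (Filter.Eventually.of_forall fun θ hθ => ?_) (hintR htlc _ _)
    have h1 : |θ| = θ := abs_of_pos (by linarith [hθ.1])
    exact hφtl θ (by rw [h1]; linarith [hθ.1]) (by rw [h1]; linarith [hθ.2])
  have htlmid : 0 ≤ ∫ θ in (-a)..a, tl θ :=
    intervalIntegral.integral_nonneg (by linarith) fun θ _ => htl0 θ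
  have htlsplit : (∫ θ in (-1 / 2 : ℝ)..(-a), tl θ) + (∫ θ in (-a)..a, tl θ)
      + (∫ θ in a..1 / 2, tl θ) = ∫ θ in (-1 / 2 : ℝ)..1 / 2, tl θ := by
    rw [intervalIntegral.integral_add_adjacent_intervals (hintR htlc _ _) (hintR htlc _ _),
      intervalIntegral.integral_add_adjacent_intervals (hintR htlc _ _) (hintR htlc _ _)]
  have hb : 0 < c1 / 2 * (s / r) ^ 2 := by positivity
  have hsqrt : Real.sqrt (Real.pi / (c1 / 2 * (s / r) ^ 2))
      = Real.sqrt (Real.pi / (c1 / 2)) * (r / s) := by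
    rw [← div_div, Real.sqrt_div (by positivity), Real.sqrt_sq (by positivity)]
    field_simp
  have htltotal : ∫ θ in (-1 / 2 : ℝ)..1 / 2, tl θ ≤ (2 * g0 / 3) * (r / s) := by
    rw [htl, intervalIntegral.integral_add (hintR (by fun_prop) _ _) (hintR hΨc _ _),
      intervalIntegral.integral_const_mul]
    have h1 := (integral_exp_neg_mul_sq_le hb).trans hsqrt.le
    have h2 : ∫ θ in (-1 / 2 : ℝ)..1 / 2, Ψ θ ≤ g0 / 3 * (r / s) := by
      have h3 : (0 : ℝ) < L ^ (k + 1) := by positivity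
      have h4 : ∫ θ in (-1 / 2 : ℝ)..1 / 2, Ψ θ ≤ r / L ^ (k + 1) := by
        rw [le_div_iff₀ h3, mul_comm]; exact hΨint
      refine h4.trans ?_
      rw [div_le_iff₀ h3, pow_succ, ← hss]
      rw [div_le_iff₀ hg0pos] at hL2
      calc r = 1 * r * 1 := by ring
        _ ≤ (g0 / 3 * L) * r * s := by gcongr; linarith
        _ = _ := by field_simp
    calc _ ≤ K2 / A * (Real.sqrt (Real.pi / (c1 / 2)) * (r / s)) + g0 / 3 * (r / s) := by gcongr
      _ = D / A * (r / s) + g0 / 3 * (r / s) := by rw [hD]; ring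
      _ ≤ g0 / 3 * (r / s) + g0 / 3 * (r / s) := by gcongr
      _ = _ := by ring
  have hmid : ‖(∫ θ in (-a)..a, φ θ) - ((∫ θ in (-a)..a, G θ : ℝ) : ℂ)‖ ≤ g0 / 3 * (r / s) := by
    rw [← intervalIntegral.integral_ofReal,
      ← intervalIntegral.integral_sub (hint hφc _ _) (hint (by fun_prop) _ _)]
    have h1 : ∀ θ ∈ Set.uIoc (-a) a, ‖φ θ - (G θ : ℂ)‖ ≤ E / s := by
      intro θ hθ
      rw [Set.uIoc_of_le (by linarith)] at hθ
      have hθa : |θ| ≤ a := abs_le.2 ⟨hθ.1.le, hθ.2⟩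
      have h2 : 2 * Real.pi * |θ| / r ≤ 2 * Real.pi * A / s := by
        calc 2 * Real.pi * |θ| / r ≤ 2 * Real.pi * a / r := by gcongr
          _ = _ := by rw [ha]; field_simp
      have h3 := norm_prod_sub_gaussian_le hp hd hr0 hsumr (by positivity) h2
      rw [← prod_digitExp_mul_ech hr.mean_eq] at h3
      refine h3.trans ?_
      rw [hE, ← hss, div_pow, div_pow]
      set Z := 2 * Real.pi * A
      have hZ : 0 ≤ Z := by positivity
      have h5 : (Z ^ 3 / s ^ 3 + Z ^ 4 / s ^ 4) * s ^ 3 ≤ Z ^ 3 + Z ^ 4 := by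
        rw [add_mul, div_mul_cancel₀ _ (by positivity)]
        gcongr
        rw [div_mul_eq_mul_div, div_le_iff₀ (by positivity)]
        gcongr
        norm_num
      rw [le_div_iff₀ hs0]
      calc _ = 960 * d ^ 6 * ((Z ^ 3 / s ^ 3 + Z ^ 4 / s ^ 4) * s ^ 3) * K := by ring
        _ ≤ _ := by gcongr
    have h4 := intervalIntegral.norm_integral_le_of_norm_le_const h1
    refine h4.trans ?_
    rw [show a - -a = 2 * a by ring, abs_of_pos (by positivity), ha]
    rw [div_le_iff₀ hg0pos] at hs2
    calc E / s * (2 * (A * (r / s))) = (2 * A * E) / s * (r / s) := by ring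
      _ ≤ g0 / 3 * (r / s) := by
          refine mul_le_mul_of_nonneg_right ?_ (by positivity)
          rw [div_le_iff₀ hs0]; linarith
  -- Already |θ| ≤ r / s yields the main term 2 g0. The tails cost 2 g0 / 3 and the Gaussian
  -- approximation g0 / 3, which leaves g0.
  have hGint : 2 * g0 * (r / s) ≤ ∫ θ in (-a)..a, G θ := by
    have hrsa : r / s ≤ a := le_mul_of_one_le_left (by positivity) hA1
    have h1 : ∫ θ in (-(r / s))..(r / s), G θ ≤ ∫ θ in (-a)..a, G θ :=
      intervalIntegral.integral_mono_interval (by linarith) (by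
        have : 0 < r / s := by positivity
        linarith) hrsa (Filter.Eventually.of_forall hG0) (hintR hGc _ _)
    refine le_trans ?_ h1
    have h2 : ∫ θ in (-(r / s))..(r / s), g0 ≤ ∫ θ in (-(r / s))..(r / s), G θ := by
      have hrs0 : 0 < r / s := by positivity
      refine intervalIntegral.integral_mono_on (by linarith) (hintR continuous_const _ _)
        (hintR hGc _ _) fun θ hθ => ?_
      have h3 : 2 * Real.pi * |θ| / r ≤ 2 * Real.pi / s := by
        calc 2 * Real.pi * |θ| / r ≤ 2 * Real.pi * (r / s) / r := by
              gcongr; exact abs_le.2 hθ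
          _ = _ := by field_simp
      refine le_trans ?_ (prod_gaussian_ge hp hd hr0 hsumr h3)
      rw [hg0, Real.exp_le_exp, neg_le_neg_iff, ← hss]
      refine le_of_eq ?_
      field_simp
    rw [intervalIntegral.integral_const, smul_eq_mul] at h2
    linarith
  have hnorm : (∫ θ in (-a)..a, G θ) ≤ ‖tiltProb p d n r‖ + ‖∫ θ in (-1 / 2 : ℝ)..(-a), φ θ‖
      + ‖∫ θ in a..1 / 2, φ θ‖ + ‖(∫ θ in (-a)..a, φ θ) - ((∫ θ in (-a)..a, G θ : ℝ) : ℂ)‖ := by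
    have e : ((∫ θ in (-a)..a, G θ : ℝ) : ℂ) = tiltProb p d n r
        - (∫ θ in (-1 / 2 : ℝ)..(-a), φ θ) - (∫ θ in a..1 / 2, φ θ)
        - ((∫ θ in (-a)..a, φ θ) - ((∫ θ in (-a)..a, G θ : ℝ) : ℂ)) := by
      rw [hsplit]; ring
    calc (∫ θ in (-a)..a, G θ) ≤ ‖((∫ θ in (-a)..a, G θ : ℝ) : ℂ)‖ := by
          rw [Complex.norm_real]; exact Real.le_norm_self _
      _ ≤ _ := by
          rw [e]
          refine (norm_sub_le _ _).trans (add_le_add ((norm_sub_le _ _).trans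
            (add_le_add (norm_sub_le _ _) le_rfl)) (le_of_eq ?_))
          rw [← e]
  linarith

end MultiBase

/-! ### Conditional moments and sums over S -/

namespace MultiBase

section Average

variable {m : ℕ} {p : Fin m → ℕ} {d n : ℕ}

theorem avg_sum {ι : Type*} (s : Finset ι) (f : ι → (ℕ →₀ ℕ) → ℂ) :
    avg p d n (fun a => ∑ i ∈ s, f i a) = ∑ i ∈ s, avg p d n (f i) := by
  unfold avg
  rw [Finset.sum_comm, Finset.sum_div]

theorem avg_add (f g : (ℕ →₀ ℕ) → ℂ) :
    avg p d n (fun a => f a + g a) = avg p d n f + avg p d n g := by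
  unfold avg
  rw [Finset.sum_add_distrib, add_div]

theorem avg_const (hne : (reps p d n).Nonempty) (c : ℂ) : avg p d n (fun _ => c) = c := by
  unfold avg
  have : ((reps p d n).card : ℂ) ≠ 0 := by exact_mod_cast hne.card_pos.ne'
  rw [Finset.sum_const, nsmul_eq_mul]
  field_simp

theorem avg_const_mul (c : ℂ) (f : (ℕ →₀ ℕ) → ℂ) :
    avg p d n (fun a => c * f a) = c * avg p d n f := by
  unfold avg
  rw [← Finset.mul_sum, mul_div_assoc]

theorem avg_congr {f g : (ℕ →₀ ℕ) → ℂ} (h : ∀ a ∈ reps p d n, f a = g a) :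
    avg p d n f = avg p d n g := by
  unfold avg
  rw [Finset.sum_congr rfl h]

theorem digitSum_eq_sum (hp : ∀ j, 1 < p j) (hd : 2 ≤ d) {a : ℕ →₀ ℕ} (ha : a ∈ reps p d n) :
    digitSum a = ∑ h ∈ terms p n, a h := by
  rw [reps_eq_filter hp hd, Finset.mem_filter, Finset.mem_finsupp_iff] at ha
  exact Finsupp.sum_of_support_subset _ ha.1.1 _ (by simp)

/-- The sum of the centred digits. -/
noncomputable def centredSum (p : Fin m → ℕ) (d n : ℕ) (r : ℝ) (a : ℕ →₀ ℕ) : ℝ :=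
  ∑ h ∈ terms p n, ((a h : ℝ) - digitMean d (r * h))

/-- The mean of the sum of independent digits. -/
noncomputable def tiltMean (p : Fin m → ℕ) (d n : ℕ) (r : ℝ) : ℝ :=
  ∑ h ∈ terms p n, digitMean d (r * h)

/-- The variance of the sum of independent digits. -/
noncomputable def tiltVar (p : Fin m → ℕ) (d n : ℕ) (r : ℝ) : ℝ :=
  ∑ h ∈ terms p n, digitVar d (r * h)

theorem digitSum_eq_centredSum (hp : ∀ j, 1 < p j) (hd : 2 ≤ d) (r : ℝ) {a : ℕ →₀ ℕ}
    (ha : a ∈ reps p d n) :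
    (digitSum a : ℝ) = centredSum p d n r a + tiltMean p d n r := by
  unfold centredSum tiltMean
  rw [digitSum_eq_sum hp hd ha, Finset.sum_sub_distrib, sub_add_cancel]
  push_cast
  rfl

theorem mean_eq (hp : ∀ j, 1 < p j) (hd : 2 ≤ d) (hne : (reps p d n).Nonempty) (r : ℝ) :
    mean p d n = expect p d n (centredSum p d n r) + tiltMean p d n r := by
  have hc : ((reps p d n).card : ℝ) ≠ 0 := by exact_mod_cast hne.card_pos.ne'
  unfold mean expect
  rw [Finset.sum_congr rfl fun a ha => digitSum_eq_centredSum hp hd r ha, Finset.sum_add_distrib,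
    Finset.sum_const, nsmul_eq_mul]
  field_simp

theorem variance_eq (hp : ∀ j, 1 < p j) (hd : 2 ≤ d) (hne : (reps p d n).Nonempty) (r : ℝ) :
    variance p d n = expect p d n (fun a => centredSum p d n r a ^ 2)
      - expect p d n (centredSum p d n r) ^ 2 := by
  have hc : ((reps p d n).card : ℝ) ≠ 0 := by exact_mod_cast hne.card_pos.ne'
  have hm := mean_eq hp hd hne r
  set E := expect p d n (centredSum p d n r) with hE
  have e : ∀ a ∈ reps p d n, ((digitSum a : ℝ) - mean p d n) ^ 2
      = centredSum p d n r a ^ 2 - 2 * E * centredSum p d n r a + E ^ 2 := by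
    intro a ha
    rw [hm, digitSum_eq_centredSum hp hd r ha]; ring
  unfold variance
  rw [expect, Finset.sum_congr rfl e, Finset.sum_add_distrib, Finset.sum_sub_distrib,
    ← Finset.mul_sum, Finset.sum_const, nsmul_eq_mul]
  have hsum : ∑ a ∈ reps p d n, centredSum p d n r a = E * (reps p d n).card := by
    rw [hE, expect]; field_simp
  rw [hsum, expect]
  field_simp
  ring

theorem sum_integral_decay_mul (c : ℝ) (S : Finset ℕ) (r D : ℝ) :
    ∑ h ∈ terms p n, ∫ θ in (-1 / 2 : ℝ)..1 / 2, decay c S θ * (D * shift d r θ h)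
      = D * ∫ θ in (-1 / 2 : ℝ)..1 / 2, decay c S θ * shiftSum p d n r θ ^ (0 + 1) := by
  have hcs := continuous_shift d r
  have hcd := continuous_decay c S
  rw [← intervalIntegral.integral_finsetSum fun h _ =>
    Continuous.intervalIntegrable (by fun_prop) _ _, ← intervalIntegral.integral_const_mul]
  congr 1
  funext θ
  rw [← Finset.mul_sum, ← Finset.mul_sum, zero_add, pow_one, shiftSum]
  ring

theorem digitExp_centred (hd : 2 ≤ d) (x : ℝ) :
    digitExp d x (fun j => (((j : ℝ) - digitMean d x : ℝ) : ℂ)) = 0 := by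
  simp only [Complex.ofReal_sub]
  rw [digitExp_sub, digitExp_const hd]
  simp only [digitExp, digitMean]
  push_cast
  exact sub_self _

theorem digitExp_centred_sq (hd : 2 ≤ d) (x : ℝ) :
    digitExp d x (fun j => ((((j : ℝ) - digitMean d x) ^ 2 - digitVar d x : ℝ) : ℂ)) = 0 := by
  simp only [Complex.ofReal_sub]
  rw [digitExp_sub, digitExp_const hd]
  simp only [digitExp, digitVar]
  push_cast
  exact sub_self _

theorem norm_avg_centredSum_le (hp : ∀ j, 1 < p j) (hd : 2 ≤ d) {r : ℝ} (hr : 0 < r)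
    (hrn : 1 ≤ r * n) :
    ‖avg p d n fun a => (centredSum p d n r a : ℂ)‖ * ‖tiltProb p d n r‖
      ≤ 2 * d * Real.exp (2 * digitRate d) * ∫ θ in (-1 / 2 : ℝ)..1 / 2,
        decay (digitRate d) (terms p r⁻¹) θ * shiftSum p d n r θ ^ (0 + 1) := by
  unfold centredSum
  simp only [Complex.ofReal_sum]
  rw [avg_sum, ← sum_integral_decay_mul]
  refine (mul_le_mul_of_nonneg_right (norm_sum_le _ _) (norm_nonneg _)).trans ?_
  rw [Finset.sum_mul]
  refine Finset.sum_le_sum fun h hh => ?_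
  refine norm_avg_single_le hp hd hr hrn
    (f := fun j => (((j : ℝ) - digitMean d (r * h) : ℝ) : ℂ)) hh (fun j hj => ?_)
    (digitExp_centred hd _)
  rw [Complex.norm_real]
  exact abs_digit_sub_mean_le hd hj

/-- The square splits into diagonal terms, which after subtraction of their variances are centred
functions of one digit, and off-diagonal products of two centred digits. The former give `shiftSum`,
the latter its square. -/
theorem norm_avg_centredSum_sq_le (hp : ∀ j, 1 < p j) (hd : 2 ≤ d) {r : ℝ} (hr : 0 < r)
    (hrn : 1 ≤ r * n) (hne : (reps p d n).Nonempty) :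
    ‖(avg p d n fun a => ((centredSum p d n r a ^ 2 : ℝ) : ℂ)) - tiltVar p d n r‖
        * ‖tiltProb p d n r‖
      ≤ 2 * d ^ 2 * Real.exp (2 * digitRate d) * (∫ θ in (-1 / 2 : ℝ)..1 / 2,
        decay (digitRate d) (terms p r⁻¹) θ * shiftSum p d n r θ ^ (0 + 1))
        + (2 * d * Real.exp (2 * digitRate d)) ^ 2 * ∫ θ in (-1 / 2 : ℝ)..1 / 2,
        decay (digitRate d) (terms p r⁻¹) θ * shiftSum p d n r θ ^ (1 + 1) := by
  classical
  set T := terms p n with hT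
  set D := 2 * d * Real.exp (2 * digitRate d) with hD
  set Y : ℕ → ℕ → ℂ := fun h j => (((j : ℝ) - digitMean d (r * h) : ℝ) : ℂ) with hY
  set X : ℕ → ℕ → ℂ := fun h j =>
    ((((j : ℝ) - digitMean d (r * h)) ^ 2 - digitVar d (r * h) : ℝ) : ℂ) with hX
  have hYM : ∀ h, ∀ j < d, ‖Y h j‖ ≤ d := fun h j hj => by
    rw [hY, Complex.norm_real]; exact abs_digit_sub_mean_le hd hj
  have hXM : ∀ h, ∀ j < d, ‖X h j‖ ≤ (d : ℝ) ^ 2 := fun h j hj => by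
    rw [hX, Complex.norm_real, Real.norm_eq_abs]
    have h1 := digitVar_nonneg (x := r * h) hd
    have h2 := digitVar_le (x := r * h) hd
    have h3 : ((j : ℝ) - digitMean d (r * h)) ^ 2 ≤ (d : ℝ) ^ 2 := by
      rw [← sq_abs]
      have := abs_digit_sub_mean_le (x := r * h) hd hj
      gcongr
    have h4 := sq_nonneg ((j : ℝ) - digitMean d (r * h))
    rw [abs_le]; constructor <;> linarith
  have hdecomp : ∀ a : ℕ →₀ ℕ, ((centredSum p d n r a ^ 2 : ℝ) : ℂ)
      = (∑ h ∈ T, X h (a h) + ∑ h ∈ T, ∑ h' ∈ T.erase h, Y h (a h) * Y h' (a h'))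
        + tiltVar p d n r := by
    intro a
    unfold centredSum tiltVar
    rw [← hT]
    have h1 : (∑ h ∈ T, ((a h : ℝ) - digitMean d (r * h))) ^ 2
        = ∑ h ∈ T, (((a h : ℝ) - digitMean d (r * h)) ^ 2
          + ∑ h' ∈ T.erase h, ((a h : ℝ) - digitMean d (r * h))
            * ((a h' : ℝ) - digitMean d (r * h'))) := by
      rw [sq, Finset.sum_mul_sum]
      refine Finset.sum_congr rfl fun h hh => ?_
      rw [← Finset.add_sum_erase _ _ hh, sq]
    rw [h1, Finset.sum_add_distrib]
    simp only [hX, hY]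
    push_cast
    rw [Finset.sum_sub_distrib]
    ring
  have havg : (avg p d n fun a => ((centredSum p d n r a ^ 2 : ℝ) : ℂ)) - tiltVar p d n r
      = ∑ h ∈ T, avg p d n (fun a => X h (a h))
        + ∑ h ∈ T, ∑ h' ∈ T.erase h, avg p d n fun a => Y h (a h) * Y h' (a h') := by
    simp only [hdecomp]
    rw [avg_add, avg_const hne, add_sub_cancel_right, avg_add, avg_sum, avg_sum]
    simp only [avg_sum]
  rw [havg]
  refine (mul_le_mul_of_nonneg_right (norm_add_le _ _) (norm_nonneg _)).trans ?_
  rw [add_mul]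
  have hcs := continuous_shift d r
  have hcd := continuous_decay (digitRate d) (terms p r⁻¹)
  refine add_le_add ?_ ?_
  · rw [← sum_integral_decay_mul]
    refine (mul_le_mul_of_nonneg_right (norm_sum_le _ _) (norm_nonneg _)).trans ?_
    rw [Finset.sum_mul]
    exact Finset.sum_le_sum fun h hh =>
      norm_avg_single_le hp hd hr hrn (f := X h) hh (hXM h) (digitExp_centred_sq hd _)
  · have h1 : ∀ h ∈ T, ∀ h' ∈ T.erase h,
        ‖avg p d n fun a => Y h (a h) * Y h' (a h')‖ * ‖tiltProb p d n r‖
        ≤ ∫ θ in (-1 / 2 : ℝ)..1 / 2, decay (digitRate d) (terms p r⁻¹) θ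
        * (D ^ 2 * (shift d r θ h * shift d r θ h')) := by
      intro h hh h' hh'
      rw [Finset.mem_erase] at hh'
      exact norm_avg_pair_le hp hd hr hrn hh hh'.2 (Ne.symm hh'.1) hYM fun i => digitExp_centred hd _
    -- Non-negativity allows the omitted diagonal to be added back, so that the double sum factors
    -- as a square.
    have h2 : ∀ h h', 0 ≤ ∫ θ in (-1 / 2 : ℝ)..1 / 2, decay (digitRate d) (terms p r⁻¹) θ
        * (D ^ 2 * (shift d r θ h * shift d r θ h')) := fun h h' =>
      intervalIntegral.integral_nonneg (by norm_num) fun θ _ =>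
        mul_nonneg (decay_pos _ _ _).le (mul_nonneg (sq_nonneg _)
          (mul_nonneg (shift_nonneg _ _ _ _) (shift_nonneg _ _ _ _)))
    calc _ ≤ (∑ h ∈ T, ∑ h' ∈ T.erase h, ‖avg p d n fun a => Y h (a h) * Y h' (a h')‖)
          * ‖tiltProb p d n r‖ := by
          gcongr
          exact (norm_sum_le _ _).trans (Finset.sum_le_sum fun h _ => norm_sum_le _ _)
      _ ≤ ∑ h ∈ T, ∑ h' ∈ T.erase h, ∫ θ in (-1 / 2 : ℝ)..1 / 2,
          decay (digitRate d) (terms p r⁻¹) θ * (D ^ 2 * (shift d r θ h * shift d r θ h')) := by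
          simp only [Finset.sum_mul]
          exact Finset.sum_le_sum fun h hh => Finset.sum_le_sum fun h' hh' => h1 h hh h' hh'
      _ ≤ ∑ h ∈ T, ∑ h' ∈ T, ∫ θ in (-1 / 2 : ℝ)..1 / 2,
          decay (digitRate d) (terms p r⁻¹) θ * (D ^ 2 * (shift d r θ h * shift d r θ h')) :=
          Finset.sum_le_sum fun h _ => Finset.sum_le_sum_of_subset_of_nonneg
            (Finset.erase_subset _ _) fun h' _ _ => h2 h h'
      _ = _ := by
          have h3 : ∀ h ∈ T, ∑ h' ∈ T, ∫ θ in (-1 / 2 : ℝ)..1 / 2,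
              decay (digitRate d) (terms p r⁻¹) θ * (D ^ 2 * (shift d r θ h * shift d r θ h'))
              = ∫ θ in (-1 / 2 : ℝ)..1 / 2, ∑ h' ∈ T,
              decay (digitRate d) (terms p r⁻¹) θ * (D ^ 2 * (shift d r θ h * shift d r θ h')) :=
            fun h _ => (intervalIntegral.integral_finsetSum fun h' _ =>
              Continuous.intervalIntegrable (by fun_prop) _ _).symm
          rw [Finset.sum_congr rfl h3, ← intervalIntegral.integral_finsetSum fun h _ =>
            Continuous.intervalIntegrable (by fun_prop) _ _, ← intervalIntegral.integral_const_mul]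
          congr 1
          funext θ
          simp only [← Finset.mul_sum, ← Finset.sum_mul]
          rw [shiftSum, ← hT]
          ring

end Average

variable {k : ℕ} {p : Fin (k + 1) → ℕ} {d : ℕ} {C : ℝ}

theorem reps_nonempty_of_tiltProb_pos (hp : ∀ j, 1 < p j) (hd : 2 ≤ d) {n : ℕ} {r : ℝ}
    (h : 0 < ‖tiltProb p d n r‖) : (reps p d n).Nonempty := by
  rw [Finset.nonempty_iff_ne_empty]
  intro he
  rw [tiltProb_eq hp hd, he] at h
  simp at h

/-- The first two conditional moments of the centred digit sum. -/
theorem exists_moment_bounds (hk : 1 ≤ k) (hp : ∀ j, 1 < p j)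
    (hcop : ∀ i j, i ≠ j → Nat.Coprime (p i) (p j)) (hd : 2 ≤ d) (hC : 1 ≤ C) :
    ∃ K ≥ 1, ∀ᶠ n : ℕ in atTop, ∀ r, IsTilt p d C n r → (reps p d n).Nonempty ∧
      |expect p d n (centredSum p d n r)| ≤ K * Real.sqrt (Real.log n ^ k) ∧
      |expect p d n (fun a => centredSum p d n r a ^ 2) - tiltVar p d n r|
        ≤ K * Real.log n ^ k := by
  obtain ⟨c, hc, hP⟩ := exists_tiltProb_ge hk hp hcop hd hC
  obtain ⟨K0, hK0, h0⟩ := exists_integral_decay_mul_shiftSum_le (d := d) hk hp hcop hC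
    (digitRate_pos hd) 0
  obtain ⟨K1, hK1, h1⟩ := exists_integral_decay_mul_shiftSum_le (d := d) hk hp hcop hC
    (digitRate_pos hd) 1
  set D := Real.exp (2 * digitRate d) with hD
  have hD0 : 0 < D := Real.exp_pos _
  have hd0 : (0 : ℝ) < d := by positivity
  set A := 2 * d * D * K0 / c with hA
  set B := (2 * d ^ 2 * D * K0 + (2 * d * D) ^ 2 * K1) / c with hB
  have hA0 : 0 ≤ A := by positivity
  have hB0 : 0 ≤ B := by positivity
  refine ⟨A + B + 1, by linarith, ?_⟩
  filter_upwards [hP, h0, h1, eventually_sqrt_log_pow_ge hk 1,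
    tendsto_log_natCast.eventually_ge_atTop 1] with n hP h0 h1 hs1 hL r hr
  have hr0 := hr.pos
  have hPr := hP r hr
  have h0r := h0 r hr
  have h1r := h1 r hr
  set s := Real.sqrt (Real.log n ^ k) with hs
  have hss : s ^ 2 = Real.log n ^ k := Real.sq_sqrt (by positivity)
  have hs0 : 0 < s := by linarith
  have hcr : 0 < c * (r / s) := by positivity
  have hne := reps_nonempty_of_tiltProb_pos hp hd (hcr.trans_le hPr)
  refine ⟨hne, ?_, ?_⟩
  · have h2 := norm_avg_centredSum_le hp hd hr0 hr.lower
    rw [← ofReal_expect, Complex.norm_real, Real.norm_eq_abs] at h2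
    -- The joint integral is O(r); cancelling the hitting probability of order r / s leaves O(s).
    have h3 : |expect p d n (centredSum p d n r)| * (c * (r / s)) ≤ 2 * d * D * (K0 * (r * s ^ 0)) :=
      (mul_le_mul_of_nonneg_left hPr (abs_nonneg _)).trans
        (h2.trans (mul_le_mul_of_nonneg_left h0r (by positivity)))
    rw [← le_div_iff₀ hcr] at h3
    calc _ ≤ _ := h3
      _ = A * s := by rw [hA]; field_simp
      _ ≤ _ := by gcongr; linarith
  · have h2 := norm_avg_centredSum_sq_le hp hd hr0 hr.lower hne
    rw [← ofReal_expect, ← Complex.ofReal_sub, Complex.norm_real, Real.norm_eq_abs] at h2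
    have h3 : |expect p d n (fun a => centredSum p d n r a ^ 2) - tiltVar p d n r| * (c * (r / s))
        ≤ 2 * d ^ 2 * D * (K0 * (r * s ^ 0)) + (2 * d * D) ^ 2 * (K1 * (r * s ^ 1)) :=
      (mul_le_mul_of_nonneg_left hPr (abs_nonneg _)).trans
        (h2.trans (add_le_add (mul_le_mul_of_nonneg_left h0r (by positivity))
          (mul_le_mul_of_nonneg_left h1r (by positivity))))
    have h4 : 2 * d ^ 2 * D * (K0 * (r * s ^ 0)) + (2 * d * D) ^ 2 * (K1 * (r * s ^ 1))
        ≤ (2 * d ^ 2 * D * K0 + (2 * d * D) ^ 2 * K1) * (r * s) := by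
      have : r ≤ r * s := le_mul_of_one_le_right hr0.le hs1
      calc _ = 2 * d ^ 2 * D * K0 * r + (2 * d * D) ^ 2 * K1 * (r * s) := by ring
        _ ≤ 2 * d ^ 2 * D * K0 * (r * s) + (2 * d * D) ^ 2 * K1 * (r * s) := by gcongr
        _ = _ := by ring
    have h5 := h3.trans h4
    rw [← le_div_iff₀ hcr] at h5
    calc _ ≤ _ := h5
      _ = B * s ^ 2 := by rw [hB]; field_simp
      _ = B * Real.log n ^ k := by rw [hss]
      _ ≤ _ := by gcongr; linarith

/-- With R = log (1/r), both differences lie within c (L + Λ)^(k+1) - c R^(k+1) for c = `countConst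
p`, which is O(L^k log L) because L - R = O(log L). -/
theorem eventually_card_sub_le (hp : ∀ j, 1 < p j)
    (hcop : ∀ i j, i ≠ j → Nat.Coprime (p i) (p j)) (hC : 1 ≤ C) :
    ∃ K ≥ 1, ∀ᶠ n : ℕ in atTop, ∀ r, IsTilt p d C n r →
      |((terms p n).card : ℝ) - countConst p * Real.log n ^ (k + 1)|
        ≤ K * (Real.log n ^ k * Real.log (Real.log n)) ∧
      ((terms p n \ terms p r⁻¹).card : ℝ) ≤ K * (Real.log n ^ k * Real.log (Real.log n)) := by
  obtain ⟨K, hK, hlog⟩ := eventually_isTilt_log (p := p) (d := d) hC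
  have hc := countConst_pos hp
  set Λ := ∑ j, Real.log (p j) with hΛ
  have hΛ0 : 0 ≤ Λ := Finset.sum_nonneg fun j _ => Real.log_nonneg (by exact_mod_cast (hp j).le)
  set B := countConst p * ((k + 1) * (K + Λ) * (1 + Λ) ^ k) with hB
  have hB0 : 0 ≤ B := by positivity
  refine ⟨B + 1, by linarith, ?_⟩
  filter_upwards [hlog, tendsto_log_natCast.eventually_ge_atTop 1, eventually_ge_atTop 1,
    (Real.tendsto_log_atTop.comp tendsto_log_natCast).eventually_ge_atTop 1,
    eventually_isTilt_of_eventually (p := p) (d := d) (C := C) (eventually_ge_atTop (1 : ℝ))]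
    with n hlog hL hn hLL hM r hr
  have hr0 := hr.pos
  have hn1 : (1 : ℝ) ≤ n := by exact_mod_cast hn
  obtain ⟨h1, h2, h3⟩ := hlog r hr
  simp only [Function.comp] at hLL
  have hMr := hM r hr
  have hR0 := Real.log_nonneg hMr
  obtain ⟨h4, h5⟩ := card_expSet_bounds hp hn1
  obtain ⟨h6, h7⟩ := card_expSet_bounds hp hMr
  rw [← hΛ] at h5
  set L := Real.log n
  set R := Real.log r⁻¹
  have key : countConst p * (L + Λ) ^ (k + 1) - countConst p * R ^ (k + 1)
      ≤ B * (L ^ k * Real.log L) := by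
    rw [← mul_sub]
    have h8 := sub_pow_le (a := L + Λ) (b := R) hR0 (by linarith) k
    calc _ ≤ countConst p * ((k + 1) * (L + Λ - R) * (L + Λ) ^ k) := by gcongr
      _ ≤ countConst p * ((k + 1) * ((K + Λ) * Real.log L) * ((1 + Λ) * L) ^ k) := by
          gcongr
          · nlinarith
          · nlinarith
      _ = _ := by rw [hB, mul_pow]; ring
  have hLR : countConst p * R ^ (k + 1) ≤ countConst p * L ^ (k + 1) := by gcongr
  have hX : 0 ≤ L ^ k * Real.log L := by positivity
  constructor
  · rw [card_terms hp hcop, abs_of_nonneg (by linarith)]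
    linarith
  · rw [Finset.card_sdiff_of_subset (terms_inv_subset hp hr0 hr.lower),
      Nat.cast_sub (Finset.card_le_card (terms_inv_subset hp hr0 hr.lower)), card_terms hp hcop,
      card_terms hp hcop]
    linarith

/-- Sums over `S` of functions with a limit at `0`. -/
theorem exists_sum_terms_asymp (hp : ∀ j, 1 < p j)
    (hcop : ∀ i j, i ≠ j → Nat.Coprime (p i) (p j)) (hC : 1 ≤ C) {f : ℝ → ℝ} {c0 B : ℝ}
    (hB : 0 ≤ B) (hf1 : ∀ x, 0 < x → |f x - c0| ≤ B * x) (hf2 : ∀ x, 0 < x → |f x - c0| ≤ B) :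
    ∃ K, ∀ᶠ n : ℕ in atTop, ∀ r, IsTilt p d C n r →
      |∑ h ∈ terms p n, f (r * h) - c0 * countConst p * Real.log n ^ (k + 1)|
        ≤ K * (Real.log n ^ k * Real.log (Real.log n)) := by
  classical
  obtain ⟨K1, hK1, h1⟩ := eventually_card_sub_le (d := d) hp hcop hC
  obtain ⟨K2, hK2, h2⟩ := eventually_sum_min_le hp hcop
  refine ⟨B * K2 + B * K1 + |c0| * K1, ?_⟩
  filter_upwards [h1, h2, tendsto_log_natCast.eventually_ge_atTop 1,
    (Real.tendsto_log_atTop.comp tendsto_log_natCast).eventually_ge_atTop 1]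
    with n h1 h2 hL hLL r hr
  have hr0 := hr.pos
  obtain ⟨h3, h4⟩ := h1 r hr
  have h5 := h2 r hr0
  simp only [Function.comp] at hLL
  set L := Real.log n
  have hsub := terms_inv_subset hp hr0 hr.lower
  have hX : L ^ k ≤ L ^ k * Real.log L := le_mul_of_one_le_right (by positivity) hLL
  have h6 : |∑ h ∈ terms p n, (f (r * h) - c0)| ≤ B * K2 * (L ^ k * Real.log L)
      + B * K1 * (L ^ k * Real.log L) := by
    calc _ ≤ ∑ h ∈ terms p n, |f (r * h) - c0| := Finset.abs_sum_le_sum_abs _ _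
      -- Below 1/r the error is linear in r h and summable against the minimum; above 1/r it is only
      -- bounded, but there are just O(L^k log L) such terms.
      _ = ∑ h ∈ terms p n \ terms p r⁻¹, |f (r * h) - c0|
          + ∑ h ∈ terms p r⁻¹, |f (r * h) - c0| := (Finset.sum_sdiff hsub).symm
      _ ≤ ∑ h ∈ terms p n \ terms p r⁻¹, B
          + ∑ h ∈ terms p r⁻¹, B * min (r * h) (r * h)⁻¹ := by
          refine add_le_add (Finset.sum_le_sum fun h hh => ?_) (Finset.sum_le_sum fun h hh => ?_)
          · have hh0 : (0 : ℝ) < h := by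
              exact_mod_cast pos_of_mem_terms hp (Finset.mem_sdiff.1 hh).1
            exact hf2 _ (by positivity)
          · have hh0 : (0 : ℝ) < h := by exact_mod_cast pos_of_mem_terms hp hh
            have h7 : r * h ≤ 1 := by
              have := ((mem_terms hp).1 hh).2
              calc r * h ≤ r * r⁻¹ := by gcongr
                _ = 1 := mul_inv_cancel₀ hr0.ne'
            rw [min_eq_left (h7.trans (one_le_inv_iff₀.2 ⟨by positivity, h7⟩))]
            exact hf1 _ (by positivity)
      _ ≤ ∑ h ∈ terms p n \ terms p r⁻¹, B
          + ∑ h ∈ terms p n, B * min (r * h) (r * h)⁻¹ := by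
          refine add_le_add le_rfl (Finset.sum_le_sum_of_subset_of_nonneg hsub fun h _ _ => ?_)
          exact mul_nonneg hB (le_min (by positivity) (by positivity))
      _ = (terms p n \ terms p r⁻¹).card * B + B * ∑ h ∈ terms p n, min (r * h) (r * h)⁻¹ := by
          rw [Finset.sum_const, nsmul_eq_mul, Finset.mul_sum]
      _ ≤ (K1 * (L ^ k * Real.log L)) * B + B * (K2 * (L ^ k * Real.log L)) := by
          gcongr
          exact h5.trans (by gcongr)
      _ = _ := by ring
  have e : ∑ h ∈ terms p n, f (r * h) - c0 * countConst p * L ^ (k + 1)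
      = ∑ h ∈ terms p n, (f (r * h) - c0)
        + c0 * ((terms p n).card - countConst p * L ^ (k + 1)) := by
    rw [Finset.sum_sub_distrib, Finset.sum_const, nsmul_eq_mul]; ring
  rw [e]
  calc _ ≤ (B * K2 * (L ^ k * Real.log L) + B * K1 * (L ^ k * Real.log L))
        + |c0| * (K1 * (L ^ k * Real.log L)) := by
        refine (abs_add_le _ _).trans (add_le_add h6 ?_)
        rw [abs_mul]
        gcongr
    _ = _ := by ring

end MultiBase

/-! ### Lévy continuity, and the asymptotics of mean and variance -/

namespace MultiBase

section Levy

open MeasureTheory ProbabilityTheory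

variable {α : Type*}

/-- The law of `Z` under the uniform distribution on a finite set, or a point mass if that set is
empty. -/
noncomputable def uniformLaw (s : Finset α) (Z : α → ℝ) : Measure ℝ :=
  if s.Nonempty then (s.card : ENNReal)⁻¹ • ∑ a ∈ s, Measure.dirac (Z a) else Measure.dirac 0

instance isProbabilityMeasure_uniformLaw (s : Finset α) (Z : α → ℝ) :
    IsProbabilityMeasure (uniformLaw s Z) := by
  unfold uniformLaw
  split_ifs with h
  · constructor
    rw [Measure.smul_apply, Measure.finsetSum_apply, smul_eq_mul]
    simp only [measure_univ, Finset.sum_const, nsmul_eq_mul, mul_one]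
    exact ENNReal.inv_mul_cancel (by exact_mod_cast h.card_pos.ne') (by simp)
  · infer_instance

theorem charFun_uniformLaw {s : Finset α} (hs : s.Nonempty) (Z : α → ℝ) (t : ℝ) :
    charFun (uniformLaw s Z) t = (∑ a ∈ s, Complex.exp ((t * Z a : ℝ) * Complex.I)) / s.card := by
  rw [charFun_apply_real, uniformLaw, if_pos hs, integral_smul_measure,
    integral_finsetSum_measure fun a _ => by
      exact integrable_dirac (by simp)]
  simp only [integral_dirac]
  rw [ENNReal.toReal_inv, ENNReal.toReal_natCast, Complex.real_smul]
  push_cast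
  rw [inv_mul_eq_div]

open Classical in
theorem uniformLaw_real_Iic {s : Finset α} (hs : s.Nonempty) (Z : α → ℝ) (x : ℝ) :
    (uniformLaw s Z).real (Set.Iic x) = ((s.filter fun a => Z a ≤ x).card : ℝ) / s.card := by
  rw [measureReal_def, uniformLaw, if_pos hs, Measure.smul_apply, Measure.finsetSum_apply,
    smul_eq_mul, ENNReal.toReal_mul, ENNReal.toReal_inv, ENNReal.toReal_natCast, inv_mul_eq_div]
  congr 1
  simp only [Measure.dirac_apply' _ measurableSet_Iic, Set.indicator, Set.mem_Iic, Pi.one_apply]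
  rw [← Finset.sum_filter, Finset.sum_const, nsmul_eq_mul, mul_one, ENNReal.toReal_natCast]

open Classical in
/-- Lévy's continuity theorem for uniform distributions on finite sets and a Gaussian limit. -/
theorem tendsto_card_filter_div_card {s : ℕ → Finset α} (hs : ∀ᶠ n in atTop, (s n).Nonempty)
    {Z : ℕ → α → ℝ}
    (h : ∀ t : ℝ, Tendsto
      (fun n => (∑ a ∈ s n, Complex.exp ((t * Z n a : ℝ) * Complex.I)) / (s n).card)
      atTop (𝓝 (Real.exp (-(t ^ 2 / 2)) : ℝ))) (x : ℝ) :
    Tendsto (fun n => (((s n).filter fun a => Z n a ≤ x).card : ℝ) / (s n).card) atTop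
      (𝓝 ((gaussianReal 0 1).real (Set.Iic x))) := by
  let ν : ℕ → ProbabilityMeasure ℝ := fun n => ⟨uniformLaw (s n) (Z n), inferInstance⟩
  let γ : ProbabilityMeasure ℝ := ⟨gaussianReal 0 1, inferInstance⟩
  have hν : Tendsto ν atTop (𝓝 γ) := by
    refine ProbabilityMeasure.tendsto_of_tendsto_charFun fun t => ?_
    have e : charFun (γ : Measure ℝ) t = (Real.exp (-(t ^ 2 / 2)) : ℝ) := by
      change charFun (gaussianReal 0 1) t = _
      rw [charFun_gaussianReal]
      push_cast
      congr 1
      simp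
    rw [e]
    refine (h t).congr' ?_
    filter_upwards [hs] with n hn
    exact (charFun_uniformLaw hn (Z n) t).symm
  -- Weak convergence passes to distribution functions at x because the Gaussian has no atoms.
  have hfr : (γ : Measure ℝ) (frontier (Set.Iic x)) = 0 := by
    change gaussianReal 0 1 _ = 0
    rw [frontier_Iic]
    have := nullSingletonClass_gaussianReal (μ := 0) (v := 1) one_ne_zero
    exact measure_singleton x
  have h1 := ProbabilityMeasure.tendsto_measure_of_null_frontier_of_tendsto' hν hfr
  have h2 := (ENNReal.tendsto_toReal (measure_ne_top (γ : Measure ℝ) _)).comp h1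
  refine h2.congr' ?_
  filter_upwards [hs] with n hn
  exact uniformLaw_real_Iic hn (Z n) x

end Levy

variable {k : ℕ} {p : Fin (k + 1) → ℕ} {d : ℕ} {C : ℝ}

theorem exists_tiltMean_asymp (hp : ∀ j, 1 < p j)
    (hcop : ∀ i j, i ≠ j → Nat.Coprime (p i) (p j)) (hd : 2 ≤ d) (hC : 1 ≤ C) :
    ∃ K, ∀ᶠ n : ℕ in atTop, ∀ r, IsTilt p d C n r →
      |tiltMean p d n r - (d - 1) / 2 * countConst p * Real.log n ^ (k + 1)|
        ≤ K * (Real.log n ^ k * Real.log (Real.log n)) := by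
  have hd1 : (1 : ℝ) ≤ d := by exact_mod_cast (by omega : 1 ≤ d)
  have h3 : (d : ℝ) ≤ d ^ 3 := le_self_pow₀ hd1 (by norm_num)
  refine exists_sum_terms_asymp (d := d) hp hcop hC (B := d ^ 3) (by positivity)
    (fun x hx => abs_digitMean_sub_le hd hx.le) fun x _ => ?_
  have h1 := digitMean_nonneg (x := x) hd
  have h2 := digitMean_le (x := x) hd
  rw [abs_le]; constructor <;> linarith

theorem exists_tiltVar_asymp (hp : ∀ j, 1 < p j)
    (hcop : ∀ i j, i ≠ j → Nat.Coprime (p i) (p j)) (hd : 2 ≤ d) (hC : 1 ≤ C) :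
    ∃ K, ∀ᶠ n : ℕ in atTop, ∀ r, IsTilt p d C n r →
      |tiltVar p d n r - (d - 1) * (d + 1) / 12 * countConst p * Real.log n ^ (k + 1)|
        ≤ K * (Real.log n ^ k * Real.log (Real.log n)) := by
  have hd1 : (1 : ℝ) ≤ d := by exact_mod_cast (by omega : 1 ≤ d)
  have h3 : (d : ℝ) ^ 2 ≤ d ^ 4 := pow_le_pow_right₀ hd1 (by norm_num)
  have h4 : (1 : ℝ) ≤ d ^ 2 := one_le_pow₀ hd1
  refine exists_sum_terms_asymp (d := d) hp hcop hC (B := 3 * d ^ 4) (by positivity)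
    (fun x hx => abs_digitVar_sub_le hd hx.le) fun x _ => ?_
  have h1 := digitVar_nonneg (x := x) hd
  have h2 := digitVar_le (x := x) hd
  rw [abs_le]; constructor <;> nlinarith

/-- The mean and the variance of the sum of digits. -/
theorem exists_mean_variance_asymp (hk : 1 ≤ k) (hp : ∀ j, 1 < p j)
    (hcop : ∀ i j, i ≠ j → Nat.Coprime (p i) (p j)) (hd : 2 ≤ d) (hC : 1 ≤ C) :
    ∃ K, ∀ᶠ n : ℕ in atTop, ∀ r, IsTilt p d C n r →
      |mean p d n - (d - 1) / 2 * countConst p * Real.log n ^ (k + 1)|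
        ≤ K * (Real.log n ^ k * Real.log (Real.log n)) ∧
      |variance p d n - (d - 1) * (d + 1) / 12 * countConst p * Real.log n ^ (k + 1)|
        ≤ K * (Real.log n ^ k * Real.log (Real.log n)) := by
  obtain ⟨K1, hK1, h1⟩ := exists_moment_bounds hk hp hcop hd hC
  obtain ⟨K2, h2⟩ := exists_tiltMean_asymp hp hcop hd hC
  obtain ⟨K3, h3⟩ := exists_tiltVar_asymp hp hcop hd hC
  refine ⟨|K2| + |K3| + K1 + K1 ^ 2, ?_⟩
  filter_upwards [h1, h2, h3, eventually_sqrt_log_pow_ge hk 1,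
    (Real.tendsto_log_atTop.comp tendsto_log_natCast).eventually_ge_atTop 1,
    tendsto_log_natCast.eventually_ge_atTop 1] with n h1 h2 h3 hs hLL hL r hr
  obtain ⟨hne, h4, h5⟩ := h1 r hr
  have h6 := h2 r hr
  have h7 := h3 r hr
  simp only [Function.comp] at hLL
  rw [mean_eq hp hd hne r, variance_eq hp hd hne r]
  set E := expect p d n (centredSum p d n r)
  set L := Real.log n
  set s := Real.sqrt (L ^ k)
  have hss : s ^ 2 = L ^ k := Real.sq_sqrt (by positivity)
  set X := L ^ k * Real.log L with hX
  have hLX : L ^ k ≤ X := le_mul_of_one_le_right (by positivity) hLL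
  have hX0 : 0 ≤ X := by positivity
  have hsX : s ≤ X := by nlinarith
  have hE : |E| ≤ K1 * X := h4.trans (by gcongr)
  have hE2 : E ^ 2 ≤ K1 ^ 2 * X := by
    rw [← sq_abs]
    calc |E| ^ 2 ≤ (K1 * s) ^ 2 := by gcongr
      _ = K1 ^ 2 * L ^ k := by rw [mul_pow, hss]
      _ ≤ _ := by gcongr
  have h8 : K1 * L ^ k ≤ K1 * X := by gcongr
  have h9 : K2 * X ≤ |K2| * X := by gcongr; exact le_abs_self _
  have h10 : K3 * X ≤ |K3| * X := by gcongr; exact le_abs_self _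
  have h11 : 0 ≤ |K2| * X := by positivity
  have h12 : 0 ≤ |K3| * X := by positivity
  have h13 : 0 ≤ K1 ^ 2 * X := by positivity
  have h14 : 0 ≤ K1 * X := by positivity
  have h15 := sq_nonneg E
  rw [abs_le] at h5 h6 h7 hE
  rw [abs_le, abs_le]
  constructor <;> constructor <;> linarith

end MultiBase

/-! ### The characteristic function of the normalised digit sum -/

namespace MultiBase

section CharFun

variable {m : ℕ} {p : Fin m → ℕ} {d n : ℕ} {r : ℝ}

/-- The characteristic function of a centred digit, before taking expectations. -/
noncomputable def centredPhase (d : ℕ) (t x : ℝ) (j : ℕ) : ℂ :=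
  Complex.exp ((t * (j - digitMean d x) : ℝ) * Complex.I)

theorem norm_centredPhase (d : ℕ) (t x : ℝ) (j : ℕ) : ‖centredPhase d t x j‖ = 1 :=
  Complex.norm_exp_ofReal_mul_I _

theorem norm_centredPhase_sub_one_le (hd : 2 ≤ d) (t x : ℝ) {j : ℕ} (hj : j < d) :
    ‖centredPhase d t x j - 1‖ ≤ |t| * d := by
  unfold centredPhase
  rw [mul_comm]
  refine (Real.norm_exp_I_mul_ofReal_sub_one_le (x := t * (j - digitMean d x))).trans ?_
  rw [Real.norm_eq_abs, abs_mul]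
  gcongr
  exact abs_digit_sub_mean_le hd hj

theorem prod_centredPhase (t : ℝ) (a : ℕ →₀ ℕ) :
    ∏ h ∈ terms p n, centredPhase d t (r * h) (a h)
      = Complex.exp ((t * centredSum p d n r a : ℝ) * Complex.I) := by
  unfold centredPhase centredSum
  rw [← Complex.exp_sum, Finset.mul_sum, ← Finset.sum_mul, ← Complex.ofReal_sum]

/-- In modulus, weighting by e^(itj) is a translation of the frequency by t / (2π); the centring is
a unimodular constant. -/
theorem norm_digitExp_centredPhase_mul_ech (t x y : ℝ) :
    ‖digitExp d x fun j => centredPhase d t x j * ech (j * y)‖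
      = ‖digitExp d x fun j => ech (j * (y + t / (2 * Real.pi)))‖ := by
  have hpi := Real.pi_pos
  have e : (fun j : ℕ => centredPhase d t x j * ech (j * y)) = fun j : ℕ =>
      Complex.exp ((-(t * digitMean d x) : ℝ) * Complex.I)
        * ech (j * (y + t / (2 * Real.pi))) := by
    funext j
    unfold centredPhase ech
    rw [← Complex.exp_add, ← Complex.exp_add, ← add_mul, ← add_mul, ← Complex.ofReal_add,
      ← Complex.ofReal_add]
    congr 3
    field_simp
    ring
  rw [e, digitExp_const_mul, norm_mul, Complex.norm_exp_ofReal_mul_I, one_mul]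

/-- `cosGap_le_add` undoes the translation at the price of half the decay rate and a factor e^(ρt²),
ρ being `digitRate d`. For t² of order one over the number of terms, the product of these factors is
bounded. -/
theorem norm_digitExp_centredPhase_mul_ech_le (hp : ∀ j, 1 < p j) (hd : 2 ≤ d) (hr : 0 < r)
    (t θ : ℝ) (h : ℕ) :
    ‖digitExp d (r * h) fun j => centredPhase d t (r * h) j * ech (j * (h * θ))‖
      ≤ factorBound (digitRate d / 2) (terms p r⁻¹) θ h * Real.exp (digitRate d * t ^ 2) := by
  have hc := digitRate_pos hd
  unfold factorBound
  split_ifs with hh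
  · rw [norm_digitExp_centredPhase_mul_ech, ← Real.exp_add]
    have h1 := ((mem_terms hp).1 hh).2
    have h2 : r * h ≤ 1 := by
      calc r * h ≤ r * r⁻¹ := by gcongr
        _ = 1 := mul_inv_cancel₀ hr.ne'
    refine (norm_digitExp_ech_le hd (by positivity) h2 _).trans ?_
    rw [Real.exp_le_exp]
    have h3 := cosGap_le_add (h * θ) (t / (2 * Real.pi))
    have h4 := cosGap_le_sq (t / (2 * Real.pi))
    have h5 : 20 * (t / (2 * Real.pi)) ^ 2 ≤ t ^ 2 := by
      have hpi := Real.pi_gt_three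
      rw [div_pow, mul_div_assoc', div_le_iff₀ (by positivity)]
      nlinarith [sq_nonneg t, mul_nonneg (sq_nonneg t) (by nlinarith : 0 ≤ Real.pi ^ 2 - 9)]
    nlinarith
  · rw [one_mul]
    exact (norm_digitExp_le hd fun j _ => by
      rw [norm_mul, norm_ech, norm_centredPhase, mul_one]).trans (Real.one_le_exp (by positivity))

theorem norm_digitExp_centredPhase_mul_le (hp : ∀ j, 1 < p j) (hd : 2 ≤ d) (hr : 0 < r)
    (t θ : ℝ) (h : ℕ) :
    ‖digitExp d (r * h) (centredPhase d t (r * h)) * digitExp d (r * h) fun j => ech (j * (h * θ))‖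
      ≤ factorBound (digitRate d / 2) (terms p r⁻¹) θ h * Real.exp (digitRate d * t ^ 2) := by
  have hc := digitRate_pos hd
  have h1 : ‖digitExp d (r * h) (centredPhase d t (r * h))‖ ≤ 1 :=
    norm_digitExp_le hd fun j _ => (norm_centredPhase _ _ _ _).le
  have h2 := norm_digitExp_ech_le_factorBound hp hd hr θ h
  have h3 : factorBound (digitRate d) (terms p r⁻¹) θ h
      ≤ factorBound (digitRate d / 2) (terms p r⁻¹) θ h := by
    unfold factorBound
    split_ifs
    · rw [Real.exp_le_exp]
      nlinarith [mul_nonneg hc.le (cosGap_nonneg (h * θ))]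
    · exact le_rfl
  have h4 : 0 ≤ factorBound (digitRate d / 2) (terms p r⁻¹) θ h :=
    (Real.exp_pos _).le.trans (factorBound_ge (by positivity) _ _ _)
  rw [norm_mul]
  calc _ ≤ 1 * factorBound (digitRate d / 2) (terms p r⁻¹) θ h := by
        gcongr
        exact h2.trans h3
    _ = factorBound (digitRate d / 2) (terms p r⁻¹) θ h * 1 := by ring
    _ ≤ _ := by
        gcongr
        exact Real.one_le_exp (by positivity)

/-- The conditional characteristic function is compared with that of independent digits by
decoupling each digit from its phase, one covariance at a time. Each costs O(|t|) times `shift`,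
since the phase of the digit is within |t| d of 1. -/
theorem norm_avg_exp_centredSum_sub_le (hp : ∀ j, 1 < p j) (hd : 2 ≤ d) (hr : 0 < r)
    (hrn : 1 ≤ r * n) (t : ℝ) :
    ‖(avg p d n fun a => Complex.exp ((t * centredSum p d n r a : ℝ) * Complex.I))
        - ∏ h ∈ terms p n, digitExp d (r * h) (centredPhase d t (r * h))‖ * ‖tiltProb p d n r‖
      ≤ Real.exp (digitRate d * t ^ 2) ^ (terms p n).card
        * (2 * (|t| * d) * Real.exp (digitRate d))
        * ∫ θ in (-1 / 2 : ℝ)..1 / 2,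
          decay (digitRate d / 2) (terms p r⁻¹) θ * shiftSum p d n r θ ^ (0 + 1) := by
  have hc := digitRate_pos hd
  set P := ∏ h ∈ terms p n, digitExp d (r * h) (centredPhase d t (r * h)) with hP
  have e1 : (avg p d n fun a => Complex.exp ((t * centredSum p d n r a : ℝ) * Complex.I))
      * tiltProb p d n r = tiltInt p d n r fun h j => centredPhase d t (r * h) j := by
    rw [← avg_prod_mul_tiltProb hp hd n r fun h j => centredPhase d t (r * h) j]
    simp only [prod_centredPhase]
  have hce := continuous_ech
  have hc1 := fun h : ℕ => continuous_digitExp_ech d (r * h) h (centredPhase d t (r * h))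
  have hc2 := fun h : ℕ => continuous_digitExp_ech d (r * h) h fun _ => 1
  have e2 : (avg p d n fun a => Complex.exp ((t * centredSum p d n r a : ℝ) * Complex.I))
      * tiltProb p d n r - P * tiltProb p d n r = ∫ θ in (-1 / 2 : ℝ)..1 / 2,
        ((∏ h ∈ terms p n, digitExp d (r * h) fun j => centredPhase d t (r * h) j
          * ech (j * (h * θ))) - ∏ h ∈ terms p n, (digitExp d (r * h) (centredPhase d t (r * h))
          * digitExp d (r * h) fun j => ech (j * (h * θ)))) * ech (-(n * θ)) := by
    rw [e1]
    unfold tiltProb tiltInt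
    rw [← intervalIntegral.integral_const_mul, ← intervalIntegral.integral_sub
      (Continuous.intervalIntegrable (by fun_prop) _ _)
      (Continuous.intervalIntegrable (by fun_prop) _ _)]
    congr 1
    funext θ
    rw [Finset.prod_mul_distrib, ← hP]
    simp only [one_mul]
    ring
  rw [← norm_mul, sub_mul, e2, ← intervalIntegral.integral_const_mul]
  have hcd := continuous_decay (digitRate d / 2) (terms p r⁻¹)
  have hcs := continuous_shiftSum p d n r
  refine intervalIntegral.norm_integral_le_of_norm_le (by norm_num)
    (Filter.Eventually.of_forall fun θ _ => ?_) (Continuous.intervalIntegrable (by fun_prop) _ _)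
  rw [norm_mul, norm_ech, mul_one]
  have h1 := norm_prod_sub_prod_le (terms p n) (Real.exp_pos (-(2 * (digitRate d / 2))))
    (fun h _ => norm_digitExp_centredPhase_mul_ech_le hp hd hr t θ h)
    (fun h _ => norm_digitExp_centredPhase_mul_le hp hd hr t θ h)
    (fun h _ => (factorBound_ge (by positivity) (terms p r⁻¹) θ h).trans
      (le_mul_of_one_le_right ((Real.exp_pos _).le.trans (factorBound_ge (by positivity) _ _ _))
        (Real.one_le_exp (by positivity))))
  refine h1.trans ?_
  rw [Finset.prod_mul_distrib, prod_factorBound _ (terms_inv_subset hp hr hrn),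
    Finset.prod_const]
  have h2 : ∀ h ∈ terms p n, ‖(digitExp d (r * h) fun j => centredPhase d t (r * h) j
      * ech (j * (h * θ))) - digitExp d (r * h) (centredPhase d t (r * h))
      * digitExp d (r * h) fun j => ech (j * (h * θ))‖ / Real.exp (-(2 * (digitRate d / 2)))
      ≤ 2 * (|t| * d) * Real.exp (digitRate d) * shift d r θ h := by
    intro h _
    have h3 := digitExp_cov_le (x := r * h) hd (by positivity)
      (fun j hj => norm_centredPhase_sub_one_le hd t (r * h) hj) (h * θ)
    rw [div_le_iff₀ (Real.exp_pos _)]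
    refine h3.trans (le_of_eq ?_)
    have h5 : Real.exp (digitRate d) * Real.exp (-digitRate d) = 1 := by
      rw [← Real.exp_add, add_neg_cancel, Real.exp_zero]
    rw [show -(2 * (digitRate d / 2)) = -digitRate d by ring, ← shift]
    linear_combination -(2 * (|t| * d) * shift d r θ h) * h5
  have h4 := decay_pos (digitRate d / 2) (terms p r⁻¹) θ
  calc _ ≤ decay (digitRate d / 2) (terms p r⁻¹) θ
        * Real.exp (digitRate d * t ^ 2) ^ (terms p n).card
        * ∑ h ∈ terms p n, 2 * (|t| * d) * Real.exp (digitRate d) * shift d r θ h := by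
        gcongr with h hh
        exact h2 h hh
    _ = _ := by
        rw [← Finset.mul_sum, shiftSum]
        ring

/-- The central limit theorem for the independent digits: cubic Taylor errors added over all terms,
with no conditioning involved. -/
theorem norm_prod_digitExp_centredPhase_sub_le (hd : 2 ≤ d) (hr : 0 < r) (t : ℝ) :
    ‖∏ h ∈ terms p n, digitExp d (r * h) (centredPhase d t (r * h))
        - (Real.exp (-(t ^ 2 * tiltVar p d n r / 2)) : ℝ)‖
      ≤ 8 * d ^ 6 * (|t| ^ 3 + t ^ 4) * (terms p n).card := by
  have e : ((Real.exp (-(t ^ 2 * tiltVar p d n r / 2)) : ℝ) : ℂ)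
      = ∏ h ∈ terms p n, ((Real.exp (-(t ^ 2 * digitVar d (r * h) / 2)) : ℝ) : ℂ) := by
    rw [← Complex.ofReal_prod, ← Real.exp_sum, tiltVar, Finset.sum_neg_distrib, Finset.mul_sum,
      Finset.sum_div]
  rw [e]
  refine (norm_prod_sub_prod_le (β := fun _ => 1) (b0 := 1) _ one_pos (fun h _ => ?_)
    (fun h _ => ?_) fun _ _ => le_rfl).trans ?_
  · exact norm_digitExp_le hd fun j _ => (norm_centredPhase _ _ _ _).le
  · rw [Complex.norm_real, Real.norm_of_nonneg (Real.exp_pos _).le, Real.exp_le_one_iff]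
    have := digitVar_nonneg (x := r * h) hd
    rw [neg_nonpos]; positivity
  · rw [Finset.prod_const_one, one_mul, mul_comm _ ((terms p n).card : ℝ), ← nsmul_eq_mul]
    refine Finset.sum_le_card_nsmul _ _ _ fun h _ => ?_
    rw [div_one]
    refine (norm_digitExp_sub_gaussian_le (x := r * h) hd (by positivity) t).trans ?_
    refine mul_le_of_le_one_right (by positivity) ?_
    rw [Real.exp_le_one_iff, neg_nonpos]; positivity

end CharFun

theorem abs_exp_neg_sub_exp_neg_le {x y : ℝ} (hx : 0 ≤ x) (hy : 0 ≤ y) :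
    |Real.exp (-x) - Real.exp (-y)| ≤ |x - y| := by
  wlog h : x ≤ y generalizing x y
  · rw [abs_sub_comm, abs_sub_comm x]
    exact this hy hx (le_of_not_ge h)
  have h1 : Real.exp (-y) = Real.exp (-x) * Real.exp (-(y - x)) := by
    rw [← Real.exp_add]; ring_nf
  have h2 := Real.add_one_le_exp (-(y - x))
  have h3 : Real.exp (-x) ≤ 1 := Real.exp_le_one_iff.2 (by linarith)
  have h4 : Real.exp (-y) ≤ Real.exp (-x) := Real.exp_le_exp.2 (by linarith)
  have h5 := Real.exp_pos (-x)
  rw [abs_of_nonneg (by linarith), abs_of_nonpos (by linarith), h1]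
  nlinarith

variable {k : ℕ} {p : Fin (k + 1) → ℕ} {d : ℕ} {C : ℝ}

/-- The variance is of exact order `(log n) ^ (k + 1)`. -/
theorem exists_variance_ge (hk : 1 ≤ k) (hp : ∀ j, 1 < p j)
    (hcop : ∀ i j, i ≠ j → Nat.Coprime (p i) (p j)) (hd : 2 ≤ d) (hC : 1 ≤ C) :
    ∃ c > 0, ∀ᶠ n : ℕ in atTop, ∀ r, IsTilt p d C n r →
      c * Real.log n ^ (k + 1) ≤ variance p d n := by
  obtain ⟨K, h1⟩ := exists_mean_variance_asymp hk hp hcop hd hC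
  have hd2 : (2 : ℝ) ≤ d := by exact_mod_cast hd
  set c := ((d : ℝ) - 1) * (d + 1) / 12 * countConst p with hc
  have hc0 : 0 < c := mul_pos (by nlinarith) (countConst_pos hp)
  refine ⟨c / 2, by positivity, ?_⟩
  have h2 := (Real.isLittleO_log_id_atTop.comp_tendsto tendsto_log_natCast).def
    (c := c / (2 * (|K| + 1))) (by positivity)
  filter_upwards [h1, h2, tendsto_log_natCast.eventually_ge_atTop 1] with n h1 h2 hL r hr
  have h3 := (h1 r hr).2
  simp only [Function.comp, id] at h2
  set L := Real.log n
  rw [Real.norm_of_nonneg (Real.log_nonneg hL), Real.norm_of_nonneg (by positivity)] at h2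
  have h4 : K * (L ^ k * Real.log L) ≤ c / 2 * L ^ (k + 1) := by
    have hlog := Real.log_nonneg hL
    calc K * (L ^ k * Real.log L) ≤ (|K| + 1) * (L ^ k * (c / (2 * (|K| + 1)) * L)) := by
          gcongr
          linarith [le_abs_self K]
      _ = _ := by rw [pow_succ]; field_simp
  rw [abs_le] at h3
  linarith

set_option maxHeartbeats 800000 in
/-- The characteristic function of the normalised sum of digits. -/
theorem exists_norm_avg_exp_sub_le (hk : 1 ≤ k) (hp : ∀ j, 1 < p j)
    (hcop : ∀ i j, i ≠ j → Nat.Coprime (p i) (p j)) (hd : 2 ≤ d) (hC : 1 ≤ C) (τ : ℝ) :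
    ∃ K, ∀ᶠ n : ℕ in atTop, ∀ r, IsTilt p d C n r →
      ‖(avg p d n fun a => Complex.exp ((τ * (((digitSum a : ℝ) - mean p d n)
          / Real.sqrt (variance p d n)) : ℝ) * Complex.I)) - (Real.exp (-(τ ^ 2 / 2)) : ℝ)‖
        ≤ K / Real.sqrt (Real.log n) := by
  obtain ⟨c, hc, hP⟩ := exists_tiltProb_ge hk hp hcop hd hC
  obtain ⟨K0, hK0, h0⟩ := exists_integral_decay_mul_shiftSum_le (d := d) hk hp hcop hC
    (c := digitRate d / 2) (half_pos (digitRate_pos hd)) 0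
  obtain ⟨K1, hK1, hmom⟩ := exists_moment_bounds hk hp hcop hd hC
  obtain ⟨K2, hK2, hcard⟩ := eventually_card_terms_le hp hcop
  obtain ⟨c1, hc1, hvar⟩ := exists_variance_ge hk hp hcop hd hC
  set ρ := digitRate d with hρ
  have hρ0 : 0 < ρ := digitRate_pos hd
  set B := |τ| / Real.sqrt c1 with hB
  have hB0 : 0 ≤ B := by positivity
  set D := 2 * d * Real.exp ρ * Real.exp (ρ * (K2 * B ^ 2)) * K0 / c with hD
  refine ⟨D * B + 8 * d ^ 6 * (B ^ 3 + B ^ 4) * K2 + B ^ 2 * (K1 + K1 ^ 2) + K1 * B, ?_⟩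
  filter_upwards [hP, h0, hmom, hcard, hvar, eventually_sqrt_log_pow_ge hk 1,
    tendsto_log_natCast.eventually_ge_atTop 1] with n hP h0 hmom hcard hvar hs1 hL r hr
  have hr0 := hr.pos
  have hPr := hP r hr
  have h0r := h0 r hr
  obtain ⟨hne, hE, hE2⟩ := hmom r hr
  have hV := hvar r hr
  have hveq := variance_eq hp hd hne r
  have hmeq := mean_eq hp hd hne r
  set E := expect p d n (centredSum p d n r) with hEdef
  set v := variance p d n with hv
  set L := Real.log n with hLdef
  set s := Real.sqrt (L ^ k) with hs
  set q := Real.sqrt L with hq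
  have hq1 : 1 ≤ q := Real.one_le_sqrt.2 hL
  have hq0 : 0 < q := by linarith
  have hs0 : 0 < s := by linarith
  have hss : s ^ 2 = L ^ k := Real.sq_sqrt (by positivity)
  have hqq : q ^ 2 = L := Real.sq_sqrt (by positivity)
  have hsq : (s * q) ^ 2 = L ^ (k + 1) := by rw [mul_pow, hss, hqq, pow_succ]
  have hv0 : 0 < v := lt_of_lt_of_le (by positivity) hV
  set t := τ / Real.sqrt v with ht
  have hσ : Real.sqrt c1 * (s * q) ≤ Real.sqrt v := by
    rw [← Real.sqrt_sq (by positivity : 0 ≤ s * q), ← Real.sqrt_mul hc1.le, hsq]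
    exact Real.sqrt_le_sqrt hV
  -- The variance is at least c1 L^(k+1) = c1 (s q)², so t is O(1/(s q)), and |t| s gains the
  -- decisive factor 1/q = L^(-1/2).
  have htB : |t| * (s * q) ≤ B := by
    have hc1' := Real.sqrt_pos.2 hc1
    have hv' := Real.sqrt_pos.2 hv0
    rw [ht, hB, abs_div, abs_of_pos hv', div_mul_eq_mul_div, div_le_div_iff₀ hv' hc1', mul_assoc]
    gcongr
    linarith
  have htB2 : t ^ 2 * L ^ (k + 1) ≤ B ^ 2 := by
    rw [← sq_abs t, ← hsq, ← mul_pow]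
    gcongr
  have ht2v : t ^ 2 * v = τ ^ 2 := by
    rw [ht, div_pow, Real.sq_sqrt hv0.le, div_mul_cancel₀ _ hv0.ne']
  have hts : |t| * s ≤ B / q := by
    rw [le_div_iff₀ hq0, mul_assoc]; exact htB
  -- The number of terms times t² is bounded, so the accumulated losses e^(ρt²) stay bounded.
  have hcB : (terms p n).card * t ^ 2 ≤ K2 * B ^ 2 := by
    calc _ ≤ K2 * L ^ (k + 1) * t ^ 2 := by gcongr
      _ = K2 * (t ^ 2 * L ^ (k + 1)) := by ring
      _ ≤ _ := by gcongr
  set Φ := avg p d n fun a => Complex.exp ((t * centredSum p d n r a : ℝ) * Complex.I) with hΦ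
  set P := ∏ h ∈ terms p n, digitExp d (r * h) (centredPhase d t (r * h)) with hPdef
  have err1 : ‖Φ - P‖ ≤ D * B / q := by
    have h1 := norm_avg_exp_centredSum_sub_le hp hd hr0 hr.lower t
    rw [← hΦ, ← hPdef, ← Real.exp_nat_mul] at h1
    have h2 : ‖Φ - P‖ * (c * (r / s)) ≤ Real.exp (ρ * (K2 * B ^ 2))
        * (2 * (|t| * d) * Real.exp ρ) * (K0 * (r * s ^ 0)) := by
      refine (mul_le_mul_of_nonneg_left hPr (norm_nonneg _)).trans (h1.trans ?_)
      have hI : 0 ≤ ∫ θ in (-1 / 2 : ℝ)..1 / 2,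
          decay (ρ / 2) (terms p r⁻¹) θ * shiftSum p d n r θ ^ (0 + 1) :=
        intervalIntegral.integral_nonneg (by norm_num) fun θ _ =>
          mul_nonneg (decay_pos _ _ _).le (pow_nonneg (shiftSum_nonneg _ _ _ _ _) _)
      have hX : (terms p n).card * (ρ * t ^ 2) ≤ ρ * (K2 * B ^ 2) := by
        calc (terms p n).card * (ρ * t ^ 2) = ρ * ((terms p n).card * t ^ 2) := by ring
          _ ≤ _ := by gcongr
      have hX' := Real.exp_le_exp.2 hX
      gcongr
    rw [← le_div_iff₀ (by positivity)] at h2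
    calc _ ≤ _ := h2
      _ = D * (|t| * s) := by rw [hD]; field_simp
      _ ≤ D * (B / q) := by gcongr
      _ = _ := by ring
  have err2 : ‖P - (Real.exp (-(t ^ 2 * tiltVar p d n r / 2)) : ℝ)‖
      ≤ 8 * d ^ 6 * (B ^ 3 + B ^ 4) * K2 / q := by
    refine (norm_prod_digitExp_centredPhase_sub_le hd hr0 t).trans ?_
    rw [le_div_iff₀ hq0]
    have hsq1 : 1 ≤ s * q := one_le_mul_of_one_le_of_one_le hs1 hq1
    have hqs : q ≤ s * q := le_mul_of_one_le_left hq0.le hs1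
    have h3 : (|t| * (s * q)) ^ 3 ≤ B ^ 3 := by gcongr
    have h4 : (|t| * (s * q)) ^ 4 ≤ B ^ 4 := by gcongr
    have h5 : |t| ^ 3 * (s * q) ^ 2 * q ≤ B ^ 3 := by
      refine le_trans ?_ h3
      calc _ ≤ |t| ^ 3 * (s * q) ^ 2 * (s * q) := by gcongr
        _ = _ := by ring
    have h6 : t ^ 4 * (s * q) ^ 2 * q ≤ B ^ 4 := by
      refine le_trans ?_ h4
      have e : t ^ 4 = |t| ^ 4 := (Even.pow_abs (by decide) t).symm
      rw [e]
      calc |t| ^ 4 * (s * q) ^ 2 * q = |t| ^ 4 * ((s * q) ^ 2 * 1 * q) := by ring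
        _ ≤ |t| ^ 4 * ((s * q) ^ 2 * (s * q) * (s * q)) := by gcongr
        _ = _ := by ring
    rw [← hsq] at hcard
    calc 8 * d ^ 6 * (|t| ^ 3 + t ^ 4) * (terms p n).card * q
        ≤ 8 * d ^ 6 * (|t| ^ 3 + t ^ 4) * (K2 * (s * q) ^ 2) * q := by gcongr
      _ = 8 * d ^ 6 * (|t| ^ 3 * (s * q) ^ 2 * q + t ^ 4 * (s * q) ^ 2 * q) * K2 := by ring
      _ ≤ _ := by gcongr
  have hvdiff : |tiltVar p d n r - v| ≤ (K1 + K1 ^ 2) * L ^ k := by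
    have h1 : E ^ 2 ≤ K1 ^ 2 * L ^ k := by
      rw [← sq_abs, ← hss, ← mul_pow]
      gcongr
    have h2 := sq_nonneg E
    have h3 : 0 ≤ K1 ^ 2 * L ^ k := by positivity
    rw [add_mul, hveq]
    rw [abs_le] at hE2 ⊢
    constructor <;> linarith
  have hLq : q ≤ L := by nlinarith
  have err3 : ‖((Real.exp (-(t ^ 2 * tiltVar p d n r / 2)) : ℝ) : ℂ)
      - (Real.exp (-(τ ^ 2 / 2)) : ℝ)‖ ≤ B ^ 2 * (K1 + K1 ^ 2) / q := by
    rw [← Complex.ofReal_sub, Complex.norm_real, Real.norm_eq_abs]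
    have htv : 0 ≤ tiltVar p d n r := Finset.sum_nonneg fun _ _ => digitVar_nonneg hd
    refine (abs_exp_neg_sub_exp_neg_le (by positivity) (by positivity)).trans ?_
    have e : t ^ 2 * tiltVar p d n r / 2 - τ ^ 2 / 2 = t ^ 2 / 2 * (tiltVar p d n r - v) := by
      rw [← ht2v]; ring
    rw [e, abs_mul, abs_of_nonneg (by positivity), le_div_iff₀ hq0]
    calc t ^ 2 / 2 * |tiltVar p d n r - v| * q ≤ t ^ 2 * ((K1 + K1 ^ 2) * L ^ k) * L := by
          gcongr
          linarith [sq_nonneg t]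
      _ = t ^ 2 * L ^ (k + 1) * (K1 + K1 ^ 2) := by rw [pow_succ]; ring
      _ ≤ _ := by gcongr
  have hΦ1 : ‖Φ‖ ≤ 1 := by
    have hc0 : (0 : ℝ) < (reps p d n).card := by exact_mod_cast hne.card_pos
    rw [hΦ, avg, norm_div, Complex.norm_natCast, div_le_one hc0]
    refine (norm_sum_le _ _).trans ?_
    simp only [Complex.norm_exp_ofReal_mul_I, Finset.sum_const, nsmul_eq_mul, mul_one, le_refl]
  have hmain : (avg p d n fun a => Complex.exp ((τ * (((digitSum a : ℝ) - mean p d n)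
      / Real.sqrt v) : ℝ) * Complex.I)) = Complex.exp ((-(t * E) : ℝ) * Complex.I) * Φ := by
    rw [hΦ, ← avg_const_mul]
    refine avg_congr fun a ha => ?_
    rw [← Complex.exp_add, ← add_mul, ← Complex.ofReal_add, digitSum_eq_centredSum hp hd r ha, hmeq,
      ht]
    congr 3
    ring
  -- Recentring from the independent mean to the true mean is a rotation by t E with |E| ≤ K1 s,
  -- hence again O(1/q).
  have err0 : ‖Complex.exp ((-(t * E) : ℝ) * Complex.I) * Φ - Φ‖ ≤ K1 * B / q := by
    rw [← sub_one_mul, norm_mul]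
    have h1 := Real.norm_exp_I_mul_ofReal_sub_one_le (x := -(t * E))
    rw [mul_comm Complex.I, Real.norm_eq_abs, abs_neg, abs_mul] at h1
    calc _ ≤ |t| * |E| * 1 := by gcongr
      _ ≤ |t| * (K1 * s) * 1 := by gcongr
      _ = K1 * (|t| * s) := by ring
      _ ≤ K1 * (B / q) := by gcongr
      _ = _ := by ring
  rw [hmain]
  set G := ((Real.exp (-(t ^ 2 * tiltVar p d n r / 2)) : ℝ) : ℂ)
  set G' := ((Real.exp (-(τ ^ 2 / 2)) : ℝ) : ℂ)
  set Ψ := Complex.exp ((-(t * E) : ℝ) * Complex.I) * Φ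
  -- The four errors come from recentring, from decoupling the condition, from the Gaussian
  -- approximation, and from replacing the independent variance by the conditional one.
  calc ‖Ψ - G'‖ = ‖(Ψ - Φ) + (Φ - P) + (P - G) + (G - G')‖ := by congr 1; ring
    _ ≤ ‖Ψ - Φ‖ + ‖Φ - P‖ + ‖P - G‖ + ‖G - G'‖ := norm_add₄_le
    _ ≤ K1 * B / q + D * B / q + 8 * d ^ 6 * (B ^ 3 + B ^ 4) * K2 / q
        + B ^ 2 * (K1 + K1 ^ 2) / q := by gcongr
    _ = _ := by ring

theorem tendsto_prob_le (hk : 1 ≤ k) (hp : ∀ j, 1 < p j)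
    (hcop : ∀ i j, i ≠ j → Nat.Coprime (p i) (p j)) (hd : 2 ≤ d) (hC : 1 ≤ C)
    (hr : ∀ᶠ n : ℕ in atTop, ∃ r, IsTilt p d C n r)
    (hne : ∀ᶠ n : ℕ in atTop, (reps p d n).Nonempty) (x : ℝ) :
    Tendsto (fun n : ℕ => prob p d n fun a =>
        ((digitSum a : ℝ) - mean p d n) / Real.sqrt (variance p d n) ≤ x)
      atTop (𝓝 ((ProbabilityTheory.gaussianReal 0 1).real (Set.Iic x))) := by
  refine tendsto_card_filter_div_card hne (Z := fun n a =>
    ((digitSum a : ℝ) - mean p d n) / Real.sqrt (variance p d n)) (fun τ => ?_) x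
  obtain ⟨K, hK⟩ := exists_norm_avg_exp_sub_le hk hp hcop hd hC τ
  rw [tendsto_iff_norm_sub_tendsto_zero]
  have h0 : Tendsto (fun n : ℕ => K / Real.sqrt (Real.log n)) atTop (𝓝 0) :=
    (Real.tendsto_sqrt_atTop.comp tendsto_log_natCast).const_div_atTop K
  refine squeeze_zero' (Filter.Eventually.of_forall fun n => norm_nonneg _) ?_ h0
  filter_upwards [hK, hr] with n hK hr
  obtain ⟨r, hr⟩ := hr
  exact hK r hr

theorem kappa_eq {m : ℕ} (p : Fin m → ℕ) (d : ℕ) : kappa p d = Real.log d * countConst p := by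
  unfold kappa countConst
  ring

end MultiBase

theorem theorem3 (d m : ℕ) (hd : 2 ≤ d) (hm : 2 ≤ m) (p : Fin m → ℕ)
    (hp : ∀ j, 1 < p j) (hmono : StrictMono p)
    (hcop : ∀ i j, i ≠ j → Nat.Coprime (p i) (p j)) :
    -- for all large `n` there is a representation, so that a random one makes sense
    (∀ᶠ n : ℕ in atTop, (MultiBase.reps p d n).Nonempty) ∧
    -- the sum of digits, centred by its mean and scaled by its standard deviation,
    -- converges in distribution to the standard normal law
    (∀ x : ℝ, Tendsto
      (fun n : ℕ => MultiBase.prob p d n fun a =>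
        ((MultiBase.digitSum a : ℝ) - MultiBase.mean p d n)
          / Real.sqrt (MultiBase.variance p d n) ≤ x)
      atTop (𝓝 ((ProbabilityTheory.gaussianReal 0 1).real (Set.Iic x)))) ∧
    -- the mean
    ((fun n : ℕ => MultiBase.mean p d n
        - MultiBase.kappa p d * ((d : ℝ) - 1) / (2 * Real.log d) * Real.log n ^ m)
      =O[atTop] fun n : ℕ => Real.log n ^ (m - 1) * Real.log (Real.log n)) ∧
    -- the variance
    ((fun n : ℕ => MultiBase.variance p d n
        - MultiBase.kappa p d * ((d : ℝ) - 1) * ((d : ℝ) + 1) / (12 * Real.log d)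
          * Real.log n ^ m)
      =O[atTop] fun n : ℕ => Real.log n ^ (m - 1) * Real.log (Real.log n)) := by
  obtain ⟨k, rfl⟩ : ∃ k, m = k + 1 := ⟨m - 1, by omega⟩
  have hk : 1 ≤ k := by omega
  obtain ⟨C, hC, htilt⟩ := MultiBase.exists_isTilt hk hp hcop hd
  obtain ⟨_, -, hmom⟩ := MultiBase.exists_moment_bounds hk hp hcop hd hC
  obtain ⟨K, hasymp⟩ := MultiBase.exists_mean_variance_asymp hk hp hcop hd hC
  have hne : ∀ᶠ n : ℕ in atTop, (MultiBase.reps p d n).Nonempty := by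
    filter_upwards [htilt, hmom] with n ⟨r, hr⟩ h
    exact (h r hr).1
  have hlog : Real.log d ≠ 0 := (Real.log_pos (by exact_mod_cast (by omega : 1 < d))).ne'
  refine ⟨hne, MultiBase.tendsto_prob_le hk hp hcop hd hC htilt hne, ?_, ?_⟩
  · refine IsBigO.of_bound |K| ?_
    filter_upwards [htilt, hasymp] with n ⟨r, hr⟩ h
    have e : MultiBase.kappa p d * ((d : ℝ) - 1) / (2 * Real.log d)
        = (d - 1) / 2 * MultiBase.countConst p := by
      rw [MultiBase.kappa_eq]; field_simp
    rw [e, Nat.add_sub_cancel, ← Real.norm_eq_abs, ← norm_mul]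
    exact (h r hr).1.trans (Real.le_norm_self _)
  · refine IsBigO.of_bound |K| ?_
    filter_upwards [htilt, hasymp] with n ⟨r, hr⟩ h
    have e : MultiBase.kappa p d * ((d : ℝ) - 1) * ((d : ℝ) + 1) / (12 * Real.log d)
        = (d - 1) * (d + 1) / 12 * MultiBase.countConst p := by
      rw [MultiBase.kappa_eq]; field_simp
    rw [e, Nat.add_sub_cancel, ← Real.norm_eq_abs, ← norm_mul]
    exact (h r hr).2.trans (Real.le_norm_self _)
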